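/- Let $\mathbb B$ be the rootless infinite binary tree (the $3$-regular tree, obtained by joining the roots of two rooted infinite binary trees by an edge), with origin $o$ one of these two roots. A subtree is a nonempty connected vertex set $\mathcal T\subset\mathbb B$ (finite or infinite). On a finite subtree, a stable configuration $\eta\in\{1,2,3\}^{\mathcal T}$ is recurrent if there is no nonempty $S\subset\mathcal T$ such that every $u\in S$ satisfies $\eta_u\le|\{v\in S: v\sim u\}|$; $\mu_{\mathcal T}$ is the uniform measure on recurrent configurations. For infinite $\mathcal T$, $\mu_{\mathcal T}$ is the limit (in the sense of probabilities of cylinder events) of $\mu_{\mathcal S}$ along the net of finite subtrees $\mathcal S\uparrow\mathcal T$. A toppling at $u$ is legal if $\eta_u>3$; it removes $3$ grains from $u$ and adds one to each neighbour of $u$ in $\mathcal T$. $Av(o,\eta)$ is the set of vertices that topple when one grain is added to $\eta$ at $o$ and the configuration is stabilized by legal topplings. Let $A_n(o,\mathcal T)$ be the number of connected vertex sets $\mathscr C\subset\mathcal T$ with $o\in\mathscr C$ and $|\mathscr C|=n$, and $\kappa(o,\mathcal T)=\limsup_{n\to\infty}\frac1n\log A_n(o,\mathcal T)$ (with $\log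 0=-\infty$). A sequence $(a_n)$ decays exponentially if there are $C,c>0$ with $a_n\le Ce^{-cn}$ for all $n\ge1$. For $p\in[0,1]$, the binary branching process starts from its root, and each vertex independently has two children with probability $p$ and none with probability $1-p$; in the binomial branching process each of the two potential children of each vertex is present independently with probability $p$. The random binary (resp. binomial) tree is either the tree of one such process, rooted at $o$, or the rootless tree obtained by joining the roots of two independent copies by an edge, $o$ being one of the two roots. $\mathbb E$ denotes expectation over the random tree. **Theorem.** The limit $\mu_{\mathcal T}$ exists as a probability measure, and is unique, for every subtree $\mathcal T$ (and is the uniform measure above if $\mathcal T$ is finite). Moreover: (1) There is a constant $C>0$ such that for every subtree $\mathcal T\ni o$ and all $n\ge1$, $$\mu_{\mathcal T}(|Av(o,\eta)|=n)\le C\,A_n(o,\mathcal T)\,4^{-n}\,2^{16n/25}.$$ In particular, if $\kappa(o,\mathcal T)<\frac{34}{25}\log2$, then $\mu_{\mathcal T}(|Av(o,\eta)|=n)$ decays exponentially in $n$. (2) For the random binary tree, rooted or rootless, $\mu_{\mathcal T}(|Av(o,\eta)|=n)$ is an integrable random variable for every $p\in[0,1]$ and $n\ge1$; for every $p\in(0,1]$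 there is $C>0$ such that for all $n\ge1$, $$\mathbb E\big(\mu_{\mathcal T}(|Av(o,\eta)|=n)\big)\le C\,2^{16n/25}\Big(\frac{p+\sqrt p}{2}\Big)^n.$$ In particular there is $p_*=0.54511\ldots$ with $\frac{p_*+\sqrt{p_*}}2=2^{-16/25}$ such that for every $p\in[0,p_*)$ the averaged probability $\mathbb E(\mu_{\mathcal T}(|Av(o,\eta)|=n))$ decays exponentially in $n$. (3) For the random binomial tree, rooted or rootless, $\mu_{\mathcal T}(|Av(o,\eta)|=n)$ is an integrable random variable for every $p\in[0,1]$ and $n\ge1$; for every $p\in(0,1]$ there is $C>0$ such that for all $n\ge1$, $$\mathbb E\big(\mu_{\mathcal T}(|Av(o,\eta)|=n)\big)\le C\,2^{16n/25}\,p^n.$$ In particular, for every $p\in[0,1]$ with $p<2^{-16/25}$ (where $|2^{-16/25}-0.641713|<10^{-6}$) the averaged probability $\mathbb E(\mu_{\mathcal T}(|Av(o,\eta)|=n))$ decays exponentially in $n$. -/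

import Mathlib

open MeasureTheory ProbabilityTheory Filter Topology
open scoped ENNReal

noncomputable section

namespace TreeSandpile

/-! ### The lattice -/

/-- Vertices of the rootless infinite binary tree (Bethe lattice): two copies, labelled by a
Boolean, of the rooted infinite binary tree, whose vertices are finite words over `Bool`
(the empty word is the root; the two children of `w` are `b :: w`). -/
abbrev Vertex : Type := Bool × List Bool

/-- The rootless infinite binary tree: each vertex is joined to its two children, and the roots of
the two copies are joined by one further edge. -/
def bethe : SimpleGraph Vertex :=
  SimpleGraph.fromRel fun u v =>
    (∃ b : Bool, v = (u.1, b :: u.2)) ∨ (u = (false, []) ∧ v = (true, []))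

/-- The origin. -/
def origin : Vertex := (false, [])

/-- A subtree is a (nonempty) connected set of vertices, with the edges it inherits. -/
def IsSubtree (T : Set Vertex) : Prop := (bethe.induce T).Connected

/-- The finite subtrees of `T`, ordered by inclusion. -/
abbrev FiniteSubtree (T : Set Vertex) : Type :=
  {S : Finset Vertex // (S : Set Vertex) ⊆ T ∧ IsSubtree (S : Set Vertex)}

/-! ### The sandpile model on a subtree -/

/-- Height configurations. A configuration on a subtree `T` is extended by `0` outside `T`, so that
the configurations on all subtrees live in one space. -/
abbrev Config : Type := Vertex → ℤ

open Classical in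
/-- The toppling matrix of `T`: `3` on the diagonal, `-1` for neighbours in `T`. It is indexed by
`T`; entries with an index outside `T` are `0`. -/
def topplingMatrix (T : Set Vertex) (u v : Vertex) : ℤ :=
  if u ∈ T ∧ v ∈ T then (if u = v then 3 else if bethe.Adj u v then -1 else 0) else 0

/-- The toppling operator at `u`. -/
def topple (T : Set Vertex) (u : Vertex) (η : Config) : Config :=
  fun v => η v - topplingMatrix T u v

/-- The topplings at the vertices of the list, performed from left to right starting from `η`,
are all legal, i.e. each takes place at a vertex of `T` of current height larger than `3`. -/
def IsLegal (T : Set Vertex) : List Vertex → Config → Prop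
  | [], _ => True
  | u :: l, η => u ∈ T ∧ 3 < η u ∧ IsLegal T l (topple T u η)

/-- The avalanche caused by adding one grain at `u` to `η`: the set of vertices that topple in the
course of the stabilization of `η + δ_u`, i.e. in some sequence of legal topplings started from
`η + δ_u`. (On a finite tree every legal sequence extends to a stabilizing one, and by the abelian
property all stabilizing sequences topple the same vertices.) -/
def avalanche (T : Set Vertex) (u : Vertex) (η : Config) : Set Vertex :=
  {v | ∃ l : List Vertex, IsLegal T l (η + Pi.single u 1) ∧ v ∈ l}

/-- `η` contains a forbidden subconfiguration: a nonempty `S ⊆ T` on which every height is at most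
the number of neighbours in `S`. -/
def HasFSC (T : Set Vertex) (η : Config) : Prop :=
  ∃ S : Set Vertex, S ⊆ T ∧ S.Nonempty ∧
    ∀ u ∈ S, η u ≤ ({v | v ∈ S ∧ bethe.Adj u v}.ncard : ℤ)

/-- The recurrent (equivalently, allowed) configurations on `T`: stable configurations without
forbidden subconfiguration. -/
def recurrent (T : Set Vertex) : Set Config :=
  {η | (∀ v ∈ T, 1 ≤ η v ∧ η v ≤ 3) ∧ (∀ v ∉ T, η v = 0) ∧ ¬ HasFSC T η}

/-- `μ` is the limit, along the net of finite subtrees `S` of `T`, of the uniform measures on the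
recurrent configurations on `S`: convergence of the probabilities of all cylinder events. -/
def IsVolumeLimit (T : Set Vertex) (μ : Measure Config) : Prop :=
  IsProbabilityMeasure μ ∧
    ∀ (F : Finset Vertex) (ξ : Config),
      Tendsto (fun S : FiniteSubtree T =>
          uniformOn (recurrent (S.1 : Set Vertex)) {η : Config | ∀ v ∈ F, η v = ξ v})
        atTop (𝓝 (μ {η : Config | ∀ v ∈ F, η v = ξ v}))

open Classical in
/-- The sandpile measure `μ_T`: the uniform measure on recurrent configurations if `T` is finite,
and the infinite-volume limit of these measures if `T` is infinite. -/
def sandpileMeasure (T : Set Vertex) : Measure Config :=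
  if T.Finite then uniformOn (recurrent T)
  else if h : ∃ μ : Measure Config, IsVolumeLimit T μ then h.choose else 0

/-- `μ_T (|Av(o, η)| = n)`. -/
def avalancheProb (T : Set Vertex) (n : ℕ) : ℝ :=
  (sandpileMeasure T).real {η : Config | (avalanche T origin η).encard = n}

/-! ### Counting clusters -/

/-- `A_n(o, T)`: the number of connected subsets of `T` that contain the origin and have
cardinality `n`. -/
def clusterCount (T : Set Vertex) (n : ℕ) : ℕ :=
  {S : Finset Vertex | (S : Set Vertex) ⊆ T ∧ origin ∈ S ∧ S.card = n ∧
    (bethe.induce (S : Set Vertex)).Connected}.ncard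

/-- The growth rate `limsup (1/n) log A_n(o, T)`, with `log 0 = -∞`. -/
def growthRate (T : Set Vertex) : EReal :=
  limsup (fun n : ℕ => ENNReal.log (clusterCount T n : ℝ≥0∞) / (n : EReal)) atTop

/-- A sequence indexed by `n ≥ 1` decays (at least) exponentially. -/
def DecaysExponentially (a : ℕ → ℝ) : Prop :=
  ∃ C c : ℝ, 0 < C ∧ 0 < c ∧ ∀ n : ℕ, 1 ≤ n → a n ≤ C * Real.exp (-(c * n))

/-! ### Random trees -/

/-- Independent coins at all vertices, each showing `true` with probability `p`. -/
def coinLaw (p : unitInterval) : Measure (Vertex → Bool) :=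
  Measure.infinitePi fun _ : Vertex => bernoulliMeasure true false p

/-- In the binary branching process with coins `ω`, a vertex that is present has both its children
if its coin shows `true`, and no child otherwise; the root of each copy is present. -/
def binaryPresent (ω : Vertex → Bool) (s : Bool) : List Bool → Prop
  | [] => True
  | _ :: w => binaryPresent ω s w ∧ ω (s, w) = true

/-- In the binomial branching process with coins `ω`, each of the two potential children of a vertex
that is present is itself present if its own coin shows `true`; the root of each copy is present. -/
def binomialPresent (ω : Vertex → Bool) (s : Bool) : List Bool → Prop
  | [] => True
  | b :: w => binomialPresent ω s w ∧ ω (s, b :: w) = true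

/-- The rootless random binary tree: two independent branching processes with their roots joined
by an edge. -/
def binaryTree (ω : Vertex → Bool) : Set Vertex := {v | binaryPresent ω v.1 v.2}

/-- The random binary tree rooted at the origin: a single branching process. -/
def rootedBinaryTree (ω : Vertex → Bool) : Set Vertex := {v | v.1 = false ∧ binaryPresent ω v.1 v.2}

/-- The rootless random binomial tree. -/
def binomialTree (ω : Vertex → Bool) : Set Vertex := {v | binomialPresent ω v.1 v.2}

/-- The random binomial tree rooted at the origin. -/
def rootedBinomialTree (ω : Vertex → Bool) : Set Vertex :=
  {v | v.1 = false ∧ binomialPresent ω v.1 v.2}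

/-- The annealed probability `𝔼 (μ_𝒯 (|Av(o, η)| = n))` for a random tree `𝒯`. -/
def annealedProb (𝒯 : (Vertex → Bool) → Set Vertex) (p : unitInterval) (n : ℕ) : ℝ :=
  ∫ ω, avalancheProb (𝒯 ω) n ∂(coinLaw p)

/-- The quenched probability is an integrable random variable, for every avalanche size. -/
def AnnealedIntegrable (𝒯 : (Vertex → Bool) → Set Vertex) (p : unitInterval) : Prop :=
  ∀ n : ℕ, 1 ≤ n → Integrable (fun ω => avalancheProb (𝒯 ω) n) (coinLaw p)

end TreeSandpile

end

open TreeSandpile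

noncomputable section

namespace TreeSandpile

/-! Cutting an edge splits a tree into two pieces that interact only through that edge. In the
language of burning, the union of the pieces is allowed exactly when one piece burns with no help
across the edge and the other burns once the first has burnt (`Bridge.hasFSC_union`).
Inclusion-exclusion makes this an identity between counts (`Bridge.cnt_union`). A branch is
therefore summarized by two numbers: its weak count W (parent burnt) and its strong count S (parent
unburnt). With all heights admitted and children's counts (N, σ), (M, τ), one has S = σM + Nτ and W
= NM + S. Hence S/W lies in [1/2, 1], in [1/2, 2/3] for a nonempty branch, and it decreases as the
tree grows. So S/W converges along the net of finite subtrees. The probability of a cylinder event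
is obtained from such limits by finitely many rational operations with denominators bounded below,
so it converges too; compactness of the space of bounded configurations then supplies the measure.

For stable heights, a finite nonempty avalanche is the connected component of the origin in the set
of vertices of height 3. Toppling along paths shows that this component topples. An explicit
superharmonic toppling function vanishing off the component, together with the least action
principle, shows that nothing else does. Thus the event of an avalanche of size n is, up to a null
set, a disjoint union over clusters C of the events "3 on C, and 1 or 2 on the boundary of C in T"
(`avalancheProb_eq`).

Each such event has probability at most 2 · 2.567⁻ⁿ (`IsCluster.measure_le`). At a vertex of C the
height is frozen, and forgetting the constraints through it decouples the branches. At a boundary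
vertex, raising the height by one turns a weakly allowed configuration into a strongly allowed one.
The induction towards the root closes with the potential 0.549 W + 0.46 S on C and S off C
(`branchBound_mul_le`). Since 4/2.567 ≤ 2^(16/25), the deterministic bound follows by multiplying by
the number of clusters.

For random trees the expected number of clusters is the sum over C of the probability that C is
present, which is at most p to the number of coins that C forces. This weighted sum is controlled by
a generating function satisfying a quadratic recursion, evaluated at its critical point; the
reciprocals of the critical points are 2(p + √p) and 4p. -/

/-- The child of `v` in direction `b`. -/
def child (v : Vertex) (b : Bool) : Vertex := (v.1, b :: v.2)

/-- The vertices weakly below `v` in its copy of the rooted binary tree. -/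
def descendants (v : Vertex) : Set Vertex := {u | u.1 = v.1 ∧ v.2 <:+ u.2}

/-- The part of `T` weakly below `v`. -/
def branch (T : Set Vertex) (v : Vertex) : Set Vertex := T ∩ descendants v

lemma adj_iff {u v : Vertex} : bethe.Adj u v ↔
    (∃ b, v = child u b) ∨ (∃ b, u = child v b) ∨ (u.2 = [] ∧ v.2 = [] ∧ u.1 ≠ v.1) := by
  obtain ⟨s, l⟩ := u
  obtain ⟨t, m⟩ := v
  simp only [bethe, SimpleGraph.fromRel_adj, child, Prod.mk.injEq, ne_eq]
  constructor
  · rintro ⟨h, (h1 | h1) | (h1 | h1)⟩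
    · exact Or.inl h1
    · right; right; simp [h1]
    · exact Or.inr (Or.inl h1)
    · right; right; simp [h1]
  · rintro (⟨b, rfl, rfl⟩ | ⟨b, rfl, rfl⟩ | ⟨rfl, rfl, h⟩)
    · simp
    · simp
    · refine ⟨by simp [h], ?_⟩
      cases s <;> cases t <;> simp_all

lemma adj_child (v : Vertex) (b : Bool) : bethe.Adj v (child v b) :=
  adj_iff.2 (Or.inl ⟨b, rfl⟩)

lemma finite_adj (u : Vertex) : {v | bethe.Adj u v}.Finite := by
  refine Set.Finite.subset (s := {child u false, child u true, (u.1, u.2.tail), (!u.1, [])})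
    (by simp) ?_
  intro v hv
  rcases adj_iff.1 hv with ⟨b, rfl⟩ | ⟨b, rfl⟩ | ⟨h1, h2, h3⟩
  · cases b <;> simp
  · simp [child]
  · obtain ⟨s, l⟩ := u
    obtain ⟨t, m⟩ := v
    cases s <;> cases t <;> simp_all

/-! ### Forbidden subconfigurations across a single edge -/

/-- The number of neighbours of `u` in `S`. -/
def deg (S : Set Vertex) (u : Vertex) : ℕ := {v | v ∈ S ∧ bethe.Adj u v}.ncard

lemma finite_deg (S : Set Vertex) (u : Vertex) : {v | v ∈ S ∧ bethe.Adj u v}.Finite :=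
  (finite_adj u).subset fun _ h => h.2

lemma deg_mono {S S' : Set Vertex} (h : S ⊆ S') (u : Vertex) : deg S u ≤ deg S' u :=
  Set.ncard_le_ncard (fun _ hv => ⟨h hv.1, hv.2⟩) (finite_deg S' u)

lemma HasFSC.mono {X Y : Set Vertex} {η : Config} (h : X ⊆ Y) (hX : HasFSC X η) : HasFSC Y η := by
  obtain ⟨S, hS, hne, hd⟩ := hX
  exact ⟨S, hS.trans h, hne, hd⟩

lemma HasFSC.anti {X : Set Vertex} {η η' : Config} (h : ∀ u ∈ X, η' u ≤ η u) (hX : HasFSC X η) :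
    HasFSC X η' := by
  obtain ⟨S, hS, hne, hd⟩ := hX
  exact ⟨S, hS, hne, fun u hu => (h u (hS hu)).trans (hd u hu)⟩

lemma hasFSC_congr {X : Set Vertex} {η η' : Config} (h : ∀ u ∈ X, η u = η' u) :
    HasFSC X η ↔ HasFSC X η' :=
  ⟨HasFSC.anti fun u hu => (h u hu).ge, HasFSC.anti fun u hu => (h u hu).le⟩

/-- `X` and `Y` are disjoint, and the only edge between them is `xy`, which is there if both `x`
and `y` are. -/
structure Bridge (X Y : Set Vertex) (x y : Vertex) : Prop where
  disj : Disjoint X Y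
  edge : ∀ u ∈ X, ∀ v ∈ Y, bethe.Adj u v → u = x ∧ v = y
  adj : x ∈ X → y ∈ Y → bethe.Adj x y

lemma Bridge.symm {X Y : Set Vertex} {x y : Vertex} (h : Bridge X Y x y) : Bridge Y X y x :=
  ⟨h.disj.symm, fun u hu v hv ha => (h.edge v hv u hu ha.symm).symm,
    fun hy hx => (h.adj hx hy).symm⟩

lemma single_nonneg (x u : Vertex) : (0 : ℤ) ≤ (Pi.single x 1 : Config) u := by
  rw [Pi.single_apply]; split_ifs <;> simp

lemma HasFSC.sub_single {X : Set Vertex} {η : Config} (x : Vertex) (h : HasFSC X η) :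
    HasFSC X (η - Pi.single x 1) :=
  h.anti fun u _ => by have := single_nonneg x u; simp only [Pi.sub_apply]; omega

lemma Bridge.deg_le {X Y S : Set Vertex} {x y : Vertex} (h : Bridge X Y x y) (hS : S ⊆ X ∪ Y)
    {u : Vertex} (hu : u ∈ X) : (deg S u : ℤ) ≤ deg (S ∩ X) u + (Pi.single x 1 : Config) u := by
  by_cases hux : u = x
  · subst hux
    have : {v | v ∈ S ∧ bethe.Adj u v} ⊆ insert y {v | v ∈ S ∩ X ∧ bethe.Adj u v} := by
      rintro v ⟨hv, ha⟩
      rcases hS hv with hX | hY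
      · exact Or.inr ⟨⟨hv, hX⟩, ha⟩
      · exact Or.inl (h.edge u hu v hY ha).2
    have h2 := (Set.ncard_le_ncard this ((finite_deg _ _).insert y)).trans (Set.ncard_insert_le _ _)
    simp only [deg, Pi.single_eq_same]
    exact_mod_cast h2
  · have : {v | v ∈ S ∧ bethe.Adj u v} ⊆ {v | v ∈ S ∩ X ∧ bethe.Adj u v} := by
      rintro v ⟨hv, ha⟩
      rcases hS hv with hX | hY
      · exact ⟨⟨hv, hX⟩, ha⟩
      · exact absurd (h.edge u hu v hY ha).1 hux
    have h2 := Set.ncard_le_ncard this (finite_deg _ _)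
    have h3 := single_nonneg x u
    simp only [deg]
    omega

lemma Bridge.hasFSC_inter {X Y S : Set Vertex} {x y : Vertex} (h : Bridge X Y x y) {η : Config}
    (hS : S ⊆ X ∪ Y) (hd : ∀ u ∈ S, η u ≤ (deg S u : ℤ)) (hne : (S ∩ X).Nonempty) :
    HasFSC X (η - Pi.single x 1) :=
  ⟨S ∩ X, Set.inter_subset_right, hne, fun u hu => by
    have h1 := hd u hu.1
    have h2 := h.deg_le hS hu.2
    simp only [Pi.sub_apply]
    change _ ≤ (deg (S ∩ X) u : ℤ)
    omega⟩

lemma deg_add_single_le {S S' : Set Vertex} {x y : Vertex} (hxy : bethe.Adj x y) (hy : y ∈ S')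
    (hyS : y ∉ S) (u : Vertex) : (deg S u : ℤ) + (Pi.single x 1 : Config) u ≤ deg (S ∪ S') u := by
  by_cases hux : u = x
  · subst hux
    have : insert y {v | v ∈ S ∧ bethe.Adj u v} ⊆ {v | v ∈ S ∪ S' ∧ bethe.Adj u v} := by
      rintro v (rfl | ⟨hv, ha⟩)
      · exact ⟨Or.inr hy, hxy⟩
      · exact ⟨Or.inl hv, ha⟩
    have h2 := Set.ncard_le_ncard this (finite_deg _ _)
    rw [Set.ncard_insert_of_notMem (fun h => hyS h.1) (finite_deg _ _)] at h2
    simp only [deg, Pi.single_eq_same]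
    exact_mod_cast h2
  · rw [Pi.single_eq_of_ne hux]
    simpa using deg_mono Set.subset_union_left u

/-- Subtracting a grain at `x` expresses that `y` is still unburnt. Negated, the equivalence says
that the fire consumes everything iff it crosses the bridge in one of the two directions: one side
burns unaided, the other after it. -/
theorem Bridge.hasFSC_union {X Y : Set Vertex} {x y : Vertex} (h : Bridge X Y x y) (η : Config) :
    HasFSC (X ∪ Y) η ↔ (HasFSC X (η - Pi.single x 1) ∨ HasFSC Y η) ∧
      (HasFSC X η ∨ HasFSC Y (η - Pi.single y 1)) := by
  constructor
  · rintro ⟨S, hS, hne, hd⟩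
    by_cases hX : (S ∩ X).Nonempty
    · refine ⟨Or.inl (h.hasFSC_inter hS hd hX), ?_⟩
      by_cases hY : (S ∩ Y).Nonempty
      · exact Or.inr (h.symm.hasFSC_inter (by rwa [Set.union_comm]) hd hY)
      · left
        refine ⟨S, fun u hu => (hS hu).resolve_right fun hu' => hY ⟨u, hu, hu'⟩, hne, hd⟩
    · have : HasFSC Y η :=
        ⟨S, fun u hu => (hS hu).resolve_left fun hu' => hX ⟨u, hu, hu'⟩, hne, hd⟩
      exact ⟨Or.inr this, Or.inr (this.sub_single y)⟩
  · rintro ⟨h1 | h1, h2 | h2⟩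
    · exact h2.mono Set.subset_union_left
    · obtain ⟨S, hS, hne, hd⟩ := h1
      obtain ⟨S', hS', hne', hd'⟩ := h2
      -- If both ends are used, the two sets are glued and the bridge gives each end back the
      -- neighbour that the subtracted grain stood for. If an end is not used, the subtraction is
      -- invisible on that side.
      by_cases hx : x ∈ S
      · by_cases hy : y ∈ S'
        · have hxy := h.adj (hS hx) (hS' hy)
          have hyS : y ∉ S := fun hyS => h.disj.ne_of_mem (hS hyS) (hS' hy) rfl
          have hxS : x ∉ S' := fun hxS => h.disj.ne_of_mem (hS hx) (hS' hxS) rfl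
          refine ⟨S ∪ S', Set.union_subset_union hS hS', hne.inl, ?_⟩
          rintro u (hu | hu)
          · have h1 := hd u hu
            have h2 := deg_add_single_le hxy hy hyS u
            simp only [Pi.sub_apply] at h1
            change _ ≤ (deg _ u : ℤ) at h1
            change _ ≤ (deg _ u : ℤ)
            omega
          · have h1 := hd' u hu
            have h2 := deg_add_single_le hxy.symm hx hxS u
            rw [Set.union_comm] at h2
            simp only [Pi.sub_apply] at h1
            change _ ≤ (deg _ u : ℤ) at h1
            change _ ≤ (deg _ u : ℤ)
            omega
        · refine HasFSC.mono Set.subset_union_right ⟨S', hS', hne', fun u hu => ?_⟩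
          have := hd' u hu
          rwa [Pi.sub_apply, Pi.single_eq_of_ne (by rintro rfl; exact hy hu), sub_zero] at this
      · refine HasFSC.mono Set.subset_union_left ⟨S, hS, hne, fun u hu => ?_⟩
        have := hd u hu
        rwa [Pi.sub_apply, Pi.single_eq_of_ne (by rintro rfl; exact hx hu), sub_zero] at this
    · exact h1.mono Set.subset_union_right
    · exact h1.mono Set.subset_union_right

/-! ### Counting allowed configurations -/

/-- The configurations on `X` with heights in `A` such that `η - m` has no forbidden
subconfiguration; `m` counts unburnt neighbours outside `X`. -/
def cfg (X : Set Vertex) (A : Vertex → Finset ℤ) (m : Config) : Set Config :=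
  {η | (∀ v ∈ X, η v ∈ A v) ∧ (∀ v ∉ X, η v = 0) ∧ ¬ HasFSC X (η - m)}

/-- The number of configurations in `cfg X A m`. -/
def cnt (X : Set Vertex) (A : Vertex → Finset ℤ) (m : Config) : ℝ := (cfg X A m).ncard

lemma cnt_nonneg (X : Set Vertex) (A : Vertex → Finset ℤ) (m : Config) : 0 ≤ cnt X A m :=
  Nat.cast_nonneg _

lemma finite_supported {X : Set Vertex} (hX : X.Finite) (A : Vertex → Finset ℤ) :
    {η : Config | (∀ v ∈ X, η v ∈ A v) ∧ (∀ v ∉ X, η v = 0)}.Finite := by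
  have := hX.to_subtype
  refine Set.Finite.of_finite_image (f := fun η (v : X) => η v) ?_ ?_
  · refine Set.Finite.subset (s := Set.pi Set.univ fun v : X => (A v : Set ℤ))
      (Set.Finite.pi fun v => (A v).finite_toSet) ?_
    rintro _ ⟨η, h, rfl⟩ v -
    exact h.1 v v.2
  · intro η h η' h' he
    ext v
    by_cases hv : v ∈ X
    · exact congrFun he ⟨v, hv⟩
    · rw [h.2 v hv, h'.2 v hv]

lemma finite_cfg {X : Set Vertex} (hX : X.Finite) (A : Vertex → Finset ℤ) (m : Config) :
    (cfg X A m).Finite :=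
  (finite_supported hX A).subset fun _ h => ⟨h.1, h.2.1⟩

lemma cfg_anti {X : Set Vertex} {A : Vertex → Finset ℤ} {m m' : Config}
    (h : ∀ u ∈ X, m u ≤ m' u) : cfg X A m' ⊆ cfg X A m := fun η hη =>
  ⟨hη.1, hη.2.1, fun hf => hη.2.2 (hf.anti fun u hu => by
    have := h u hu; simp only [Pi.sub_apply]; omega)⟩

lemma cfg_congr {X : Set Vertex} {A A' : Vertex → Finset ℤ} {m m' : Config}
    (hA : ∀ u ∈ X, A u = A' u) (h : ∀ u ∈ X, m u = m' u) : cfg X A m = cfg X A' m' := by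
  ext η
  simp only [cfg, Set.mem_ofPred_eq]
  rw [hasFSC_congr (η := η - m) (η' := η - m') fun u hu => by simp [h u hu]]
  refine and_congr_left fun _ => forall₂_congr fun u hu => by rw [hA u hu]

lemma cnt_congr {X : Set Vertex} {A A' : Vertex → Finset ℤ} {m m' : Config}
    (hA : ∀ u ∈ X, A u = A' u) (h : ∀ u ∈ X, m u = m' u) : cnt X A m = cnt X A' m' := by
  rw [cnt, cfg_congr hA h, cnt]

lemma cfg_empty (A : Vertex → Finset ℤ) (m : Config) : cfg ∅ A m = {0} := by
  ext η
  have : ¬ HasFSC ∅ (η - m) := by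
    rintro ⟨S, hS, hne, -⟩
    exact hne.ne_empty (Set.subset_empty_iff.1 hS)
  simp only [cfg, Set.mem_ofPred_eq, this, Set.mem_empty_iff_false]
  simp [funext_iff]

lemma cnt_empty (A : Vertex → Finset ℤ) (m : Config) : cnt ∅ A m = 1 := by
  simp [cnt, cfg_empty]

/-- Configurations on `X ∪ Y` are pairs of configurations on `X` and on `Y`. -/
lemma injOn_add_of_disjoint {X Y : Set Vertex} (hXY : Disjoint X Y) {P Q : Set Config}
    (hP : ∀ η ∈ P, ∀ v ∉ X, η v = 0) (hQ : ∀ η ∈ Q, ∀ v ∉ Y, η v = 0) :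
    Set.InjOn (fun p : Config × Config => p.1 + p.2) (P ×ˢ Q) := by
  rintro ⟨η, ζ⟩ ⟨h1, h2⟩ ⟨η', ζ'⟩ ⟨h1', h2'⟩ he
  simp only at h1 h2 h1' h2' he
  have key : ∀ v, η v = η' v ∧ ζ v = ζ' v := by
    intro v
    have := congrFun he v
    simp only [Pi.add_apply] at this
    by_cases hv : v ∈ X
    · have hv' : v ∉ Y := fun h => hXY.ne_of_mem hv h rfl
      have a := hQ _ h2 v hv'
      have b := hQ _ h2' v hv'
      omega
    · have a := hP _ h1 v hv
      have b := hP _ h1' v hv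
      omega
  exact Prod.ext (funext fun v => (key v).1) (funext fun v => (key v).2)

/-- The two products correspond to the two directions in which the fire can cross the bridge. They
overlap: both directions are possible when each side burns unaided. -/
lemma Bridge.cfg_union {X Y : Set Vertex} {x y : Vertex} (h : Bridge X Y x y)
    (A : Vertex → Finset ℤ) (m : Config) :
    cfg (X ∪ Y) A m = (fun p : Config × Config => p.1 + p.2) ''
      (cfg X A (m + Pi.single x 1) ×ˢ cfg Y A m ∪ cfg X A m ×ˢ cfg Y A (m + Pi.single y 1)) := by
  classical
  have hf : ∀ η ζ : Config, (∀ v ∉ X, η v = 0) → (∀ v ∉ Y, ζ v = 0) →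
      (∀ v ∈ X, (η + ζ) v = η v) ∧ (∀ v ∈ Y, (η + ζ) v = ζ v) := by
    intro η ζ h1 h2
    refine ⟨fun v hv => ?_, fun v hv => ?_⟩
    · simp [h2 v fun hv' => h.disj.ne_of_mem hv hv' rfl]
    · simp [h1 v fun hv' => h.disj.ne_of_mem hv' hv rfl]
  have hF : ∀ η ζ : Config, (∀ v ∉ X, η v = 0) → (∀ v ∉ Y, ζ v = 0) →
      (HasFSC (X ∪ Y) (η + ζ - m) ↔ (HasFSC X (η - (m + Pi.single x 1)) ∨ HasFSC Y (ζ - m)) ∧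
      (HasFSC X (η - m) ∨ HasFSC Y (ζ - (m + Pi.single y 1)))) := by
    intro η ζ h1 h2
    obtain ⟨hX, hY⟩ := hf η ζ h1 h2
    have eX : ∀ z : Config, HasFSC X (η + ζ - z) ↔ HasFSC X (η - z) := fun z =>
      hasFSC_congr fun u hu => congrArg (· - z u) (hX u hu)
    have eY : ∀ z : Config, HasFSC Y (η + ζ - z) ↔ HasFSC Y (ζ - z) := fun z =>
      hasFSC_congr fun u hu => congrArg (· - z u) (hY u hu)
    rw [h.hasFSC_union, sub_sub, sub_sub, eX, eX, eY, eY]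
  ext θ
  constructor
  · rintro ⟨h1, h2, h3⟩
    refine ⟨(fun v => if v ∈ X then θ v else 0, fun v => if v ∈ Y then θ v else 0), ?_, ?_⟩
    · have hη : ∀ v ∉ X, (fun v => if v ∈ X then θ v else 0) v = 0 := fun v hv => by simp [hv]
      have hζ : ∀ v ∉ Y, (fun v => if v ∈ Y then θ v else 0) v = 0 := fun v hv => by simp [hv]
      have hsum : θ =
          (fun v => if v ∈ X then θ v else 0) + (fun v => if v ∈ Y then θ v else 0) := by
        ext v
        by_cases hv : v ∈ X
        · have : v ∉ Y := fun hv' => h.disj.ne_of_mem hv hv' rfl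
          simp [hv, this]
        · by_cases hv' : v ∈ Y
          · simp [hv, hv']
          · simp [hv, hv', h2 v (by simp [hv, hv'])]
      rw [hsum, hF _ _ hη hζ] at h3
      have hηA : ∀ v ∈ X, (fun v => if v ∈ X then θ v else 0) v ∈ A v := fun v hv => by
        simpa [hv] using h1 v (Or.inl hv)
      have hζA : ∀ v ∈ Y, (fun v => if v ∈ Y then θ v else 0) v ∈ A v := fun v hv => by
        simpa [hv] using h1 v (Or.inr hv)
      by_cases hc : HasFSC X ((fun v => if v ∈ X then θ v else 0) - (m + Pi.single x 1)) ∨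
          HasFSC Y ((fun v => if v ∈ Y then θ v else 0) - m)
      · have hc' := not_or.1 fun h => h3 ⟨hc, h⟩
        exact Or.inr ⟨⟨hηA, hη, hc'.1⟩, ⟨hζA, hζ, hc'.2⟩⟩
      · rw [not_or] at hc
        exact Or.inl ⟨⟨hηA, hη, hc.1⟩, ⟨hζA, hζ, hc.2⟩⟩
    · ext v
      by_cases hv : v ∈ X
      · have : v ∉ Y := fun hv' => h.disj.ne_of_mem hv hv' rfl
        simp [hv, this]
      · by_cases hv' : v ∈ Y
        · simp [hv, hv']
        · simp [hv, hv', h2 v (by simp [hv, hv'])]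
  · rintro ⟨⟨η, ζ⟩, hp, rfl⟩
    have hη : (∀ v ∈ X, η v ∈ A v) ∧ ∀ v ∉ X, η v = 0 := by
      rcases hp with hp | hp <;> exact ⟨hp.1.1, hp.1.2.1⟩
    have hζ : (∀ v ∈ Y, ζ v ∈ A v) ∧ ∀ v ∉ Y, ζ v = 0 := by
      rcases hp with hp | hp <;> exact ⟨hp.2.1, hp.2.2.1⟩
    obtain ⟨hX, hY⟩ := hf η ζ hη.2 hζ.2
    refine ⟨?_, ?_, ?_⟩
    · rintro v (hv | hv)
      · simp only [hX v hv, hη.1 v hv]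
      · simp only [hY v hv, hζ.1 v hv]
    · intro v hv
      simp only [Set.mem_union, not_or] at hv
      simp [hη.2 v hv.1, hζ.2 v hv.2]
    · simp only
      rw [hF _ _ hη.2 hζ.2]
      rintro ⟨a, b⟩
      rcases hp with ⟨⟨-, -, h1⟩, ⟨-, -, h2⟩⟩ | ⟨⟨-, -, h1⟩, ⟨-, -, h2⟩⟩
      · exact a.elim h1 h2
      · exact b.elim h1 h2

/-- Inclusion-exclusion for the two products. Strong sets are contained in the weak ones, so the
intersection is the product of the two strong sets. -/
theorem Bridge.cnt_union {X Y : Set Vertex} {x y : Vertex} (h : Bridge X Y x y) (hX : X.Finite)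
    (hY : Y.Finite) (A : Vertex → Finset ℤ) (m : Config) :
    cnt (X ∪ Y) A m = cnt X A (m + Pi.single x 1) * cnt Y A m
      + cnt X A m * cnt Y A (m + Pi.single y 1)
      - cnt X A (m + Pi.single x 1) * cnt Y A (m + Pi.single y 1) := by
  have hle : ∀ z u : Vertex, m u ≤ (m + Pi.single z 1 : Config) u := fun z u => by
    have := single_nonneg z u; simp only [Pi.add_apply]; omega
  have hsx : cfg X A (m + Pi.single x 1) ⊆ cfg X A m := cfg_anti fun u _ => hle x u
  have hsy : cfg Y A (m + Pi.single y 1) ⊆ cfg Y A m := cfg_anti fun u _ => hle y u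
  have e := Set.ncard_union_add_ncard_inter
    (cfg X A (m + Pi.single x 1) ×ˢ cfg Y A m) (cfg X A m ×ˢ cfg Y A (m + Pi.single y 1))
    ((finite_cfg hX _ _).prod (finite_cfg hY _ _)) ((finite_cfg hX _ _).prod (finite_cfg hY _ _))
  rw [Set.prod_inter_prod, Set.inter_eq_left.2 hsx, Set.inter_eq_right.2 hsy] at e
  have hinj : Set.InjOn (fun p : Config × Config => p.1 + p.2)
      (cfg X A (m + Pi.single x 1) ×ˢ cfg Y A m ∪ cfg X A m ×ˢ cfg Y A (m + Pi.single y 1)) :=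
    (injOn_add_of_disjoint h.disj (P := cfg X A m) (Q := cfg Y A m) (fun η hη => hη.2.1)
      (fun η hη => hη.2.1)).mono
      (Set.union_subset (Set.prod_mono hsx subset_rfl) (Set.prod_mono subset_rfl hsy))
  unfold cnt
  rw [h.cfg_union, hinj.ncard_image]
  simp only [Set.ncard_prod] at e
  rw [eq_sub_iff_add_eq]
  exact_mod_cast e

/-- Restricting to two pieces only relaxes the constraints. -/
lemma cnt_union_le {X Y : Set Vertex} (hX : X.Finite) (hY : Y.Finite)
    (A : Vertex → Finset ℤ) (m : Config) : cnt (X ∪ Y) A m ≤ cnt X A m * cnt Y A m := by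
  classical
  unfold cnt
  rw [← Nat.cast_mul, ← Set.ncard_prod, Nat.cast_le]
  refine Set.ncard_le_ncard_of_injOn
    (fun θ => (fun v => if v ∈ X then θ v else 0, fun v => if v ∈ Y then θ v else 0)) ?_ ?_
    ((finite_cfg hX A m).prod (finite_cfg hY A m))
  · intro θ hθ
    have aux : ∀ Z : Set Vertex, Z ⊆ X ∪ Y → (fun v => if v ∈ Z then θ v else 0) ∈ cfg Z A m := by
      intro Z hZ
      refine ⟨fun v hv => by simpa [hv] using hθ.1 v (hZ hv), fun v hv => by simp [hv], ?_⟩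
      intro hf
      refine hθ.2.2 (HasFSC.mono hZ ((hasFSC_congr fun u hu => ?_).1 hf))
      simp [hu]
    exact ⟨aux X Set.subset_union_left, aux Y Set.subset_union_right⟩
  · intro θ hθ θ' hθ' he
    simp only [Prod.mk.injEq] at he
    ext v
    by_cases hv : v ∈ X
    · simpa [hv] using congrFun he.1 v
    · by_cases hv' : v ∈ Y
      · simpa [hv'] using congrFun he.2 v
      · rw [hθ.2.1 v (by simp [hv, hv']), hθ'.2.1 v (by simp [hv, hv'])]

/-! ### Branches -/

lemma self_mem_descendants (v : Vertex) : v ∈ descendants v := ⟨rfl, List.suffix_rfl⟩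

lemma descendants_trans {u v w : Vertex} (h : u ∈ descendants v) (h' : v ∈ descendants w) :
    u ∈ descendants w := ⟨h.1.trans h'.1, h'.2.trans h.2⟩

lemma child_mem_descendants {u v : Vertex} (h : u ∈ descendants v) (b : Bool) :
    child u b ∈ descendants v := ⟨h.1, h.2.trans (List.suffix_cons b u.2)⟩

lemma descendants_child_subset (v : Vertex) (b : Bool) : descendants (child v b) ⊆ descendants v :=
  fun _ h => descendants_trans h (child_mem_descendants (self_mem_descendants v) b)

lemma length_le_of_mem_descendants {u v : Vertex} (h : u ∈ descendants v) :
    v.2.length ≤ u.2.length := h.2.length_le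

lemma notMem_descendants_child (v : Vertex) (b : Bool) : v ∉ descendants (child v b) := fun h => by
  have := length_le_of_mem_descendants h
  simp [child] at this

lemma mem_descendants_iff {u v : Vertex} :
    u ∈ descendants v ↔ u = v ∨ ∃ b, u ∈ descendants (child v b) := by
  constructor
  · rintro ⟨h1, t, h2⟩
    obtain ⟨s, l⟩ := u
    obtain ⟨s', l'⟩ := v
    simp only at h1 h2
    subst h1
    rcases List.eq_nil_or_concat t with rfl | ⟨t, b, rfl⟩
    · left; simpa using h2.symm
    · right
      exact ⟨b, rfl, t, by simpa [child] using h2⟩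
  · rintro (rfl | ⟨b, h⟩)
    · exact self_mem_descendants _
    · exact descendants_child_subset v b h

lemma eq_of_mem_descendants {u v w : Vertex} (h : u ∈ descendants v) (h' : u ∈ descendants w)
    (hl : v.2.length = w.2.length) : v = w := by
  have := List.suffix_of_suffix_length_le h.2 h'.2 hl.le
  exact Prod.ext (h.1.symm.trans h'.1) (this.eq_of_length hl)

lemma disjoint_descendants_child (v : Vertex) :
    Disjoint (descendants (child v false)) (descendants (child v true)) := by
  rw [Set.disjoint_left]
  intro u h h'
  have := eq_of_mem_descendants h h' (by simp [child])
  simp [child] at this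

lemma child_injective {u v : Vertex} {b b' : Bool} (h : child u b = child v b') :
    u = v ∧ b = b' := by
  simp only [child, Prod.mk.injEq, List.cons.injEq] at h
  exact ⟨Prod.ext h.1 h.2.2, h.2.1⟩

/-- The only edges that enter the set of descendants of `z` end in `z`. -/
lemma eq_of_adj_descendants {u w z : Vertex} (h : bethe.Adj u w) (hu : u ∉ descendants z)
    (hw : w ∈ descendants z) : w = z := by
  rcases adj_iff.1 h with ⟨b, rfl⟩ | ⟨b, rfl⟩ | ⟨-, h2, -⟩
  · have h2 := hw.2
    simp only [child, List.suffix_cons_iff] at h2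
    rcases h2 with h2 | h2
    · exact Prod.ext hw.1 h2.symm
    · exact absurd ⟨hw.1, h2⟩ hu
  · exact absurd (child_mem_descendants hw b) hu
  · have h3 := hw.2
    rw [h2, List.suffix_nil] at h3
    exact Prod.ext hw.1 (h2.trans h3.symm)

lemma eq_parent_of_adj {u v : Vertex} {b : Bool} (h : bethe.Adj u (child v b))
    (hu : u ∉ descendants (child v b)) : u = v := by
  rcases adj_iff.1 h with ⟨b', h'⟩ | ⟨b', rfl⟩ | ⟨-, h2, -⟩
  · exact (child_injective h').1.symm
  · exact absurd (child_mem_descendants (self_mem_descendants _) b') hu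
  · simp [child] at h2

/-- Below `v`, the set `T` is closed under taking parents. -/
def Hereditary (T : Set Vertex) (v : Vertex) : Prop :=
  ∀ u ∈ descendants v, ∀ b, child u b ∈ T → u ∈ T

lemma Hereditary.child {T : Set Vertex} {v : Vertex} (h : Hereditary T v) (b : Bool) :
    Hereditary T (child v b) := fun u hu => h u (descendants_child_subset v b hu)

lemma Hereditary.branch_eq_empty {T : Set Vertex} {v : Vertex} (h : Hereditary T v) (hv : v ∉ T) :
    branch T v = ∅ := by
  rw [Set.eq_empty_iff_forall_notMem]
  rintro ⟨s, l⟩ ⟨hT, hs, t, ht⟩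
  simp only at hs ht
  subst hs
  subst ht
  induction t with
  | nil => exact hv hT
  | cons b t ih =>
    exact ih (h (v.1, t ++ v.2) ⟨rfl, List.suffix_append t v.2⟩ b hT)

lemma branch_eq {T : Set Vertex} {v : Vertex} (hv : v ∈ T) :
    branch T v = ({v} ∪ branch T (child v false)) ∪ branch T (child v true) := by
  ext u
  simp only [branch, Set.mem_inter_iff, Set.mem_union, Set.mem_singleton_iff]
  rw [mem_descendants_iff]
  simp only [Bool.exists_bool]
  constructor
  · rintro ⟨h, rfl | h' | h'⟩ <;> simp_all
  · rintro ((rfl | h) | h) <;> simp_all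

lemma bridge_left (T : Set Vertex) (v : Vertex) :
    Bridge {v} (branch T (child v false)) v (child v false) := by
  refine ⟨?_, ?_, fun _ _ => adj_child _ _⟩
  · rw [Set.disjoint_singleton_left]
    exact fun h => notMem_descendants_child _ _ h.2
  · rintro u rfl w hw ha
    exact ⟨rfl, eq_of_adj_descendants ha (notMem_descendants_child _ _) hw.2⟩

lemma bridge_right (T : Set Vertex) (v : Vertex) :
    Bridge ({v} ∪ branch T (child v false)) (branch T (child v true)) v (child v true) := by
  have hd : ∀ u ∈ {v} ∪ branch T (child v false), u ∉ descendants (child v true) := by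
    rintro u (rfl | h) hu
    · exact notMem_descendants_child _ _ hu
    · exact Set.disjoint_left.1 (disjoint_descendants_child v) h.2 hu
  refine ⟨Set.disjoint_left.2 fun u hu hu' => hd u hu hu'.2, ?_, fun _ _ => adj_child _ _⟩
  intro u hu w hw ha
  have := eq_of_adj_descendants ha (hd u hu) hw.2
  subst this
  exact ⟨eq_parent_of_adj ha (hd u hu), rfl⟩

/-! ### Weak and strong counts of a branch -/

/-- The number of heights in `A v` exceeding `j`. -/
def above (A : Vertex → Finset ℤ) (v : Vertex) (j : ℤ) : ℝ := ((A v).filter (j < ·)).card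

lemma hasFSC_singleton {v : Vertex} {η : Config} : HasFSC {v} η ↔ η v ≤ 0 := by
  have h0 : ({w | w ∈ ({v} : Set Vertex) ∧ bethe.Adj v w}) = ∅ := by
    ext w; simp only [Set.mem_singleton_iff, Set.mem_ofPred_eq, Set.mem_empty_iff_false, iff_false]
    rintro ⟨rfl, h⟩; exact h.ne rfl
  constructor
  · rintro ⟨S, hS, hne, hd⟩
    obtain rfl := hne.subset_singleton_iff.1 hS
    have := hd v rfl
    rwa [h0, Set.ncard_empty] at this
  · intro h
    refine ⟨{v}, subset_rfl, Set.singleton_nonempty v, ?_⟩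
    rintro u rfl
    rw [h0, Set.ncard_empty]
    exact h

lemma cnt_singleton (A : Vertex → Finset ℤ) (v : Vertex) (m : Config) :
    cnt {v} A m = above A v (m v) := by
  classical
  have : cfg {v} A m = (fun h : ℤ => (Pi.single v h : Config)) '' ((A v).filter (m v < ·)) := by
    ext η
    simp only [cfg, Set.mem_singleton_iff, forall_eq, hasFSC_singleton, Pi.sub_apply,
      Set.mem_ofPred_eq, Set.mem_image, Finset.coe_filter]
    constructor
    · rintro ⟨h1, h2, h3⟩
      refine ⟨η v, ⟨h1, by omega⟩, ?_⟩
      ext u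
      by_cases hu : u = v
      · subst hu; simp
      · simp [hu, h2 u hu]
    · rintro ⟨h, ⟨h1, h2⟩, rfl⟩
      refine ⟨by simpa using h1, fun u hu => by simp [hu], by simpa using h2⟩
  unfold cnt
  rw [this, Set.InjOn.ncard_image (f := fun h : ℤ => (Pi.single v h : Config))
    (fun a _ b _ hab => by simpa using congrFun hab v), Set.ncard_coe_finset, above]

lemma finite_branch {T : Set Vertex} (hT : T.Finite) (v : Vertex) : (branch T v).Finite :=
  hT.subset Set.inter_subset_left

/-- The number of configurations on the branch at `v`, with burnt parent. -/
def weakCnt (T : Set Vertex) (A : Vertex → Finset ℤ) (v : Vertex) : ℝ := cnt (branch T v) A 0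

/-- The number of configurations on the branch at `v`, with unburnt parent. -/
def strongCnt (T : Set Vertex) (A : Vertex → Finset ℤ) (v : Vertex) : ℝ :=
  cnt (branch T v) A (Pi.single v 1)

/-- The branch is assembled over two bridges: `v` with its first child branch, then the result with
the second. A height at `v` burns against `j` unburnt neighbours iff it exceeds `j`, so the shifts
0, 1, 2 of `m v` count the child branches that are still unburnt when `v` burns. -/
lemma cnt_branch_eq {T : Set Vertex} (hT : T.Finite) {v : Vertex} (hv : v ∈ T)
    (A : Vertex → Finset ℤ) (m : Config) (hm : ∀ b, ∀ u ∈ descendants (child v b), m u = 0) :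
    cnt (branch T v) A m =
      (above A v (m v + 2) * weakCnt T A (child v false)
        + above A v (m v + 1) * strongCnt T A (child v false)
        - above A v (m v + 2) * strongCnt T A (child v false))
        * (weakCnt T A (child v true) - strongCnt T A (child v true))
      + (above A v (m v + 1) * weakCnt T A (child v false)
        + above A v (m v) * strongCnt T A (child v false)
        - above A v (m v + 1) * strongCnt T A (child v false)) * strongCnt T A (child v true) := by
  have hw : ∀ b, ∀ m : Config, (∀ u ∈ descendants (child v b), m u = 0) →
      cnt (branch T (child v b)) A m = weakCnt T A (child v b) := fun b m hm =>
    cnt_congr (fun _ _ => rfl) fun u hu => hm u hu.2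
  have hs : ∀ b, ∀ m : Config, (∀ u ∈ descendants (child v b), m u = 0) →
      cnt (branch T (child v b)) A (m + Pi.single (child v b) 1) = strongCnt T A (child v b) :=
    fun b m hm => cnt_congr (fun _ _ => rfl) fun u hu => by simp [hm u hu.2]
  have hm' : ∀ b, ∀ u ∈ descendants (child v b), (m + Pi.single v 1 : Config) u = 0 := by
    intro b u hu
    have : u ≠ v := by rintro rfl; exact notMem_descendants_child _ _ hu
    simp [hm b u hu, this]
  have h1 : ∀ m : Config, (∀ u ∈ descendants (child v false), m u = 0) →
      cnt ({v} ∪ branch T (child v false)) A m =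
        above A v (m v + 1) * weakCnt T A (child v false)
        + above A v (m v) * strongCnt T A (child v false)
        - above A v (m v + 1) * strongCnt T A (child v false) := by
    intro m hm
    rw [(bridge_left T v).cnt_union (Set.finite_singleton v) (finite_branch hT _), hw _ _ hm,
      hs _ _ hm, cnt_singleton, cnt_singleton]
    simp
  rw [branch_eq hv, (bridge_right T v).cnt_union
    ((Set.finite_singleton v).union (finite_branch hT _)) (finite_branch hT _), h1 _ (hm false),
    h1 _ (hm' false), hw _ _ (hm true), hs _ _ (hm true)]
  have e : m v + 1 + 1 = m v + 2 := by ring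
  simp only [Pi.add_apply, Pi.single_eq_same, e]
  ring

lemma weakCnt_eq {T : Set Vertex} (hT : T.Finite) {v : Vertex} (hv : v ∈ T)
    (A : Vertex → Finset ℤ) :
    weakCnt T A v =
      (above A v 2 * weakCnt T A (child v false)
        + above A v 1 * strongCnt T A (child v false)
        - above A v 2 * strongCnt T A (child v false))
        * (weakCnt T A (child v true) - strongCnt T A (child v true))
      + (above A v 1 * weakCnt T A (child v false)
        + above A v 0 * strongCnt T A (child v false)
        - above A v 1 * strongCnt T A (child v false)) * strongCnt T A (child v true) := by
  rw [weakCnt, cnt_branch_eq hT hv A 0 (by simp)]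
  simp

lemma strongCnt_eq {T : Set Vertex} (hT : T.Finite) {v : Vertex} (hv : v ∈ T)
    (A : Vertex → Finset ℤ) :
    strongCnt T A v =
      (above A v 3 * weakCnt T A (child v false)
        + above A v 2 * strongCnt T A (child v false)
        - above A v 3 * strongCnt T A (child v false))
        * (weakCnt T A (child v true) - strongCnt T A (child v true))
      + (above A v 2 * weakCnt T A (child v false)
        + above A v 1 * strongCnt T A (child v false)
        - above A v 2 * strongCnt T A (child v false)) * strongCnt T A (child v true) := by
  rw [strongCnt, cnt_branch_eq hT hv A (Pi.single v 1)]
  · simp only [Pi.single_eq_same]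
    norm_num
  · intro b u hu
    have : u ≠ v := by rintro rfl; exact notMem_descendants_child _ _ hu
    simp [this]

lemma weakCnt_of_notMem {T : Set Vertex} {v : Vertex} (h : Hereditary T v) (hv : v ∉ T)
    (A : Vertex → Finset ℤ) : weakCnt T A v = 1 := by
  rw [weakCnt, h.branch_eq_empty hv, cnt_empty]

lemma strongCnt_of_notMem {T : Set Vertex} {v : Vertex} (h : Hereditary T v) (hv : v ∉ T)
    (A : Vertex → Finset ℤ) : strongCnt T A v = 1 := by
  rw [strongCnt, h.branch_eq_empty hv, cnt_empty]

/-- All stable heights. -/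
def full : Vertex → Finset ℤ := fun _ => Finset.Icc 1 3

lemma above_full (v : Vertex) : above full v 0 = 3 ∧ above full v 1 = 2 ∧ above full v 2 = 1 ∧
    above full v 3 = 0 := by
  refine ⟨?_, ?_, ?_, ?_⟩ <;>
  · simp only [above, full]
    norm_cast

lemma weakCnt_full {T : Set Vertex} (hT : T.Finite) {v : Vertex} (hv : v ∈ T) :
    weakCnt T full v = weakCnt T full (child v false) * weakCnt T full (child v true)
      + strongCnt T full (child v false) * weakCnt T full (child v true)
      + weakCnt T full (child v false) * strongCnt T full (child v true) := by
  obtain ⟨h0, h1, h2, h3⟩ := above_full v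
  rw [weakCnt_eq hT hv, h0, h1, h2]
  ring

lemma strongCnt_full {T : Set Vertex} (hT : T.Finite) {v : Vertex} (hv : v ∈ T) :
    strongCnt T full v = strongCnt T full (child v false) * weakCnt T full (child v true)
      + weakCnt T full (child v false) * strongCnt T full (child v true) := by
  obtain ⟨h0, h1, h2, h3⟩ := above_full v
  rw [strongCnt_eq hT hv, h1, h2, h3]
  ring

lemma exists_length_lt {T : Set Vertex} (hT : T.Finite) :
    ∃ d, ∀ u ∈ T, u.2.length < d := by
  obtain ⟨d, hd⟩ := (hT.image fun u : Vertex => u.2.length).bddAbove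
  exact ⟨d + 1, fun u hu => Nat.lt_succ_of_le (hd ⟨u, hu, rfl⟩)⟩

/-- Induction from the leaves of a finite set towards its root. -/
lemma branch_induction {T : Set Vertex} (hT : T.Finite) {P : Vertex → Prop}
    (h0 : ∀ v, Hereditary T v → v ∉ T → P v)
    (h1 : ∀ v, Hereditary T v → v ∈ T → (∀ b, P (child v b)) → P v) {v : Vertex}
    (hv : Hereditary T v) : P v := by
  obtain ⟨d, hd⟩ := exists_length_lt hT
  have : ∀ k, ∀ v : Vertex, d ≤ v.2.length + k → Hereditary T v → P v := by
    intro k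
    induction k with
    | zero =>
      intro v hdv hv
      refine h0 v hv fun hvT => ?_
      have := hd v hvT
      omega
    | succ k ih =>
      intro v hdv hv
      by_cases hvT : v ∈ T
      · refine h1 v hv hvT fun b => ih _ ?_ (hv.child b)
        simp only [child, List.length_cons]
        omega
      · exact h0 v hv hvT
  exact this d v (by omega) hv

/-- By induction the children have N/2 ≤ S ≤ N and N'/2 ≤ S' ≤ N', so the new strong count S N' + N
S' lies between N N' and 2 N N', while the weak count exceeds it by exactly N N'. An absent branch
has ratio 1, which is why the bound 2/3 needs `v ∈ T`. -/
lemma strongCnt_bounds {T : Set Vertex} (hT : T.Finite) {v : Vertex} (hv : Hereditary T v) :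
    0 < weakCnt T full v ∧ weakCnt T full v ≤ 2 * strongCnt T full v ∧
      strongCnt T full v ≤ weakCnt T full v ∧
      (v ∈ T → 3 * strongCnt T full v ≤ 2 * weakCnt T full v) := by
  refine branch_induction hT (P := fun v => 0 < weakCnt T full v ∧
    weakCnt T full v ≤ 2 * strongCnt T full v ∧ strongCnt T full v ≤ weakCnt T full v ∧
    (v ∈ T → 3 * strongCnt T full v ≤ 2 * weakCnt T full v)) ?_ ?_ hv
  · intro v hv hvT
    rw [weakCnt_of_notMem hv hvT, strongCnt_of_notMem hv hvT]
    exact ⟨by norm_num, by norm_num, le_rfl, fun h => absurd h hvT⟩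
  · intro v hv hvT ih
    obtain ⟨a1, a2, a3, -⟩ := ih false
    obtain ⟨b1, b2, b3, -⟩ := ih true
    rw [weakCnt_full hT hvT, strongCnt_full hT hvT]
    set N := weakCnt T full (child v false)
    set S := strongCnt T full (child v false)
    set N' := weakCnt T full (child v true)
    set S' := strongCnt T full (child v true)
    have h1 : 0 < N * N' := mul_pos a1 b1
    have h2 : N * N' ≤ 2 * S * N' := by gcongr
    have h3 : N * N' ≤ N * (2 * S') := by gcongr
    have h4 : S * N' ≤ N * N' := by gcongr
    have h5 : N * S' ≤ N * N' := by gcongr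
    exact ⟨by nlinarith, by nlinarith, by nlinarith, fun _ => by nlinarith⟩

/-! ### The shape of subtrees -/

/-- A walk in `S` from `x` to the child must enter the descendants of the child somewhere, and the
only edge entering them comes from `u`. -/
lemma parent_mem {S : Set Vertex} (hS : IsSubtree S) {u x : Vertex} {b : Bool}
    (hu : child u b ∈ S) (hx : x ∈ S) (hxu : x ∉ descendants (child u b)) : u ∈ S := by
  obtain ⟨p⟩ := hS.preconnected ⟨x, hx⟩ ⟨child u b, hu⟩
  obtain ⟨d, -, h1, h2⟩ := p.exists_boundary_dart {w | (w : Vertex) ∉ descendants (child u b)} hxu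
    (by simpa using self_mem_descendants _)
  simp only [Set.mem_ofPred_eq, not_not] at h1 h2
  have ha : bethe.Adj d.fst d.snd := d.adj
  have h3 := eq_of_adj_descendants ha h1 h2
  rw [h3] at ha
  rw [← eq_parent_of_adj ha h1]
  exact d.fst.2

/-- The set `T` lies below `x` and below the root `y` of the other copy, `x` belongs to `T`, and
both parts are hereditary. -/
structure Rooted (T : Set Vertex) (x y : Vertex) : Prop where
  mem : x ∈ T
  eq : y = (!x.1, [])
  subset : T ⊆ descendants x ∪ descendants y
  left : Hereditary T x
  right : Hereditary T y
  root : y ∈ T → x.2 = []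

lemma hereditary_of_isSubtree {T : Set Vertex} (hT : IsSubtree T) {x : Vertex} (hx : x ∈ T) :
    Hereditary T x := fun u hu b h => parent_mem hT h hx fun hx' => by
  have h1 := length_le_of_mem_descendants hu
  have h2 := length_le_of_mem_descendants hx'
  simp only [child, List.length_cons] at h2
  omega

lemma hereditary_of_isSubtree' {T : Set Vertex} (hT : IsSubtree T) {x y : Vertex} (hx : x ∈ T)
    (hy : y.1 ≠ x.1) : Hereditary T y := fun u hu b h => parent_mem hT h hx fun hx' => by
  exact hy (hu.1.symm.trans hx'.1.symm)

lemma Rooted.mono {S T : Set Vertex} {x y : Vertex} (h : Rooted T x y) (hST : S ⊆ T)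
    (hS : IsSubtree S) (hx : x ∈ S) : Rooted S x y :=
  ⟨hx, h.eq, hST.trans h.subset, hereditary_of_isSubtree hS hx,
    hereditary_of_isSubtree' hS hx (by rw [h.eq]; simp), fun hy => h.root (hST hy)⟩

lemma rooted_of_root_mem {T : Set Vertex} (hT : IsSubtree T) {s : Bool} (hs : (s, []) ∈ T) :
    Rooted T (s, []) (!s, []) := by
  refine ⟨hs, rfl, fun u _ => ?_, hereditary_of_isSubtree hT hs,
    hereditary_of_isSubtree' hT hs (by simp), fun _ => rfl⟩
  by_cases h : u.1 = s
  · exact Or.inl ⟨h, List.nil_suffix⟩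
  · exact Or.inr ⟨by simpa using Bool.eq_not.2 h, List.nil_suffix⟩

/-- If `T` misses both roots, a vertex of least depth serves as `x` and the branch at `y` is empty,
with both counts equal to 1, so the same two-sided formulas remain valid. -/
lemma exists_rooted {T : Set Vertex} (hT : IsSubtree T) : ∃ x y, Rooted T x y := by
  by_cases h : ∃ s : Bool, (s, []) ∈ T
  · obtain ⟨s, hs⟩ := h
    exact ⟨_, _, rooted_of_root_mem hT hs⟩
  · push Not at h
    obtain ⟨⟨x0, hx0⟩⟩ := hT.nonempty
    obtain ⟨x, hx, hmin⟩ := WellFounded.has_min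
      (InvImage.wf (fun u : Vertex => u.2.length) Nat.lt_wfRel.wf) T ⟨x0, hx0⟩
    refine ⟨x, (!x.1, []), hx, rfl, fun u hu => Or.inl ?_, hereditary_of_isSubtree hT hx,
      hereditary_of_isSubtree' hT hx (by simp), fun hy => absurd hy (h _)⟩
    by_contra hux
    obtain ⟨s, l⟩ := x
    cases l with
    | nil => exact h _ hx
    | cons b l =>
      refine hmin (s, l) (parent_mem (u := (s, l)) (b := b) hT hx hu hux) ?_
      simp [InvImage, WellFoundedRelation.rel]

lemma Rooted.eq_union {T : Set Vertex} {x y : Vertex} (h : Rooted T x y) :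
    T = branch T x ∪ branch T y := by
  rw [branch, branch, ← Set.inter_union_distrib_left, Set.inter_eq_left.2 h.subset]

lemma Rooted.bridge {T : Set Vertex} {x y : Vertex} (h : Rooted T x y) :
    Bridge (branch T x) (branch T y) x y := by
  have hxy : x.1 ≠ y.1 := by rw [h.eq]; simp
  refine ⟨Set.disjoint_left.2 fun u hu hu' => hxy (hu.2.1.symm.trans hu'.2.1), ?_, ?_⟩
  · intro u hu w hw ha
    have hu' : u ∉ descendants y := fun hu' => hxy (hu.2.1.symm.trans hu'.1)
    have hwy := eq_of_adj_descendants ha hu' hw.2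
    subst hwy
    refine ⟨?_, rfl⟩
    rcases adj_iff.1 ha with ⟨b, hb⟩ | ⟨b, hb⟩ | ⟨h1, -, -⟩
    · have := congrArg Prod.snd hb
      rw [h.eq] at this
      simp [child] at this
    · have := congrArg Prod.fst hb
      exact absurd (hu.2.1.symm.trans this) hxy
    · exact Prod.ext hu.2.1 (h1.trans (h.root hw.1).symm)
  · intro hx hy
    exact adj_iff.2 (Or.inr (Or.inr ⟨h.root hy.1, by rw [h.eq], hxy⟩))

lemma Rooted.cnt_eq {T : Set Vertex} {x y : Vertex} (h : Rooted T x y) (hT : T.Finite)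
    (A : Vertex → Finset ℤ) :
    cnt T A 0 = strongCnt T A x * weakCnt T A y + weakCnt T A x * strongCnt T A y
      - strongCnt T A x * strongCnt T A y := by
  conv_lhs => rw [h.eq_union]
  rw [h.bridge.cnt_union (finite_branch hT x) (finite_branch hT y)]
  simp [strongCnt, weakCnt]

/-- The total is the product of the weak counts minus the product of the differences weak minus
strong, and each difference is at most half the weak count. -/
lemma Rooted.cnt_full_ge {T : Set Vertex} {x y : Vertex} (h : Rooted T x y) (hT : T.Finite) :
    3 / 4 * (weakCnt T full x * weakCnt T full y) ≤ cnt T full 0 := by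
  obtain ⟨a1, a2, a3, -⟩ := strongCnt_bounds hT h.left
  obtain ⟨b1, b2, b3, -⟩ := strongCnt_bounds hT h.right
  rw [h.cnt_eq hT]
  have := mul_le_mul (show weakCnt T full x - strongCnt T full x ≤ weakCnt T full x / 2 by linarith)
    (show weakCnt T full y - strongCnt T full y ≤ weakCnt T full y / 2 by linarith)
    (by linarith) (by linarith)
  nlinarith

lemma Rooted.cnt_full_pos {T : Set Vertex} {x y : Vertex} (h : Rooted T x y) (hT : T.Finite) :
    0 < cnt T full 0 := by
  have h1 := h.cnt_full_ge hT
  have h2 := mul_pos (strongCnt_bounds hT h.left).1 (strongCnt_bounds hT h.right).1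
  linarith

/-! ### Ratios of counts along the net of finite subtrees -/

/-- The probability of `A` on the branch at `v`. -/
def weakRatio (T : Set Vertex) (A : Vertex → Finset ℤ) (v : Vertex) : ℝ :=
  weakCnt T A v / weakCnt T full v

/-- The probability on the branch at `v` of `A` and of being strongly allowed. -/
def strongRatio (T : Set Vertex) (A : Vertex → Finset ℤ) (v : Vertex) : ℝ :=
  strongCnt T A v / weakCnt T full v

lemma weakRatio_full {T : Set Vertex} (hT : T.Finite) {v : Vertex} (hv : Hereditary T v) :
    weakRatio T full v = 1 := div_self (strongCnt_bounds hT hv).1.ne'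

lemma strongRatio_bounds {T : Set Vertex} (hT : T.Finite) {v : Vertex} (hv : Hereditary T v) :
    1 / 2 ≤ strongRatio T full v ∧ strongRatio T full v ≤ 1 := by
  obtain ⟨h1, h2, h3, -⟩ := strongCnt_bounds hT hv
  refine ⟨(le_div_iff₀ h1).2 (by linarith), (div_le_one h1).2 h3⟩

lemma ratio_den {T : Set Vertex} (hT : T.Finite) {v : Vertex} (hv : Hereditary T v) (hvT : v ∈ T) :
    weakCnt T full v = weakCnt T full (child v false) * weakCnt T full (child v true) *
      (1 + strongRatio T full (child v false) + strongRatio T full (child v true)) := by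
  have h1 := (strongCnt_bounds hT (hv.child false)).1.ne'
  have h2 := (strongCnt_bounds hT (hv.child true)).1.ne'
  rw [weakCnt_full hT hvT, strongRatio, strongRatio]
  field_simp

lemma weakRatio_eq {T : Set Vertex} (hT : T.Finite) {v : Vertex} (hv : Hereditary T v)
    (hvT : v ∈ T) (A : Vertex → Finset ℤ) :
    weakRatio T A v =
      ((above A v 2 * weakRatio T A (child v false)
        + above A v 1 * strongRatio T A (child v false)
        - above A v 2 * strongRatio T A (child v false))
        * (weakRatio T A (child v true) - strongRatio T A (child v true))
      + (above A v 1 * weakRatio T A (child v false)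
        + above A v 0 * strongRatio T A (child v false)
        - above A v 1 * strongRatio T A (child v false)) * strongRatio T A (child v true)) /
      (1 + strongRatio T full (child v false) + strongRatio T full (child v true)) := by
  have h1 := (strongCnt_bounds hT (hv.child false)).1.ne'
  have h2 := (strongCnt_bounds hT (hv.child true)).1.ne'
  rw [weakRatio, ratio_den hT hv hvT, ← div_div, weakCnt_eq hT hvT A]
  congr 1
  simp only [weakRatio, strongRatio]
  field_simp

lemma strongRatio_eq {T : Set Vertex} (hT : T.Finite) {v : Vertex} (hv : Hereditary T v)
    (hvT : v ∈ T) (A : Vertex → Finset ℤ) :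
    strongRatio T A v =
      ((above A v 3 * weakRatio T A (child v false)
        + above A v 2 * strongRatio T A (child v false)
        - above A v 3 * strongRatio T A (child v false))
        * (weakRatio T A (child v true) - strongRatio T A (child v true))
      + (above A v 2 * weakRatio T A (child v false)
        + above A v 1 * strongRatio T A (child v false)
        - above A v 2 * strongRatio T A (child v false)) * strongRatio T A (child v true)) /
      (1 + strongRatio T full (child v false) + strongRatio T full (child v true)) := by
  have h1 := (strongCnt_bounds hT (hv.child false)).1.ne'
  have h2 := (strongCnt_bounds hT (hv.child true)).1.ne'
  rw [strongRatio, ratio_den hT hv hvT, ← div_div, strongCnt_eq hT hvT A]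
  congr 1
  simp only [weakRatio, strongRatio]
  field_simp

lemma strongRatio_full {T : Set Vertex} (hT : T.Finite) {v : Vertex} (hv : Hereditary T v)
    (hvT : v ∈ T) : strongRatio T full v =
      (strongRatio T full (child v false) + strongRatio T full (child v true)) /
      (1 + strongRatio T full (child v false) + strongRatio T full (child v true)) := by
  obtain ⟨-, h1, h2, h3⟩ := above_full v
  rw [strongRatio_eq hT hv hvT, h1, h2, h3, weakRatio_full hT (hv.child _),
    weakRatio_full hT (hv.child _)]
  congr 1
  ring

/-- The recursion (a + b)/(1 + a + b) is increasing in both arguments, and an absent branch has the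
largest possible ratio 1. Adding vertices can only lower the ratio. -/
lemma strongRatio_antitone {S T : Set Vertex} (hT : T.Finite) (hST : S ⊆ T) {v : Vertex}
    (hvS : Hereditary S v) (hvT : Hereditary T v) :
    strongRatio T full v ≤ strongRatio S full v := by
  have hS := hT.subset hST
  have key : Hereditary S v → strongRatio T full v ≤ strongRatio S full v := by
    refine branch_induction hT
      (P := fun v => Hereditary S v → strongRatio T full v ≤ strongRatio S full v) ?_ ?_ hvT
    · intro v hv hvT hvS
      rw [strongRatio, strongRatio, weakCnt_of_notMem hv hvT, strongCnt_of_notMem hv hvT,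
        weakCnt_of_notMem hvS (fun h => hvT (hST h)),
        strongCnt_of_notMem hvS (fun h => hvT (hST h))]
    · intro v hv hvT ih hvS
      by_cases h : v ∈ S
      · have h0 := ih false (hvS.child _)
        have h1 := ih true (hvS.child _)
        have b0 := (strongRatio_bounds hT (hv.child false)).1
        have b1 := (strongRatio_bounds hT (hv.child true)).1
        rw [strongRatio_full hT hv hvT, strongRatio_full hS hvS h,
          div_le_div_iff₀ (by linarith) (by linarith)]
        nlinarith
      · refine (strongRatio_bounds hT hv).2.trans_eq ?_
        rw [strongRatio, weakCnt_of_notMem hvS h, strongCnt_of_notMem hvS h, div_one]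
  exact key hvS

/-! ### The net of finite subtrees -/

lemma isSubtree_singleton (v : Vertex) : IsSubtree {v} := by
  have : Subsingleton ({v} : Set Vertex) := Set.subsingleton_singleton.coe_sort
  exact ⟨SimpleGraph.Preconnected.of_subsingleton⟩

/-- A single vertex as a finite subtree. -/
def single (T : Set Vertex) (v : Vertex) (hv : v ∈ T) : FiniteSubtree T :=
  ⟨{v}, by simpa using hv, by simpa using isSubtree_singleton v⟩

/-- Two finite subtrees become one after adding a walk in `T` that joins them. Directedness makes
`atTop` a proper filter, so that limits along the net are unique. -/
lemma exists_finiteSubtree_ge {T : Set Vertex} (hT : IsSubtree T) (S S' : FiniteSubtree T) :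
    ∃ S'' : FiniteSubtree T, S ≤ S'' ∧ S' ≤ S'' := by
  classical
  obtain ⟨⟨u, hu⟩⟩ := S.2.2.nonempty
  obtain ⟨⟨w, hw⟩⟩ := S'.2.2.nonempty
  obtain ⟨p⟩ := hT.preconnected ⟨u, S.2.1 hu⟩ ⟨w, S'.2.1 hw⟩
  let q := p.map (SimpleGraph.Embedding.induce T).toHom
  have hq : (bethe.induce {z | z ∈ q.support}).Connected := q.connected_induce_support
  have hqT : ∀ z ∈ q.support, z ∈ T := by
    intro z hz
    simp only [q, SimpleGraph.Walk.support_map, List.mem_map] at hz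
    obtain ⟨a, -, rfl⟩ := hz
    exact a.2
  have h1 : (bethe.induce ((S.1 : Set Vertex) ∪ {z | z ∈ q.support})).Connected :=
    SimpleGraph.induce_union_connected S.2.2.preconnected hq.preconnected
      ⟨u, hu, q.start_mem_support⟩
  have h2 : (bethe.induce (((S.1 : Set Vertex) ∪ {z | z ∈ q.support}) ∪ S'.1)).Connected :=
    SimpleGraph.induce_union_connected h1.preconnected S'.2.2.preconnected
      ⟨w, Or.inr q.end_mem_support, hw⟩
  have e : (((S.1 ∪ q.support.toFinset) ∪ S'.1 : Finset Vertex) : Set Vertex) =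
      ((S.1 : Set Vertex) ∪ {z | z ∈ q.support}) ∪ S'.1 := by
    ext z; simp [or_assoc]
  refine ⟨⟨(S.1 ∪ q.support.toFinset) ∪ S'.1, ?_, ?_⟩, ?_, ?_⟩
  · rw [e]
    rintro z ((hz | hz) | hz)
    · exact S.2.1 hz
    · exact hqT z hz
    · exact S'.2.1 hz
  · rw [IsSubtree, e]
    exact h2
  · intro z hz; simp [hz]
  · intro z hz; simp [hz]

lemma isDirected_finiteSubtree {T : Set Vertex} (hT : IsSubtree T) :
    IsDirected (FiniteSubtree T) (· ≤ ·) := ⟨exists_finiteSubtree_ge hT⟩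

lemma nonempty_finiteSubtree {T : Set Vertex} (hT : IsSubtree T) : Nonempty (FiniteSubtree T) := by
  obtain ⟨⟨u, hu⟩⟩ := hT.nonempty
  exact ⟨single T u hu⟩

lemma eventually_mem {T : Set Vertex} {v : Vertex} (hv : v ∈ T) :
    ∀ᶠ S : FiniteSubtree T in atTop, v ∈ S.1 := by
  filter_upwards [eventually_ge_atTop (single T v hv)] with S hS
  exact hS (by simp [single])

lemma eventually_subset {T : Set Vertex} (F : Finset Vertex) :
    ∀ᶠ S : FiniteSubtree T in atTop, ∀ v ∈ F, v ∈ T → v ∈ S.1 := by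
  rw [eventually_all_finset]
  intro v _
  by_cases hv : v ∈ T
  · filter_upwards [eventually_mem hv] with S hS _ using hS
  · exact Eventually.of_forall fun S h => absurd h hv

lemma exists_tendsto_of_antitone_ge {ι : Type*} [Preorder ι] [IsDirected ι (· ≤ ·)]
    {f : ι → ℝ} {i₀ : ι} (hf : ∀ i j, i₀ ≤ i → i ≤ j → f j ≤ f i) (h0 : ∀ i, i₀ ≤ i → 0 ≤ f i) :
    ∃ l, Tendsto f atTop (𝓝 l) := by
  refine ⟨_, tendsto_comp_val_Ici_atTop (a := i₀).1
    (tendsto_atTop_ciInf (f := fun i : Set.Ici i₀ => f i)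
    (fun i j hij => hf i j i.2 hij) ⟨0, ?_⟩)⟩
  rintro _ ⟨i, rfl⟩
  exact h0 i i.2

lemma Hereditary.of_mem {T : Set Vertex} {v w : Vertex} (h : Hereditary T v)
    (hw : w ∈ descendants v) : Hereditary T w := fun u hu => h u (descendants_trans hu hw)

lemma Rooted.hereditary {T : Set Vertex} {x y v : Vertex} (h : Rooted T x y)
    (hv : v ∈ descendants x ∪ descendants y) : Hereditary T v :=
  hv.elim (fun h' => h.left.of_mem h') fun h' => h.right.of_mem h'

lemma Rooted.exists_tendsto_strongRatio {T : Set Vertex} (hT : IsSubtree T) {x y v : Vertex}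
    (h : Rooted T x y) (hv : v ∈ descendants x ∪ descendants y) :
    ∃ l, 1 / 2 ≤ l ∧
      Tendsto (fun S : FiniteSubtree T => strongRatio (S.1 : Set Vertex) full v) atTop (𝓝 l) := by
  have := isDirected_finiteSubtree hT
  have := nonempty_finiteSubtree hT
  have hR : ∀ S : FiniteSubtree T, single T x h.mem ≤ S → Rooted (S.1 : Set Vertex) x y :=
    fun S hS => h.mono S.2.1 S.2.2 (hS (by simp [single]))
  obtain ⟨l, hl⟩ := exists_tendsto_of_antitone_ge
    (f := fun S : FiniteSubtree T => strongRatio (S.1 : Set Vertex) full v) (i₀ := single T x h.mem)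
    (fun i j hi hij => strongRatio_antitone j.1.finite_toSet (by exact_mod_cast hij)
      ((hR i hi).hereditary hv) ((hR j (hi.trans hij)).hereditary hv))
    (fun i hi => by
      have := (strongRatio_bounds i.1.finite_toSet ((hR i hi).hereditary hv)).1; linarith)
  refine ⟨l, ge_of_tendsto hl ?_, hl⟩
  filter_upwards [eventually_ge_atTop (single T x h.mem)] with S hS
  exact (strongRatio_bounds S.1.finite_toSet ((hR S hS).hereditary hv)).1

/-- Below all of `F` the heights are unconstrained, and convergence there is the monotone case. Each
of the finitely many levels above is a rational function of the level below, with denominator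
tending to a positive limit. -/
lemma Rooted.exists_tendsto_ratio {T : Set Vertex} (hT : IsSubtree T) {x y : Vertex}
    (h : Rooted T x y) {A : Vertex → Finset ℤ} {F : Finset Vertex} (hA : ∀ v ∉ F, A v = full v)
    {v : Vertex} (hv : v ∈ descendants x ∪ descendants y) :
    (∃ l, Tendsto (fun S : FiniteSubtree T => weakRatio (S.1 : Set Vertex) A v) atTop (𝓝 l)) ∧
    ∃ l, Tendsto (fun S : FiniteSubtree T => strongRatio (S.1 : Set Vertex) A v) atTop (𝓝 l) := by
  have hR : ∀ᶠ S : FiniteSubtree T in atTop, Rooted (S.1 : Set Vertex) x y := by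
    filter_upwards [eventually_mem h.mem] with S hS using h.mono S.2.1 S.2.2 hS
  obtain ⟨d, hd⟩ := exists_length_lt F.finite_toSet
  have key : ∀ k, ∀ v : Vertex, d ≤ v.2.length + k → v ∈ descendants x ∪ descendants y →
    (∃ l, Tendsto (fun S : FiniteSubtree T => weakRatio (S.1 : Set Vertex) A v) atTop (𝓝 l)) ∧
    ∃ l, Tendsto (fun S : FiniteSubtree T => strongRatio (S.1 : Set Vertex) A v) atTop (𝓝 l) := by
    intro k
    induction k with
    | zero =>
      intro v hdv hv
      have hAv : ∀ u ∈ descendants v, A u = full u := by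
        intro u hu
        refine hA u fun huF => ?_
        have h1 := hd u huF
        have h2 := length_le_of_mem_descendants hu
        omega
      have e1 : ∀ S : FiniteSubtree T, weakRatio (S.1 : Set Vertex) A v =
          weakRatio (S.1 : Set Vertex) full v := fun S => by
        rw [weakRatio, weakCnt, cnt_congr (fun u hu => hAv u hu.2) fun _ _ => rfl]; rfl
      have e2 : ∀ S : FiniteSubtree T, strongRatio (S.1 : Set Vertex) A v =
          strongRatio (S.1 : Set Vertex) full v := fun S => by
        rw [strongRatio, strongCnt, cnt_congr (fun u hu => hAv u hu.2) fun _ _ => rfl]; rfl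
      simp only [e1, e2]
      refine ⟨⟨1, ?_⟩, ?_⟩
      · refine tendsto_const_nhds.congr' ?_
        filter_upwards [hR] with S hS
        rw [weakRatio_full S.1.finite_toSet (hS.hereditary hv)]
      · obtain ⟨l, -, hl⟩ := h.exists_tendsto_strongRatio hT hv
        exact ⟨l, hl⟩
    | succ k ih =>
      intro v hdv hv
      by_cases hvT : v ∈ T
      · have hc : ∀ b, child v b ∈ descendants x ∪ descendants y := fun b =>
          hv.imp (fun h => child_mem_descendants h b) fun h => child_mem_descendants h b
        have hl : ∀ b, d ≤ (child v b).2.length + k := fun b => by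
          simp only [child, List.length_cons]; omega
        obtain ⟨⟨n0, hn0⟩, s0, hs0⟩ := ih _ (hl false) (hc false)
        obtain ⟨⟨n1, hn1⟩, s1, hs1⟩ := ih _ (hl true) (hc true)
        obtain ⟨σ0, hσ0, hl0⟩ := h.exists_tendsto_strongRatio hT (hc false)
        obtain ⟨σ1, hσ1, hl1⟩ := h.exists_tendsto_strongRatio hT (hc true)
        have hden : Tendsto (fun S : FiniteSubtree T =>
            1 + strongRatio (S.1 : Set Vertex) full (child v false)
              + strongRatio (S.1 : Set Vertex) full (child v true)) atTop (𝓝 (1 + σ0 + σ1)) :=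
          (tendsto_const_nhds.add hl0).add hl1
        have hne : 1 + σ0 + σ1 ≠ 0 := by linarith
        have main : ∀ a b c : ℝ, Tendsto (fun S : FiniteSubtree T =>
            ((a * weakRatio (S.1 : Set Vertex) A (child v false)
              + b * strongRatio (S.1 : Set Vertex) A (child v false)
              - a * strongRatio (S.1 : Set Vertex) A (child v false))
              * (weakRatio (S.1 : Set Vertex) A (child v true)
                - strongRatio (S.1 : Set Vertex) A (child v true))
            + (b * weakRatio (S.1 : Set Vertex) A (child v false)
              + c * strongRatio (S.1 : Set Vertex) A (child v false)
              - b * strongRatio (S.1 : Set Vertex) A (child v false))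
              * strongRatio (S.1 : Set Vertex) A (child v true)) /
            (1 + strongRatio (S.1 : Set Vertex) full (child v false)
              + strongRatio (S.1 : Set Vertex) full (child v true))) atTop
            (𝓝 (((a * n0 + b * s0 - a * s0) * (n1 - s1) + (b * n0 + c * s0 - b * s0) * s1) /
              (1 + σ0 + σ1))) := fun a b c =>
          (((((hn0.const_mul a).add (hs0.const_mul b)).sub (hs0.const_mul a)).mul
            (hn1.sub hs1)).add ((((hn0.const_mul b).add (hs0.const_mul c)).sub
            (hs0.const_mul b)).mul hs1)).div hden hne
        have hev : ∀ᶠ S : FiniteSubtree T in atTop,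
            Hereditary (S.1 : Set Vertex) v ∧ v ∈ (S.1 : Set Vertex) := by
          filter_upwards [hR, eventually_mem hvT] with S h1 h2 using ⟨h1.hereditary hv, h2⟩
        refine ⟨⟨_, (main (above A v 2) (above A v 1) (above A v 0)).congr' ?_⟩,
          ⟨_, (main (above A v 3) (above A v 2) (above A v 1)).congr' ?_⟩⟩
        · filter_upwards [hev] with S hS
          exact (weakRatio_eq S.1.finite_toSet hS.1 hS.2 A).symm
        · filter_upwards [hev] with S hS
          exact (strongRatio_eq S.1.finite_toSet hS.1 hS.2 A).symm
      · have hnot : ∀ S : FiniteSubtree T, v ∉ (S.1 : Set Vertex) := fun S hS => hvT (S.2.1 hS)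
        refine ⟨⟨1, ?_⟩, ⟨1, ?_⟩⟩
        · refine tendsto_const_nhds.congr' ?_
          filter_upwards [hR] with S hS
          simp only [weakRatio, weakCnt_of_notMem (hS.hereditary hv) (hnot S), div_one]
        · refine tendsto_const_nhds.congr' ?_
          filter_upwards [hR] with S hS
          simp only [strongRatio, weakCnt_of_notMem (hS.hereditary hv) (hnot S),
            strongCnt_of_notMem (hS.hereditary hv) (hnot S), div_one]
  exact key d v (by omega) hv

lemma Rooted.cnt_div {T : Set Vertex} {x y : Vertex} (h : Rooted T x y) (hT : T.Finite)
    (A : Vertex → Finset ℤ) :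
    cnt T A 0 / cnt T full 0 =
      (strongRatio T A x * weakRatio T A y + weakRatio T A x * strongRatio T A y
        - strongRatio T A x * strongRatio T A y) /
      (strongRatio T full x + strongRatio T full y
        - strongRatio T full x * strongRatio T full y) := by
  have h1 := (strongCnt_bounds hT h.left).1.ne'
  have h2 := (strongCnt_bounds hT h.right).1.ne'
  rw [h.cnt_eq hT, h.cnt_eq hT]
  have e : ∀ a b c d : ℝ, a * b + c * d - a * d =
      weakCnt T full x * weakCnt T full y * (a / weakCnt T full x * (b / weakCnt T full y) +
      c / weakCnt T full x * (d / weakCnt T full y)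
      - a / weakCnt T full x * (d / weakCnt T full y)) := by
    intro a b c d
    field_simp
  rw [e, e (strongCnt T full x), mul_div_mul_left _ _ (mul_ne_zero h1 h2), div_self h1, div_self h2]
  simp only [weakRatio, strongRatio, one_mul, mul_one]

lemma exists_tendsto_cnt_div {T : Set Vertex} (hT : IsSubtree T) {A : Vertex → Finset ℤ}
    {F : Finset Vertex} (hA : ∀ v ∉ F, A v = full v) :
    ∃ l, Tendsto (fun S : FiniteSubtree T =>
      cnt (S.1 : Set Vertex) A 0 / cnt (S.1 : Set Vertex) full 0) atTop (𝓝 l) := by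
  obtain ⟨x, y, h⟩ := exists_rooted hT
  have hx : x ∈ descendants x ∪ descendants y := Or.inl (self_mem_descendants x)
  have hy : y ∈ descendants x ∪ descendants y := Or.inr (self_mem_descendants y)
  obtain ⟨⟨n0, hn0⟩, s0, hs0⟩ := h.exists_tendsto_ratio hT hA hx
  obtain ⟨⟨n1, hn1⟩, s1, hs1⟩ := h.exists_tendsto_ratio hT hA hy
  obtain ⟨σ0, hσ0, hl0⟩ := h.exists_tendsto_strongRatio hT hx
  obtain ⟨σ1, hσ1, hl1⟩ := h.exists_tendsto_strongRatio hT hy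
  have hden : Tendsto (fun S : FiniteSubtree T => strongRatio (S.1 : Set Vertex) full x
      + strongRatio (S.1 : Set Vertex) full y
      - strongRatio (S.1 : Set Vertex) full x * strongRatio (S.1 : Set Vertex) full y) atTop
      (𝓝 (σ0 + σ1 - σ0 * σ1)) := (hl0.add hl1).sub (hl0.mul hl1)
  -- For a, b in [1/2, 1], a + b - ab = 1 - (1 - a)(1 - b) ≥ 3/4.
  have hne : ∀ᶠ S : FiniteSubtree T in atTop, 3 / 4 ≤ strongRatio (S.1 : Set Vertex) full x
      + strongRatio (S.1 : Set Vertex) full y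
      - strongRatio (S.1 : Set Vertex) full x * strongRatio (S.1 : Set Vertex) full y := by
    filter_upwards [eventually_mem h.mem] with S hS
    have hR := h.mono S.2.1 S.2.2 hS
    obtain ⟨a, b⟩ := strongRatio_bounds S.1.finite_toSet hR.left
    obtain ⟨c, d⟩ := strongRatio_bounds S.1.finite_toSet hR.right
    nlinarith
  have := isDirected_finiteSubtree hT
  have := nonempty_finiteSubtree hT
  have hpos := ge_of_tendsto hden hne
  refine ⟨_, ((((hs0.mul hn1).add (hn0.mul hs1)).sub (hs0.mul hs1)).div hden
    (by linarith)).congr' ?_⟩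
  filter_upwards [eventually_mem h.mem] with S hS
  exact ((h.mono S.2.1 S.2.2 hS).cnt_div S.1.finite_toSet A).symm

/-! ### Sandpile measures -/

lemma recurrent_eq (T : Set Vertex) : recurrent T = cfg T full 0 := by
  ext η
  simp [recurrent, cfg, full, Finset.mem_Icc]

lemma finite_recurrent {T : Set Vertex} (hT : T.Finite) : (recurrent T).Finite := by
  rw [recurrent_eq]; exact finite_cfg hT _ _

lemma IsSubtree.cnt_pos {T : Set Vertex} (h : IsSubtree T) (hT : T.Finite) : 0 < cnt T full 0 := by
  obtain ⟨x, y, hR⟩ := exists_rooted h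
  exact hR.cnt_full_pos hT

lemma nonempty_recurrent {T : Set Vertex} (h : IsSubtree T) (hT : T.Finite) :
    (recurrent T).Nonempty := by
  have := h.cnt_pos hT
  rw [cnt, ← recurrent_eq, Nat.cast_pos] at this
  exact Set.nonempty_of_ncard_ne_zero this.ne'

lemma isProbabilityMeasure_recurrent {T : Set Vertex} (h : IsSubtree T) (hT : T.Finite) :
    IsProbabilityMeasure (uniformOn (recurrent T)) :=
  isProbabilityMeasure_uniformOn (finite_recurrent hT) (nonempty_recurrent h hT)

lemma uniformOn_recurrent_apply {T : Set Vertex} (h : IsSubtree T) (hT : T.Finite)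
    (E : Set Config) :
    uniformOn (recurrent T) E = ENNReal.ofReal ((recurrent T ∩ E).ncard / cnt T full 0) := by
  have hf := finite_recurrent hT
  rw [uniformOn, cond_apply hf.measurableSet, Measure.count_apply_finite _ hf,
    Measure.count_apply_finite _ (hf.inter_of_left E), ← Set.ncard_eq_toFinset_card _ hf,
    ← Set.ncard_eq_toFinset_card _ (hf.inter_of_left E),
    ENNReal.ofReal_div_of_pos (h.cnt_pos hT), cnt, ← recurrent_eq, ENNReal.ofReal_natCast,
    ENNReal.ofReal_natCast, mul_comm, div_eq_mul_inv]

/-- The configurations with heights in `B` on `F`. -/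
def heightsIn (F : Finset Vertex) (B : Vertex → Finset ℤ) : Set Config := {η | ∀ v ∈ F, η v ∈ B v}

open Classical in
/-- Stable heights, in `B` on `F`. -/
def stableIn (F : Finset Vertex) (B : Vertex → Finset ℤ) : Vertex → Finset ℤ :=
  fun v => if v ∈ F then full v ∩ B v else full v

/-- Configurations vanish outside `S`, so the constraints there are vacuous precisely when they
allow the value 0. -/
lemma recurrent_inter_heightsIn {S : Set Vertex} {F : Finset Vertex} {B : Vertex → Finset ℤ}
    (h : ∀ v ∈ F, v ∉ S → 0 ∈ B v) : recurrent S ∩ heightsIn F B = cfg S (stableIn F B) 0 := by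
  rw [recurrent_eq]
  ext η
  constructor
  · rintro ⟨⟨h1, h2⟩, h3⟩
    refine ⟨fun v hv => ?_, h2⟩
    by_cases hF : v ∈ F
    · simp [stableIn, hF, h1 v hv, h3 v hF]
    · simp [stableIn, hF, h1 v hv]
  · rintro ⟨h1, h2, h3⟩
    refine ⟨⟨fun v hv => ?_, h2, h3⟩, fun v hF => ?_⟩
    · have := h1 v hv
      by_cases hF : v ∈ F
      · simp only [stableIn, hF, if_true, Finset.mem_inter] at this; exact this.1
      · simpa [stableIn, hF] using this
    · by_cases hv : v ∈ S
      · have := h1 v hv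
        simp only [stableIn, hF, if_true, Finset.mem_inter] at this; exact this.2
      · rw [h2 v hv]; exact h v hF hv

lemma exists_tendsto_heightsIn {T : Set Vertex} (hT : IsSubtree T) (F : Finset Vertex)
    (B : Vertex → Finset ℤ) : ∃ L, Tendsto (fun S : FiniteSubtree T =>
      uniformOn (recurrent (S.1 : Set Vertex)) (heightsIn F B)) atTop (𝓝 L) := by
  by_cases h : ∀ v ∈ F, v ∉ T → 0 ∈ B v
  · obtain ⟨l, hl⟩ := exists_tendsto_cnt_div hT (A := stableIn F B) (F := F)
      fun v hv => by simp [stableIn, hv]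
    refine ⟨_, (ENNReal.tendsto_ofReal hl).congr' ?_⟩
    filter_upwards [eventually_subset F] with S hS
    rw [uniformOn_recurrent_apply S.2.2 S.1.finite_toSet, recurrent_inter_heightsIn, cnt]
    intro v hv hvS
    exact h v hv fun hvT => hvS (hS v hv hvT)
  · push Not at h
    obtain ⟨v, hF, hvT, h0⟩ := h
    refine ⟨0, tendsto_const_nhds.congr fun S => ?_⟩
    rw [uniformOn_recurrent_apply S.2.2 S.1.finite_toSet]
    have : recurrent (S.1 : Set Vertex) ∩ heightsIn F B = ∅ := by
      rw [Set.eq_empty_iff_forall_notMem]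
      rintro η ⟨h1, h2⟩
      have := h2 v hF
      rw [h1.2.1 v fun hvS => hvT (S.2.1 hvS)] at this
      exact h0 this
    simp [this]

lemma cylinder_eq (F : Finset Vertex) (ξ : Config) :
    {η : Config | ∀ v ∈ F, η v = ξ v} = heightsIn F fun v => {ξ v} := by
  ext η; simp [heightsIn]

/-! ### Existence and uniqueness of the infinite-volume measure -/

/-- Configurations with heights `0, …, 3`, a compact space. -/
abbrev Bounded : Type := Vertex → Fin 4

/-- A bounded configuration as a configuration. -/
def Bounded.toConfig (f : Bounded) : Config := fun v => ((f v : ℕ) : ℤ)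

/-- Truncation of a configuration. -/
def truncate (η : Config) : Bounded := fun v => Fin.ofNat 4 (η v).toNat

lemma measurable_toConfig : Measurable Bounded.toConfig :=
  measurable_pi_lambda _ fun v => (measurable_of_countable fun k : Fin 4 => ((k : ℕ) : ℤ)).comp
    (measurable_pi_apply v)

lemma measurable_truncate : Measurable truncate :=
  measurable_pi_lambda _ fun v => (measurable_of_countable fun k : ℤ => Fin.ofNat 4 k.toNat).comp
    (measurable_pi_apply v)

lemma toConfig_truncate {T : Set Vertex} {η : Config} (h : η ∈ recurrent T) :
    (truncate η).toConfig = η := by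
  ext v
  have : 0 ≤ η v ∧ η v ≤ 3 := by
    by_cases hv : v ∈ T
    · have := h.1 v hv; omega
    · rw [h.2.1 v hv]; omega
  simp only [Bounded.toConfig, truncate, Fin.ofNat]
  have h4 : (η v).toNat % 4 = (η v).toNat := Nat.mod_eq_of_lt (by omega)
  rw [h4]
  omega

lemma isClopen_toConfig_heightsIn (F : Finset Vertex) (B : Vertex → Finset ℤ) :
    IsClopen (Bounded.toConfig ⁻¹' heightsIn F B) := by
  have : Bounded.toConfig ⁻¹' heightsIn F B =
      ⋂ v ∈ F, (fun f : Bounded => f v) ⁻¹' {k | ((k : ℕ) : ℤ) ∈ B v} := by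
    ext f; simp [heightsIn, Bounded.toConfig]
  rw [this]
  exact isClopen_biInter_finset fun v _ => (isClopen_discrete _).preimage (continuous_apply v)

lemma measurableSet_heightsIn (F : Finset Vertex) (B : Vertex → Finset ℤ) :
    MeasurableSet (heightsIn F B) := by
  have : heightsIn F B = ⋂ v ∈ F, (fun η : Config => η v) ⁻¹' (B v : Set ℤ) := by
    ext f; simp [heightsIn]
  rw [this]
  exact F.measurableSet_biInter fun v _ => measurable_pi_apply v (B v).measurableSet

/-- The probability measures on the compact space `Bounded` form a compact space, so the
finite-volume measures converge along an ultrafilter finer than `atTop`. Cylinders are clopen, hence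
have empty frontier, and their limiting probabilities are those already known to exist along the
whole net. -/
theorem exists_isVolumeLimit {T : Set Vertex} (hT : IsSubtree T) :
    ∃ μ : Measure Config, IsVolumeLimit T μ := by
  have := isDirected_finiteSubtree hT
  have := nonempty_finiteSubtree hT
  have hp : ∀ S : FiniteSubtree T, IsProbabilityMeasure
      ((uniformOn (recurrent (S.1 : Set Vertex))).map truncate) := fun S => by
    have := isProbabilityMeasure_recurrent S.2.2 S.1.finite_toSet
    exact Measure.isProbabilityMeasure_map measurable_truncate.aemeasurable
  let P : FiniteSubtree T → ProbabilityMeasure Bounded := fun S => ⟨_, hp S⟩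
  let 𝒰 : Ultrafilter (FiniteSubtree T) := Ultrafilter.of atTop
  have h𝒰 : (𝒰 : Filter (FiniteSubtree T)) ≤ atTop := Ultrafilter.of_le atTop
  obtain ⟨ν, -, hν⟩ := isCompact_univ.ultrafilter_le_nhds (𝒰.map P) (by simp)
  have hν' : Tendsto P 𝒰 (𝓝 ν) := hν
  refine ⟨(ν : Measure Bounded).map Bounded.toConfig,
    Measure.isProbabilityMeasure_map measurable_toConfig.aemeasurable, fun F ξ => ?_⟩
  rw [cylinder_eq, Measure.map_apply measurable_toConfig (measurableSet_heightsIn _ _)]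
  obtain ⟨L, hL⟩ := exists_tendsto_heightsIn hT F fun v => {ξ v}
  have h1 := ProbabilityMeasure.tendsto_measure_of_null_frontier_of_tendsto' hν'
    (E := Bounded.toConfig ⁻¹' heightsIn F fun v => {ξ v})
    (by rw [(isClopen_toConfig_heightsIn F _).frontier_eq]; simp)
  have h2 : ∀ S : FiniteSubtree T,
      (P S : Measure Bounded) (Bounded.toConfig ⁻¹' heightsIn F fun v => {ξ v}) =
      uniformOn (recurrent (S.1 : Set Vertex)) (heightsIn F fun v => {ξ v}) := by
    intro S
    change ((uniformOn (recurrent (S.1 : Set Vertex))).map truncate) _ = _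
    rw [Measure.map_apply measurable_truncate (measurable_toConfig (measurableSet_heightsIn _ _)),
      uniformOn_recurrent_apply S.2.2 S.1.finite_toSet,
      uniformOn_recurrent_apply S.2.2 S.1.finite_toSet]
    congr 4
    ext η
    refine and_congr_right fun hη => ?_
    simp only [Set.mem_preimage, toConfig_truncate hη]
  simp only [h2] at h1
  rwa [tendsto_nhds_unique h1 (hL.mono_left h𝒰)]

/-- Cylinder events are the atoms of the finite-dimensional marginals, which live on countable
spaces; a finite measure is determined by its marginals. -/
theorem isVolumeLimit_unique {T : Set Vertex} (hT : IsSubtree T) {μ ν : Measure Config}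
    (hμ : IsVolumeLimit T μ) (hν : IsVolumeLimit T ν) : μ = ν := by
  have := isDirected_finiteSubtree hT
  have := nonempty_finiteSubtree hT
  have := hμ.1
  have := hν.1
  have key : ∀ F : Finset Vertex, μ.map (F.restrict (π := fun _ : Vertex => ℤ)) =
      ν.map (F.restrict (π := fun _ : Vertex => ℤ)) := by
    intro F
    refine Measure.ext_of_singleton fun ξ => ?_
    classical
    have e : F.restrict (π := fun _ : Vertex => ℤ) ⁻¹' {ξ} = {η : Config | ∀ v ∈ F, η v =
        (fun v => if h : v ∈ F then ξ ⟨v, h⟩ else 0 : Config) v} := by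
      ext η
      simp only [Set.mem_preimage, Set.mem_singleton_iff, funext_iff, Subtype.forall,
        Finset.restrict, Set.mem_ofPred_eq]
      exact forall₂_congr fun v hv => by simp [hv]
    rw [Measure.map_apply (Finset.measurable_restrict F) (measurableSet_singleton _),
      Measure.map_apply (Finset.measurable_restrict F) (measurableSet_singleton _), e]
    exact tendsto_nhds_unique (hμ.2 F _) (hν.2 F _)
  exact IsProjectiveLimit.unique
    (P := fun F : Finset Vertex => ν.map (F.restrict (π := fun _ : Vertex => ℤ))) (fun F => key F) fun F => rfl

lemma isVolumeLimit_of_finite {T : Set Vertex} (hT : IsSubtree T) (hfin : T.Finite) :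
    IsVolumeLimit T (uniformOn (recurrent T)) := by
  refine ⟨isProbabilityMeasure_recurrent hT hfin, fun F ξ => ?_⟩
  have hc : ((hfin.toFinset : Finset Vertex) : Set Vertex) = T := hfin.coe_toFinset
  refine tendsto_const_nhds.congr' ?_
  filter_upwards [eventually_ge_atTop (⟨hfin.toFinset, hc.subset, hc.symm ▸ hT⟩ : FiniteSubtree T)]
    with S hS
  have : (S.1 : Set Vertex) = T := by
    exact S.2.1.antisymm (hc.superset.trans (by exact_mod_cast hS))
  rw [this]

theorem isVolumeLimit_sandpileMeasure {T : Set Vertex} (hT : IsSubtree T) :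
    IsVolumeLimit T (sandpileMeasure T) := by
  unfold sandpileMeasure
  split_ifs with h1 h2
  · exact isVolumeLimit_of_finite hT h1
  · exact h2.choose_spec
  · exact absurd (exists_isVolumeLimit hT) h2

/-- Finitely many allowed heights on a finite set make the event a finite disjoint union of
cylinders. -/
lemma tendsto_heightsIn {T : Set Vertex} {μ : Measure Config} (hμ : IsVolumeLimit T μ)
    (F : Finset Vertex) (B : Vertex → Finset ℤ) :
    Tendsto (fun S : FiniteSubtree T => uniformOn (recurrent (S.1 : Set Vertex)) (heightsIn F B))
      atTop (𝓝 (μ (heightsIn F B))) := by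
  classical
  let ext : ((v : Vertex) → v ∈ F → ℤ) → Config := fun f v => if h : v ∈ F then f v h else 0
  have e : heightsIn F B = ⋃ f ∈ F.pi B, heightsIn F fun v => {ext f v} := by
    ext η
    simp only [Set.mem_iUnion, Finset.mem_pi, exists_prop]
    constructor
    · intro h
      refine ⟨fun v _ => η v, h, fun v hv => ?_⟩
      simp [ext, hv]
    · rintro ⟨f, hf, h⟩ v hv
      have := h v hv
      simp only [ext, hv, dif_pos, Finset.mem_singleton] at this
      rw [this]
      exact hf v hv
  have hd : Set.PairwiseDisjoint (F.pi B : Set ((v : Vertex) → v ∈ F → ℤ))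
      fun f => heightsIn F fun v => {ext f v} := by
    intro f _ g _ hfg
    rw [Function.onFun, Set.disjoint_left]
    intro η h1 h2
    refine hfg (funext₂ fun v hv => ?_)
    have a := h1 v hv
    have b := h2 v hv
    simp only [ext, hv, dif_pos, Finset.mem_singleton] at a b
    exact a.symm.trans b
  have hm : ∀ ν : Measure Config, ν (heightsIn F B) =
      ∑ f ∈ F.pi B, ν (heightsIn F fun v => {ext f v}) := fun ν => by
    conv_lhs => rw [e]
    exact measure_biUnion_finset hd fun f _ => measurableSet_heightsIn _ _
  simp only [hm]
  refine tendsto_finsetSum _ fun f _ => ?_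
  rw [← cylinder_eq]
  exact hμ.2 F (ext f)

/-! ### Avalanches -/

/-- The neighbour of `v` that is not a child: its parent, or the root of the other copy. -/
def up : Vertex → Vertex
  | (s, []) => (!s, [])
  | (s, _ :: w) => (s, w)

lemma adj_iff_up {v w : Vertex} :
    bethe.Adj v w ↔ w = up v ∨ w = child v false ∨ w = child v true := by
  rw [adj_iff]
  obtain ⟨s, l⟩ := v
  obtain ⟨t, m⟩ := w
  cases l with
  | nil => simp [up, child, Bool.eq_not, eq_comm]; tauto
  | cons b l => cases b <;> simp [up, child, eq_comm] <;> tauto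

/-- The neighbours of `v`. -/
def nbrs (v : Vertex) : Finset Vertex := {up v, child v false, child v true}

lemma mem_nbrs {v w : Vertex} : w ∈ nbrs v ↔ bethe.Adj v w := by
  rw [adj_iff_up]; simp [nbrs]

lemma sum_nbrs (v : Vertex) (f : Vertex → ℤ) :
    ∑ w ∈ nbrs v, f w = f (up v) + f (child v false) + f (child v true) := by
  have h1 : child v false ≠ child v true := by simp [child]
  have h2 : ∀ b, up v ≠ child v b := by
    intro b
    obtain ⟨s, l⟩ := v
    cases l with
    | nil => simp [up, child]
    | cons b l =>
      simp only [up, child, ne_eq, Prod.mk.injEq, true_and]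
      intro h
      have := congrArg List.length h
      simp only [List.length_cons] at this
      omega
  rw [nbrs, Finset.sum_insert (by simp [h2]), Finset.sum_pair h1, add_assoc]

/-! ### The least action principle and a toppling function for clusters -/

/-- `n` topplings suffice to stabilize `ζ`; they take place in `C`. -/
structure Stabilizes (T : Set Vertex) (C : Finset Vertex) (ζ : Config) (n : Vertex → ℤ) : Prop where
  nonneg : ∀ v, 0 ≤ n v
  zero : ∀ v ∉ C, n v = 0
  le : ∀ v ∈ T, ζ v - ∑ w ∈ C, n w * topplingMatrix T w v ≤ 3

lemma topplingMatrix_nonpos (T : Set Vertex) {u v : Vertex} (h : u ≠ v) :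
    topplingMatrix T u v ≤ 0 := by
  unfold topplingMatrix
  split_ifs <;> simp_all

/-- Without a toppling at `u` its height can only grow, so it could not end at 3 or less. -/
lemma Stabilizes.one_le {T : Set Vertex} {C : Finset Vertex} {ζ : Config} {n : Vertex → ℤ}
    (h : Stabilizes T C ζ n) {u : Vertex} (hu : u ∈ T) (h3 : 3 < ζ u) : 1 ≤ n u := by
  by_contra hn
  have h0 : n u = 0 := by have := h.nonneg u; omega
  have := h.le u hu
  have hs : ∑ w ∈ C, n w * topplingMatrix T w u ≤ 0 := by
    refine Finset.sum_nonpos fun w _ => ?_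
    by_cases hw : w = u
    · rw [hw, h0, zero_mul]
    · exact mul_nonpos_of_nonneg_of_nonpos (h.nonneg w) (topplingMatrix_nonpos T hw)
  omega

/-- The least action principle. -/
lemma Stabilizes.mem_of_isLegal {T : Set Vertex} {C : Finset Vertex} {l : List Vertex} :
    ∀ {ζ : Config} {n : Vertex → ℤ}, Stabilizes T C ζ n → IsLegal T l ζ → ∀ v ∈ l, v ∈ C := by
  induction l with
  | nil => simp
  | cons u l ih =>
    rintro ζ n h ⟨hu, h3, hl⟩ v hv
    have h1 := h.one_le hu h3
    have huC : u ∈ C := by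
      by_contra hC
      have := h.zero u hC
      omega
    rcases List.mem_cons.1 hv with rfl | hv
    · exact huC
    -- The legal toppling at `u` is one that `n` also performs; removing it leaves a function
    -- stabilizing the toppled configuration.
    · refine ih (n := n - Pi.single u 1) ⟨fun w => ?_, fun w hw => ?_, fun w hw => ?_⟩ hl v hv
      · by_cases hwu : w = u
        · subst hwu; simp only [Pi.sub_apply, Pi.single_eq_same]; omega
        · simpa [hwu] using h.nonneg w
      · have hwu : w ≠ u := by rintro rfl; exact hw huC
        simpa [hwu] using h.zero w hw
      · refine le_of_eq_of_le ?_ (h.le w hw)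
        simp only [topple, Pi.sub_apply, sub_mul, Finset.sum_sub_distrib, Pi.single_apply, ite_mul,
          one_mul, zero_mul, Finset.sum_ite_eq', huC, if_true]
        ring

/-- The distance to the complement of a finite set of vertices. -/
lemma exists_dist_compl (C : Finset Vertex) : ∃ d : Vertex → ℕ, (∀ v, d v = 0 ↔ v ∉ C) ∧
    (∀ u v, bethe.Adj u v → d u ≤ d v + 1) ∧
    ∀ v, d v ≠ 0 → ∃ u, bethe.Adj v u ∧ d u + 1 = d v := by
  classical
  let R : ℕ → Vertex → Prop := fun k => Nat.rec (motive := fun _ => Vertex → Prop) (fun v => v ∉ C)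
    (fun _ r v => ∃ u, bethe.Adj v u ∧ r u) k
  have hR : ∀ v, ∃ k, R k v := by
    obtain ⟨d, hd⟩ := exists_length_lt C.finite_toSet
    -- Since `C` is finite, descending along first children leaves it, so the distance is finite.
    have : ∀ j, ∀ v : Vertex, d ≤ v.2.length + j → ∃ k, R k v := by
      intro j
      induction j with
      | zero =>
        intro v hv
        exact ⟨0, fun hC => by have := hd v hC; omega⟩
      | succ j ih =>
        intro v hv
        obtain ⟨k, hk⟩ := ih (child v false) (by simp only [child, List.length_cons]; omega)
        exact ⟨k + 1, _, adj_child v false, hk⟩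
    exact fun v => this d v (by omega)
  refine ⟨fun v => Nat.find (hR v), fun v => Nat.find_eq_zero (hR v),
    fun u v h => ?_,
    fun v hv => ?_⟩
  · exact Nat.find_min' (hR u) (show R (Nat.find (hR v) + 1) u from ⟨v, h, Nat.find_spec (hR v)⟩)
  · obtain ⟨k, hk⟩ := Nat.exists_eq_succ_of_ne_zero hv
    have h1 := Nat.find_spec (hR v)
    simp only at hk
    rw [hk] at h1
    obtain ⟨u, hu, hRu⟩ := h1
    refine ⟨u, hu, ?_⟩
    have h2 := Nat.find_min' (hR u) hRu
    have h4 : R (Nat.find (hR u) + 1) v := ⟨u, hu, Nat.find_spec (hR u)⟩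
    have h3 : Nat.find (hR v) ≤ Nat.find (hR u) + 1 := Nat.find_min' (hR v) h4
    simp only at hk ⊢
    omega

/-- The minimum of `d` along the path from the origin to `v`. -/
def pathMin (d : Vertex → ℕ) : Bool → List Bool → ℕ
  | s, b :: w => min (pathMin d s w) (d (s, b :: w))
  | false, [] => d origin
  | true, [] => min (d origin) (d (true, []))

lemma pathMin_of_ne {d : Vertex → ℕ} {v : Vertex} (hv : v ≠ origin) :
    pathMin d v.1 v.2 = min (pathMin d (up v).1 (up v).2) (d v) := by
  obtain ⟨s, l⟩ := v
  cases l with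
  | nil => cases s <;> simp_all [origin, up, pathMin]
  | cons b l => cases s <;> simp [up, pathMin]

lemma pathMin_child (d : Vertex → ℕ) (v : Vertex) (b : Bool) :
    pathMin d (child v b).1 (child v b).2 = min (pathMin d v.1 v.2) (d (child v b)) := by
  rw [pathMin_of_ne (by simp [child, origin])]
  rfl

lemma pathMin_le (d : Vertex → ℕ) (v : Vertex) : pathMin d v.1 v.2 ≤ d v := by
  by_cases h : v = origin
  · subst h; exact le_rfl
  · rw [pathMin_of_ne h]; exact min_le_right _ _

/-- Away from the origin, `pathMin` does not increase in passing to children, and it can exceed its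
value at `v` only at `up v`, by at most one. It does so only when `d v` is smaller than `d (up v)`;
then the neighbour nearer to the complement is a child, which loses one and compensates. At the
origin no neighbour has a larger value and the nearer one has a smaller value, which gains the unit
that absorbs the added grain. -/
lemma pathMin_sum_le {d : Vertex → ℕ} (h1 : ∀ u v, bethe.Adj u v → d u ≤ d v + 1)
    (h2 : ∀ v, d v ≠ 0 → ∃ u, bethe.Adj v u ∧ d u + 1 = d v) {v : Vertex} (hv : d v ≠ 0) :
    pathMin d (up v).1 (up v).2 + pathMin d (child v false).1 (child v false).2
      + pathMin d (child v true).1 (child v true).2 + (if v = origin then 1 else 0)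
      ≤ 3 * pathMin d v.1 v.2 := by
  obtain ⟨u, hu, hdu⟩ := h2 v hv
  rw [adj_iff_up] at hu
  have hup := h1 (up v) v (adj_iff_up.2 (Or.inl rfl)).symm
  rw [pathMin_child, pathMin_child]
  by_cases hvo : v = origin
  · subst hvo
    have e : pathMin d (up origin).1 (up origin).2 = min (d origin) (d (up origin)) := rfl
    have e' : pathMin d origin.1 origin.2 = d origin := rfl
    rw [if_pos rfl, e, e']
    rcases hu with rfl | rfl | rfl <;> omega
  · have e := pathMin_of_ne (d := d) hvo
    have e' := pathMin_le d (up v)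
    rw [if_neg hvo]
    rcases hu with rfl | rfl | rfl <;> omega

/-- `C` is a connected finite set containing the origin. -/
def IsCluster (C : Finset Vertex) : Prop :=
  origin ∈ C ∧ (bethe.induce (C : Set Vertex)).Connected

lemma IsCluster.rooted {C : Finset Vertex} (h : IsCluster C) :
    Rooted (C : Set Vertex) origin (true, []) :=
  rooted_of_root_mem (s := false) h.2 h.1

lemma mem_descendants_root (v : Vertex) : v ∈ descendants (v.1, []) := ⟨rfl, List.nil_suffix⟩

lemma IsCluster.mem_of_child_mem {C : Finset Vertex} (h : IsCluster C) {v : Vertex} {b : Bool}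
    (hv : child v b ∈ C) : v ∈ C := by
  obtain ⟨s, l⟩ := v
  cases s
  · exact h.rooted.left _ (mem_descendants_root _) b hv
  · exact h.rooted.right _ (mem_descendants_root _) b hv

/-- If all heights are `3` on the cluster `C` and at most `2` on its boundary in `T`, then the
avalanche stays inside `C`. -/
lemma IsCluster.avalanche_subset {T : Set Vertex} {C : Finset Vertex} (h : IsCluster C)
    (hCT : (C : Set Vertex) ⊆ T) {η : Config} (h3 : ∀ v ∈ T, η v ≤ 3)
    (h2 : ∀ u ∈ C, ∀ v ∈ T, v ∉ C → bethe.Adj u v → η v ≤ 2) :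
    avalanche T origin η ⊆ C := by
  classical
  obtain ⟨d, hd0, hd1, hd2⟩ := exists_dist_compl C
  -- The toppling function: superharmonic on `C`, with a unit of slack at the origin, and zero off
  -- `C`.
  set n : Vertex → ℤ := fun v => pathMin d v.1 v.2 with hn
  have hzero : ∀ v ∉ C, n v = 0 := fun v hv => by
    have := pathMin_le d v
    have := (hd0 v).2 hv
    simp only [hn]
    omega
  have hsum : ∀ v ∈ T, ∑ w ∈ C, n w * topplingMatrix T w v =
      3 * n v - (n (up v) + n (child v false) + n (child v true)) := by
    intro v hv
    have e : ∀ w ∈ C, n w * topplingMatrix T w v =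
        (if w = v then 3 * n w else 0) - (if w ∈ nbrs v then n w else 0) := by
      intro w hw
      have hwT := hCT hw
      have hnb : w ∈ nbrs v ↔ bethe.Adj w v := by rw [mem_nbrs]; exact bethe.adj_comm v w
      by_cases hwv : w = v
      · subst hwv
        simp [topplingMatrix, hv, mem_nbrs, mul_comm]
      · by_cases ha : bethe.Adj w v
        · simp [topplingMatrix, hv, hwT, hwv, ha, hnb]
        · simp [topplingMatrix, hv, hwT, hwv, ha, hnb]
    rw [Finset.sum_congr rfl e, Finset.sum_sub_distrib, Finset.sum_ite_eq', ← sum_nbrs]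
    congr 1
    · split_ifs with hvC
      · rfl
      · rw [hzero v hvC, mul_zero]
    · rw [← Finset.sum_filter, Finset.filter_mem_eq_inter]
      refine Finset.sum_subset Finset.inter_subset_right fun w hw hwC => hzero w fun hC => ?_
      exact hwC (Finset.mem_inter.2 ⟨hC, hw⟩)
  have hst : Stabilizes T C (η + Pi.single origin 1) n := by
    refine ⟨fun v => Nat.cast_nonneg _, hzero, fun v hv => ?_⟩
    rw [hsum v hv]
    by_cases hvC : v ∈ C
    · have h4 := pathMin_sum_le hd1 hd2 (fun h0 => (hd0 v).1 h0 hvC)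
      have h5 := h3 v hv
      simp only [Pi.add_apply, Pi.single_apply, hn]
      split_ifs at h4 ⊢ <;> omega
    · have hvo : v ≠ origin := by rintro rfl; exact hvC h.1
      -- A vertex off `C` can receive grains only from `up v`, because `C` is closed under parents.
      -- If `up v` is in `C` it topples at most once, and for `v` in `T` the height 2 leaves room
      -- for one grain.
      have hc : ∀ b, n (child v b) = 0 := fun b => hzero _ fun hb => hvC (h.mem_of_child_mem hb)
      simp only [Pi.add_apply, Pi.single_eq_of_ne hvo, hc, hzero v hvC]
      by_cases hu : up v ∈ C
      · have ha : bethe.Adj (up v) v := (adj_iff_up.2 (Or.inl rfl)).symm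
        have h4 := h2 _ hu v hv hvC ha
        have h5 := hd1 _ _ ha
        have h6 := pathMin_le d (up v)
        have h7 := (hd0 v).2 hvC
        simp only [hn]
        omega
      · rw [hzero _ hu]
        have := h3 v hv
        omega
  rintro v ⟨l, hl, hv⟩
  exact hst.mem_of_isLegal hl v hv

/-- Each toppling hands a grain to the next vertex of the path, raising it from at least 3 to above
3. Because the path is simple, no vertex has lost grains before its turn. -/
lemma isLegal_support {T : Set Vertex} {u w : Vertex} (p : bethe.Walk u w) :
    ∀ {ζ : Config}, p.IsPath → 3 < ζ u → (∀ v ∈ p.support, v ∈ T) →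
      (∀ v ∈ p.support, v ≠ u → 3 ≤ ζ v) → IsLegal T p.support ζ := by
  induction p with
  | nil =>
    intro ζ _ h3 hT _
    exact ⟨hT _ (by simp), h3, trivial⟩
  | @cons u v w ha p ih =>
    intro ζ hp h3 hT h
    rw [SimpleGraph.Walk.cons_isPath_iff] at hp
    have huT : u ∈ T := hT u (by simp)
    refine ⟨huT, h3, ih hp.1 ?_ (fun x hx => hT x (by simp [hx])) fun x hx hxv => ?_⟩
    · have h4 := h v (by simp) ha.ne'
      have hvT : v ∈ T := hT v (by simp)
      simp only [topple, topplingMatrix, huT, hvT, and_self, if_true, if_neg ha.ne, if_pos ha]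
      omega
    · have hxu : x ≠ u := by rintro rfl; exact hp.2 hx
      have h4 := h x (by simp [hx]) hxu
      have h5 := topplingMatrix_nonpos T hxu.symm
      simp only [topple]
      omega

lemma mem_avalanche_of_walk {T : Set Vertex} {η : Config} {v : Vertex} (p : bethe.Walk origin v)
    (hp : ∀ u ∈ p.support, u ∈ T ∧ η u = 3) : v ∈ avalanche T origin η := by
  classical
  have hsub : ∀ u ∈ p.bypass.support, u ∈ T ∧ η u = 3 :=
    fun u hu => hp u (p.support_bypass_subset_support hu)
  refine ⟨p.bypass.support, isLegal_support p.bypass p.bypass_isPath ?_ (fun u hu => (hsub u hu).1)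
    ?_, p.bypass.end_mem_support⟩
  · have := (hsub origin p.bypass.start_mem_support).2
    simp [this]
  · intro u hu huo
    simp [huo, (hsub u hu).2]

lemma IsCluster.subset_avalanche {T : Set Vertex} {C : Finset Vertex} (h : IsCluster C)
    (hCT : (C : Set Vertex) ⊆ T) {η : Config} (h3 : ∀ v ∈ C, η v = 3) :
    (C : Set Vertex) ⊆ avalanche T origin η := by
  intro v hv
  obtain ⟨p⟩ := h.2.preconnected ⟨origin, h.1⟩ ⟨v, hv⟩
  let q := p.map (SimpleGraph.Embedding.induce (C : Set Vertex)).toHom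
  have hq : ∀ u ∈ q.support, u ∈ T ∧ η u = 3 := by
    intro u hu
    simp only [q, SimpleGraph.Walk.support_map, List.mem_map] at hu
    obtain ⟨a, -, rfl⟩ := hu
    exact ⟨hCT a.2, h3 a a.2⟩
  exact mem_avalanche_of_walk q hq

/-! ### Avalanches as height-3 clusters -/

open Classical in
/-- The cluster `C` with its boundary in `T`. -/
def collar (T : Set Vertex) (C : Finset Vertex) : Finset Vertex :=
  C ∪ (C.biUnion nbrs).filter (· ∈ T)

open Classical in
/-- The heights that make `C` the set of toppling vertices. -/
def clusterHeights (C : Finset Vertex) : Vertex → Finset ℤ := fun v => if v ∈ C then {3} else {1, 2}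

lemma mem_heightsIn_collar {T : Set Vertex} {C : Finset Vertex} {η : Config} :
    η ∈ heightsIn (collar T C) (clusterHeights C) ↔ (∀ v ∈ C, η v = 3) ∧
      ∀ u ∈ C, ∀ v ∈ T, v ∉ C → bethe.Adj u v → η v = 1 ∨ η v = 2 := by
  simp only [heightsIn, Set.mem_ofPred_eq, collar, Finset.mem_union, Finset.mem_filter,
    Finset.mem_biUnion, mem_nbrs, clusterHeights]
  constructor
  · intro h
    refine ⟨fun v hv => by simpa [hv] using h v (Or.inl hv), fun u hu v hv hvC ha => ?_⟩
    simpa [hvC] using h v (Or.inr ⟨⟨u, hu, ha⟩, hv⟩)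
  · rintro ⟨h1, h2⟩ v hv
    by_cases hvC : v ∈ C
    · simp [hvC, h1 v hvC]
    · obtain ⟨⟨u, hu, ha⟩, hvT⟩ := hv.resolve_left hvC
      simpa [hvC] using h2 u hu v hvT hvC ha

lemma avalanche_eq {T : Set Vertex} {C : Finset Vertex} (h : IsCluster C)
    (hCT : (C : Set Vertex) ⊆ T) {η : Config} (h3 : ∀ v ∈ T, η v ≤ 3)
    (hη : η ∈ heightsIn (collar T C) (clusterHeights C)) : avalanche T origin η = C := by
  rw [mem_heightsIn_collar] at hη
  refine (h.avalanche_subset hCT h3 fun u hu v hv hvC ha => ?_).antisymm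
    (h.subset_avalanche hCT hη.1)
  rcases hη.2 u hu v hv hvC ha with h | h <;> omega

/-- The witness is the component of the origin in the height-3 set; it lies in the avalanche and is
therefore finite. It is nonempty because the first toppling of any legal sequence must occur at the
origin, the only place where a height can exceed 3 initially. -/
lemma exists_cluster {T : Set Vertex} {η : Config} (h3 : ∀ v ∈ T, 1 ≤ η v ∧ η v ≤ 3)
    (hne : (avalanche T origin η).Nonempty) (hfin : (avalanche T origin η).Finite) :
    ∃ C : Finset Vertex, IsCluster C ∧ (C : Set Vertex) ⊆ T ∧
      η ∈ heightsIn (collar T C) (clusterHeights C) := by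
  let K : Set Vertex := {v | ∃ p : bethe.Walk origin v, ∀ u ∈ p.support, u ∈ T ∧ η u = 3}
  have hK : K ⊆ avalanche T origin η := fun v ⟨p, hp⟩ => mem_avalanche_of_walk p hp
  have hKf : K.Finite := hfin.subset hK
  have ho : origin ∈ K := by
    obtain ⟨v, l, hl, hv⟩ := hne
    cases l with
    | nil => simp at hv
    | cons u l =>
      obtain ⟨hu, h4, -⟩ := hl
      have h5 := (h3 u hu).2
      have huo : u = origin := by
        by_contra huo
        simp [huo] at h4
        omega
      subst huo
      simp at h4
      refine ⟨SimpleGraph.Walk.nil, fun w hw => ?_⟩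
      simp only [SimpleGraph.Walk.support_nil, List.mem_singleton] at hw
      subst hw
      exact ⟨hu, by omega⟩
  have hKT : ∀ v ∈ K, v ∈ T ∧ η v = 3 := fun v ⟨p, hp⟩ => hp v p.end_mem_support
  have hsupp : ∀ v (p : bethe.Walk origin v), (∀ u ∈ p.support, u ∈ T ∧ η u = 3) →
      ∀ u ∈ p.support, u ∈ K := by
    classical
    intro v p hp u hu
    exact ⟨p.takeUntil u hu, fun w hw => hp w (p.support_takeUntil_subset_support hu hw)⟩
  have hconn : (bethe.induce K).Connected := by
    refine SimpleGraph.induce_connected_of_patches origin ho fun {v} hv => ?_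
    obtain ⟨p, hp⟩ := hv
    refine ⟨{z | z ∈ p.support}, fun z hz => hsupp v p hp z hz, p.start_mem_support,
      p.end_mem_support, p.connected_induce_support.preconnected _ _⟩
  refine ⟨hKf.toFinset, ⟨by simpa using ho, by rwa [hKf.coe_toFinset]⟩, ?_, ?_⟩
  · rw [hKf.coe_toFinset]
    exact fun v hv => (hKT v hv).1
  · rw [mem_heightsIn_collar]
    simp only [Set.Finite.mem_toFinset]
    refine ⟨fun v hv => (hKT v hv).2, fun u hu v hv hvK ha => ?_⟩
    have h5 : η v ≠ 3 := fun h5 => by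
      obtain ⟨p, hp⟩ := hu
      refine hvK ⟨p.concat ha, fun w hw => ?_⟩
      rw [SimpleGraph.Walk.support_concat, List.mem_append, List.mem_singleton] at hw
      rcases hw with hw | rfl
      · exact hp w hw
      · exact ⟨hv, h5⟩
    have := h3 v hv
    omega

/-- Avalanches of size `n ≥ 1` are described by the clusters of size `n`. -/
lemma encard_avalanche_eq_iff {T : Set Vertex} {η : Config} (h3 : ∀ v ∈ T, 1 ≤ η v ∧ η v ≤ 3)
    {n : ℕ} (hn : 1 ≤ n) : (avalanche T origin η).encard = n ↔
      ∃ C : Finset Vertex, (IsCluster C ∧ (C : Set Vertex) ⊆ T ∧ C.card = n) ∧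
        η ∈ heightsIn (collar T C) (clusterHeights C) := by
  constructor
  · intro h
    have hfin : (avalanche T origin η).Finite := Set.finite_of_encard_eq_coe h
    have hne : (avalanche T origin η).Nonempty := by
      rw [← Set.encard_pos, h]
      exact_mod_cast hn
    obtain ⟨C, h1, h2, h4⟩ := exists_cluster h3 hne hfin
    refine ⟨C, ⟨h1, h2, ?_⟩, h4⟩
    rw [avalanche_eq h1 h2 (fun v hv => (h3 v hv).2) h4, Set.encard_coe_eq_coe_finsetCard] at h
    exact_mod_cast h
  · rintro ⟨C, ⟨h1, h2, rfl⟩, h4⟩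
    rw [avalanche_eq h1 h2 (fun v hv => (h3 v hv).2) h4, Set.encard_coe_eq_coe_finsetCard]

/-! ### Clusters and avalanche probabilities -/

/-- All ancestors of `v` within its copy belong to the cluster, one at each depth from 0 to that of
`v`. -/
lemma IsCluster.length_lt {C : Finset Vertex} (h : IsCluster C) {v : Vertex} (hv : v ∈ C) :
    v.2.length < C.card := by
  have hdrop : ∀ i, (v.1, v.2.drop i) ∈ C := by
    intro i
    induction i with
    | zero => simpa using hv
    | succ i ih =>
      rcases hl : v.2.drop i with _ | ⟨b, l⟩
      · rw [hl] at ih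
        rw [← List.drop_drop, hl, List.drop_nil]
        exact ih
      · rw [hl] at ih
        rw [← List.drop_drop, hl]
        exact h.mem_of_child_mem (v := (v.1, l)) (b := b) ih
  have hle := Finset.card_le_card_of_injOn (s := Finset.range (v.2.length + 1)) (t := C)
    (fun i => (v.1, v.2.drop i)) (fun i _ => hdrop i) ?_
  · simpa using hle
  · intro i hi j hj hij
    have := congrArg (fun u : Vertex => u.2.length) hij
    simp only [List.length_drop] at this
    simp only [Finset.coe_range, Set.mem_Iio] at hi hj
    omega

/-- The vertices at depth at most `m`. -/
def ball (m : ℕ) : Set Vertex := {v | v.2.length ≤ m}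

lemma finite_ball (m : ℕ) : (ball m).Finite := by
  refine ((Set.finite_univ (α := Bool)).prod (List.finite_length_le Bool m)).subset ?_
  intro v hv
  exact ⟨trivial, hv⟩

lemma finite_clusters (n : ℕ) : {C : Finset Vertex | IsCluster C ∧ C.card = n}.Finite := by
  refine (finite_ball n).toFinset.powerset.finite_toSet.subset ?_
  rintro C ⟨h, rfl⟩
  rw [Finset.mem_coe, Finset.mem_powerset]
  exact fun v hv => (finite_ball _).mem_toFinset.2 (h.length_lt hv).le

/-- The clusters of size `n`. -/
def clusters (n : ℕ) : Finset (Finset Vertex) := (finite_clusters n).toFinset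

lemma mem_clusters {n : ℕ} {C : Finset Vertex} : C ∈ clusters n ↔ IsCluster C ∧ C.card = n := by
  simp [clusters]

open Classical in
/-- The clusters of size `n` in `T`. -/
def clustersIn (T : Set Vertex) (n : ℕ) : Finset (Finset Vertex) :=
  (clusters n).filter fun C : Finset Vertex => (C : Set Vertex) ⊆ T

lemma mem_clustersIn {T : Set Vertex} {n : ℕ} {C : Finset Vertex} :
    C ∈ clustersIn T n ↔ (IsCluster C ∧ C.card = n) ∧ (C : Set Vertex) ⊆ T := by
  simp [clustersIn, mem_clusters]

lemma clusterCount_eq (T : Set Vertex) (n : ℕ) : clusterCount T n = (clustersIn T n).card := by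
  rw [clusterCount, ← Set.ncard_coe_finset]
  congr 1
  ext C
  simp only [Set.mem_ofPred_eq, Finset.mem_coe, mem_clustersIn, IsCluster]
  tauto

lemma ae_stable {T : Set Vertex} (hT : IsSubtree T) :
    ∀ᵐ η ∂sandpileMeasure T, ∀ v ∈ T, 1 ≤ η v ∧ η v ≤ 3 := by
  have hμ := isVolumeLimit_sandpileMeasure hT
  have := hμ.1
  have := isDirected_finiteSubtree hT
  have := nonempty_finiteSubtree hT
  have h1 : ∀ v ∈ T, ∀ᵐ η ∂sandpileMeasure T, η ∈ heightsIn {v} full := by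
    intro v hv
    refine (prob_compl_eq_zero_iff (measurableSet_heightsIn _ _)).2 ?_
    refine tendsto_nhds_unique (tendsto_heightsIn hμ {v} full) (tendsto_const_nhds.congr' ?_)
    filter_upwards [eventually_mem hv] with S hS
    have := isProbabilityMeasure_recurrent S.2.2 S.1.finite_toSet
    refine (prob_compl_eq_zero_iff (measurableSet_heightsIn _ _)).1 ?_ |>.symm
    rw [uniformOn_recurrent_apply S.2.2 S.1.finite_toSet]
    have : recurrent (S.1 : Set Vertex) ∩ (heightsIn {v} full)ᶜ = ∅ := by
      rw [Set.eq_empty_iff_forall_notMem]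
      rintro η ⟨h1, h2⟩
      refine h2 fun u hu => ?_
      obtain rfl := Finset.mem_singleton.1 hu
      simpa [full] using h1.1 u hS
    simp [this]
  rw [ae_all_iff]
  intro v
  by_cases hv : v ∈ T
  · filter_upwards [h1 v hv] with η hη _
    simpa [heightsIn, full] using hη
  · exact Eventually.of_forall fun _ h => absurd h hv

/-- Almost every configuration is stable, and on stable configurations the event attached to `C`
forces the avalanche to equal `C`; hence the events are disjoint up to null sets. -/
lemma avalancheProb_eq {T : Set Vertex} (hT : IsSubtree T) {n : ℕ} (hn : 1 ≤ n) :
    avalancheProb T n = ∑ C ∈ clustersIn T n,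
      (sandpileMeasure T).real (heightsIn (collar T C) (clusterHeights C)) := by
  have := (isVolumeLimit_sandpileMeasure hT).1
  have hst := ae_stable hT
  have e : {η : Config | (avalanche T origin η).encard = n} =ᵐ[sandpileMeasure T]
      ⋃ C ∈ clustersIn T n,
        heightsIn (collar T C) (clusterHeights C) := by
    rw [Filter.eventuallyEq_set]
    filter_upwards [hst] with η hη
    rw [encard_avalanche_eq_iff hη hn]
    simp only [Set.mem_iUnion, mem_clustersIn, exists_prop]
    exact exists_congr fun C => by tauto
  have hd : (clustersIn T n : Set (Finset Vertex)).Pairwise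
      (Function.onFun (AEDisjoint (sandpileMeasure T))
        fun C : Finset Vertex => heightsIn (collar T C) (clusterHeights C)) := by
    intro C hC C' hC' hne
    simp only [Finset.mem_coe, mem_clustersIn] at hC hC'
    refine measure_mono_null ?_ hst
    rintro η ⟨h1, h2⟩ h3
    have h4 := avalanche_eq hC.1.1 hC.2 (fun v hv => (h3 v hv).2) h1
    have h5 := avalanche_eq hC'.1.1 hC'.2 (fun v hv => (h3 v hv).2) h2
    exact hne (Finset.coe_injective (h4.symm.trans h5))
  rw [avalancheProb, measureReal_congr e, Measure.real, measure_biUnion_finset₀ hd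
    fun C _ => (measurableSet_heightsIn _ _).nullMeasurableSet, ENNReal.toReal_sum (by simp)]
  rfl

lemma avalancheProb_nonneg (T : Set Vertex) (n : ℕ) : 0 ≤ avalancheProb T n := measureReal_nonneg

lemma avalancheProb_le_one {T : Set Vertex} (hT : IsSubtree T) (n : ℕ) : avalancheProb T n ≤ 1 := by
  have := (isVolumeLimit_sandpileMeasure hT).1
  exact measureReal_le_one

/-! ### The probability of a single cluster -/

/-- Raising the height at `v` by one is injective, keeps heights 1 and 2 stable, and exactly
compensates the grain subtracted in the definition of the strong count. -/
lemma weakCnt_le_strongCnt {S : Set Vertex} (hS : S.Finite) {A : Vertex → Finset ℤ}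
    (hA : ∀ u, A u ⊆ full u) {v : Vertex} (hv : v ∈ S) (hAv : A v ⊆ {1, 2}) :
    weakCnt S A v ≤ strongCnt S full v := by
  unfold weakCnt strongCnt cnt
  rw [Nat.cast_le]
  refine Set.ncard_le_ncard_of_injOn (fun η => η + Pi.single v 1) ?_
    (fun η _ ζ _ h => add_right_cancel h) (finite_cfg (finite_branch hS v) _ _)
  rintro η ⟨h1, h2, h3⟩
  refine ⟨fun u hu => ?_, fun u hu => ?_, ?_⟩
  · by_cases huv : u = v
    · subst huv
      have := hAv (h1 u hu)
      simp only [Finset.mem_insert, Finset.mem_singleton] at this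
      simp only [Pi.add_apply, Pi.single_eq_same, full, Finset.mem_Icc]
      omega
    · simpa [huv] using hA u (h1 u hu)
  · have huv : u ≠ v := by rintro rfl; exact hu ⟨hv, self_mem_descendants _⟩
    simp [huv, h2 u hu]
  · simpa using h3

lemma IsCluster.hereditary {C : Finset Vertex} (h : IsCluster C) (v : Vertex) :
    Hereditary (C : Set Vertex) v := fun _ _ _ hb => h.mem_of_child_mem hb

lemma ncard_branch {C : Set Vertex} (hC : C.Finite) {v : Vertex} (hv : v ∈ C) :
    (branch C v).ncard =
      1 + (branch C (child v false)).ncard + (branch C (child v true)).ncard := by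
  rw [branch_eq hv, Set.ncard_union_eq (bridge_right C v).disj
      ((Set.finite_singleton v).union (finite_branch hC _)) (finite_branch hC _),
    Set.ncard_union_eq (bridge_left C v).disj (Set.finite_singleton v) (finite_branch hC _),
    Set.ncard_singleton]

open Classical in
/-- The bound for the weight of a branch in the cluster estimate. -/
def branchBound (S : Set Vertex) (C : Finset Vertex) (v : Vertex) : ℝ :=
  if v ∈ C then 0.549 * weakCnt S full v + 0.46 * strongCnt S full v else strongCnt S full v

/-- After division by the weak counts this is a bilinear inequality in the children's ratios, which
range over [1/2, 2/3] for a child in `C` and [1/2, 1] otherwise; it suffices to check corners. The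
tightest are ratios (1, 1) with both children outside `C`, where 2.567 = 0.549 + 2 · 1.009 gives
equality, and (1/2, 1/2) with both in `C`, where 2.567 · 0.779² < 1.558. -/
lemma branchBound_mul_le {S : Set Vertex} (hS : S.Finite) {C : Finset Vertex}
    (hCS : (C : Set Vertex) ⊆ S) {v : Vertex} (hv : Hereditary S v) (hvC : v ∈ C) :
    2.567 * (branchBound S C (child v false) * branchBound S C (child v true)) ≤
      branchBound S C v := by
  obtain ⟨a1, a2, a3, a4⟩ := strongCnt_bounds hS (hv.child false)
  obtain ⟨b1, b2, b3, b4⟩ := strongCnt_bounds hS (hv.child true)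
  rw [branchBound, branchBound, branchBound, if_pos hvC, weakCnt_full hS (hCS hvC),
    strongCnt_full hS (hCS hvC)]
  set N := weakCnt S full (child v false)
  set σ := strongCnt S full (child v false)
  set M := weakCnt S full (child v true)
  set τ := strongCnt S full (child v true)
  -- Products of distances to the ends of the ratio intervals: a bilinear form nonnegative at the
  -- corners of a rectangle is a nonnegative combination of four of them.
  have p1 : 0 ≤ (2 * σ - N) * (2 * τ - M) := mul_nonneg (by linarith) (by linarith)
  have p2 : 0 ≤ (N - σ) * (2 * τ - M) := mul_nonneg (by linarith) (by linarith)
  have p3 : 0 ≤ (2 * σ - N) * (M - τ) := mul_nonneg (by linarith) (by linarith)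
  have p4 : 0 ≤ (N - σ) * (M - τ) := mul_nonneg (by linarith) (by linarith)
  split_ifs with h1 h2 h2
  · have c1 := a4 (hCS h1)
    have c2 := b4 (hCS h2)
    have q2 : 0 ≤ (2 * N - 3 * σ) * (2 * τ - M) := mul_nonneg (by linarith) (by linarith)
    have q3 : 0 ≤ (2 * σ - N) * (2 * M - 3 * τ) := mul_nonneg (by linarith) (by linarith)
    have q4 : 0 ≤ (2 * N - 3 * σ) * (2 * M - 3 * τ) := mul_nonneg (by linarith) (by linarith)
    nlinarith
  · have c1 := a4 (hCS h1)
    have q2 : 0 ≤ (2 * N - 3 * σ) * (2 * τ - M) := mul_nonneg (by linarith) (by linarith)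
    have q4 : 0 ≤ (2 * N - 3 * σ) * (M - τ) := mul_nonneg (by linarith) (by linarith)
    nlinarith
  · have c2 := b4 (hCS h2)
    have q3 : 0 ≤ (2 * σ - N) * (2 * M - 3 * τ) := mul_nonneg (by linarith) (by linarith)
    have q4 : 0 ≤ (N - σ) * (2 * M - 3 * τ) := mul_nonneg (by linarith) (by linarith)
    nlinarith
  · nlinarith

lemma branchBound_nonneg {S : Set Vertex} (hS : S.Finite) (C : Finset Vertex) {v : Vertex}
    (hv : Hereditary S v) : 0 ≤ branchBound S C v := by
  obtain ⟨a1, a2, a3, a4⟩ := strongCnt_bounds hS hv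
  unfold branchBound
  split_ifs <;> linarith

lemma branchBound_le {S : Set Vertex} (hS : S.Finite) (C : Finset Vertex) {v : Vertex}
    (hv : Hereditary S v) : branchBound S C v ≤ 1.009 * weakCnt S full v := by
  obtain ⟨a1, a2, a3, a4⟩ := strongCnt_bounds hS hv
  unfold branchBound
  split_ifs <;> linarith

lemma mem_collar {S : Set Vertex} {C : Finset Vertex} {v : Vertex} :
    v ∈ collar S C ↔ v ∈ C ∨ (∃ u ∈ C, bethe.Adj u v) ∧ v ∈ S := by
  simp [collar, mem_nbrs]

lemma subset_collar (S : Set Vertex) (C : Finset Vertex) : C ⊆ collar S C := by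
  intro v hv; simp [collar, hv]

lemma mem_collar_of_adj {S : Set Vertex} {C : Finset Vertex} {u v : Vertex} (hu : u ∈ C)
    (hv : v ∈ S) (h : bethe.Adj u v) : v ∈ collar S C :=
  mem_collar.2 (Or.inr ⟨⟨u, hu, h⟩, hv⟩)

/-- Induction from the leaves: a vertex of `C` contributes one factor 2.567 through
`branchBound_mul_le`, and the recursion stops at the boundary, where the heights 1 and 2 give the
strong count. -/
lemma pow_mul_weakCnt_le {S : Set Vertex} (hS : S.Finite) {C : Finset Vertex} (hC : IsCluster C)
    (hCS : (C : Set Vertex) ⊆ S) {v : Vertex} (hv : Hereditary S v)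
    (hvC : v ∈ S → v ∈ collar S C) :
    2.567 ^ (branch (C : Set Vertex) v).ncard *
      weakCnt S (stableIn (collar S C) (clusterHeights C)) v ≤ branchBound S C v := by
  set A := stableIn (collar S C) (clusterHeights C) with hA
  have hAfull : ∀ u, A u ⊆ full u := by
    intro u
    simp only [hA, stableIn]
    split_ifs
    · exact Finset.inter_subset_left
    · exact subset_rfl
  refine branch_induction hS (P := fun v => (v ∈ S → v ∈ collar S C) →
    2.567 ^ (branch (C : Set Vertex) v).ncard * weakCnt S A v ≤ branchBound S C v) ?_ ?_ hv hvC
  · intro v hv hvS _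
    have hvC : v ∉ C := fun h => hvS (hCS h)
    rw [(hC.hereditary v).branch_eq_empty (by simpa using hvC), Set.ncard_empty, branchBound,
      if_neg hvC, weakCnt_of_notMem hv hvS, strongCnt_of_notMem hv hvS]
    norm_num
  · intro v hv hvS ih hcol
    by_cases hvC : v ∈ C
    · have hc : ∀ b, child v b ∈ S → child v b ∈ collar S C := fun b hb =>
        mem_collar_of_adj hvC hb (adj_child v b)
      have i0 := ih false (hc false)
      have i1 := ih true (hc true)
      have hAv : cnt {v} A 0 = 1 := by
        have hAv : A v = {3} := by
          simp only [hA, stableIn, subset_collar S C hvC, if_true, clusterHeights, hvC, full]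
          rfl
        rw [cnt_singleton, above, hAv]
        norm_cast
      -- The height at `v` is fixed to 3, so only forbidden sets inside the two child branches are
      -- kept as constraints.
      have hle : weakCnt S A v ≤ weakCnt S A (child v false) * weakCnt S A (child v true) := by
        rw [weakCnt, branch_eq hvS]
        refine (cnt_union_le ((Set.finite_singleton v).union (finite_branch hS _))
          (finite_branch hS _) A 0).trans ?_
        refine mul_le_mul_of_nonneg_right ?_ (cnt_nonneg _ _ _)
        refine (cnt_union_le (Set.finite_singleton v) (finite_branch hS _) A 0).trans_eq ?_
        rw [hAv, one_mul, weakCnt]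
      rw [ncard_branch C.finite_toSet hvC, pow_add, pow_add, pow_one]
      calc _ ≤ 2.567 * 2.567 ^ (branch (C : Set Vertex) (child v false)).ncard *
            2.567 ^ (branch (C : Set Vertex) (child v true)).ncard *
            (weakCnt S A (child v false) * weakCnt S A (child v true)) := by gcongr
        _ = 2.567 * ((2.567 ^ (branch (C : Set Vertex) (child v false)).ncard *
              weakCnt S A (child v false)) *
            (2.567 ^ (branch (C : Set Vertex) (child v true)).ncard *
              weakCnt S A (child v true))) := by ring
        _ ≤ 2.567 * (branchBound S C (child v false) * branchBound S C (child v true)) := by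
          refine mul_le_mul_of_nonneg_left ?_ (by norm_num)
          exact mul_le_mul i0 i1 (mul_nonneg (by positivity) (cnt_nonneg _ _ _))
            (branchBound_nonneg hS C (hv.child _))
        _ ≤ _ := branchBound_mul_le hS hCS hv hvC
    · rw [(hC.hereditary v).branch_eq_empty (by simpa using hvC), Set.ncard_empty, branchBound,
        if_neg hvC, pow_zero, one_mul]
      refine weakCnt_le_strongCnt hS hAfull hvS ?_
      simp only [hA, stableIn, hcol hvS, if_true, clusterHeights, hvC, if_false]
      exact Finset.inter_subset_right

lemma IsCluster.pow_mul_cnt_le {S : Set Vertex} (hS : S.Finite) {C : Finset Vertex}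
    (hC : IsCluster C) (hCS : (C : Set Vertex) ⊆ S) (hR : Rooted S origin (true, [])) :
    2.567 ^ C.card * cnt S (stableIn (collar S C) (clusterHeights C)) 0 ≤ 2 * cnt S full 0 := by
  set A := stableIn (collar S C) (clusterHeights C) with hA
  have h1 := pow_mul_weakCnt_le hS hC hCS hR.left fun _ => subset_collar S C hC.1
  have h2 := pow_mul_weakCnt_le hS hC hCS hR.right fun h =>
    mem_collar_of_adj hC.1 h (adj_iff_up.2 (Or.inl rfl))
  have hcard : C.card = (branch (C : Set Vertex) origin).ncard
      + (branch (C : Set Vertex) (true, [])).ncard := by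
    rw [← Set.ncard_union_eq hC.rooted.bridge.disj (finite_branch C.finite_toSet _)
      (finite_branch C.finite_toSet _), ← hC.rooted.eq_union, Set.ncard_coe_finset]
  have hcnt : cnt S A 0 ≤ weakCnt S A origin * weakCnt S A (true, []) := by
    conv_lhs => rw [hR.eq_union]
    exact cnt_union_le (finite_branch hS _) (finite_branch hS _) A 0
  have h3 := hR.cnt_full_ge hS
  have b1 := branchBound_le hS C hR.left
  have b2 := branchBound_le hS C hR.right
  have n1 := branchBound_nonneg hS C hR.left
  have n2 := branchBound_nonneg hS C hR.right
  have w1 := (strongCnt_bounds hS hR.left).1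
  have w2 := (strongCnt_bounds hS hR.right).1
  rw [hcard, pow_add]
  calc _ ≤ 2.567 ^ (branch (C : Set Vertex) origin).ncard *
        2.567 ^ (branch (C : Set Vertex) (true, [])).ncard *
        (weakCnt S A origin * weakCnt S A (true, [])) := by gcongr
    _ = (2.567 ^ (branch (C : Set Vertex) origin).ncard * weakCnt S A origin) *
        (2.567 ^ (branch (C : Set Vertex) (true, [])).ncard * weakCnt S A (true, [])) := by ring
    _ ≤ branchBound S C origin * branchBound S C (true, []) :=
        mul_le_mul h1 h2 (mul_nonneg (by positivity) (cnt_nonneg _ _ _)) n1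
    _ ≤ (1.009 * weakCnt S full origin) * (1.009 * weakCnt S full (true, [])) :=
        mul_le_mul b1 b2 n2 (by positivity)
    -- 1.009² ≤ 2 · 3/4, with 3/4 from `Rooted.cnt_full_ge`.
    _ ≤ _ := by nlinarith [mul_pos w1 w2]

lemma collar_eq {S T : Set Vertex} {C : Finset Vertex} (hST : S ⊆ T)
    (h : ∀ v ∈ collar T C, v ∈ T → v ∈ S) : collar S C = collar T C := by
  ext v
  simp only [mem_collar] at h ⊢
  refine or_congr_right (and_congr_right fun hv => ⟨fun h => hST h, fun hvT => ?_⟩)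
  exact h v (Or.inr ⟨hv, hvT⟩) hvT

lemma IsCluster.measure_le {T : Set Vertex} (hT : IsSubtree T) {C : Finset Vertex}
    (hC : IsCluster C) (hCT : (C : Set Vertex) ⊆ T) :
    (sandpileMeasure T).real (heightsIn (collar T C) (clusterHeights C)) ≤
      2 * (2.567⁻¹) ^ C.card := by
  have := isDirected_finiteSubtree hT
  have := nonempty_finiteSubtree hT
  have hRT : Rooted T origin (true, []) := rooted_of_root_mem (s := false) hT (hCT hC.1)
  refine ENNReal.toReal_le_of_le_ofReal (by positivity) ?_
  refine le_of_tendsto (tendsto_heightsIn (isVolumeLimit_sandpileMeasure hT) _ _) ?_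
  filter_upwards [eventually_subset (collar T C)] with S hS
  have hCS : (C : Set Vertex) ⊆ S.1 := fun v hv => hS v (subset_collar T C hv) (hCT hv)
  have hfin := S.1.finite_toSet
  have hR := hRT.mono S.2.1 S.2.2 (hCS hC.1)
  have hpos := hR.cnt_full_pos hfin
  rw [← collar_eq S.2.1 hS, uniformOn_recurrent_apply S.2.2 hfin, recurrent_inter_heightsIn]
  · refine ENNReal.ofReal_le_ofReal ?_
    rw [div_le_iff₀ hpos, inv_pow, mul_right_comm, ← div_eq_mul_inv,
      le_div_iff₀ (by positivity), mul_comm]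
    exact hC.pow_mul_cnt_le hfin hCS hR
  · intro v hv hvS
    exact absurd ((mem_collar.1 hv).elim (fun h => hCS h) fun h => h.2) hvS

/-! ### Bounds on a fixed subtree -/

/-- The exponential factor in the avalanche bounds. -/
def rate : ℝ := 4⁻¹ * (2 : ℝ) ^ (16 / 25 : ℝ)

lemma rate_pos : 0 < rate := by unfold rate; positivity

lemma rate_pow (n : ℕ) : rate ^ n = (4 : ℝ) ^ (-(n : ℝ)) * (2 : ℝ) ^ ((n : ℝ) * (16 / 25)) := by
  rw [rate, mul_pow, Real.rpow_neg (by norm_num), Real.rpow_natCast, inv_pow, mul_comm (n : ℝ),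
    Real.rpow_mul (by norm_num), Real.rpow_natCast]

/-- A close call: 4/2.567 is about 1.55824 and 2^(16/25) about 1.55833. Taking 25th powers makes the
comparison rational. -/
lemma inv_le_rate : (2.567 : ℝ)⁻¹ ≤ rate := by
  have h : (4 / 2.567 : ℝ) ≤ (2 : ℝ) ^ (16 / 25 : ℝ) := by
    refine le_of_pow_le_pow_left₀ (n := 25) (by norm_num) (by positivity) ?_
    rw [← Real.rpow_natCast ((2 : ℝ) ^ (16 / 25 : ℝ)) 25, ← Real.rpow_mul (by norm_num)]
    norm_num
  rw [rate]
  calc (2.567 : ℝ)⁻¹ = 4⁻¹ * (4 / 2.567) := by norm_num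
    _ ≤ _ := by gcongr

theorem avalancheProb_le {T : Set Vertex} (hT : IsSubtree T) {n : ℕ} (hn : 1 ≤ n) :
    avalancheProb T n ≤ 2 * clusterCount T n * rate ^ n := by
  rw [avalancheProb_eq hT hn, clusterCount_eq]
  refine (Finset.sum_le_card_nsmul _ _ (2 * rate ^ n) fun C hC => ?_).trans_eq ?_
  · rw [mem_clustersIn] at hC
    obtain ⟨⟨hC, rfl⟩, hCT⟩ := hC
    refine (hC.measure_le hT hCT).trans ?_
    gcongr
    exact inv_le_rate
  · rw [nsmul_eq_mul]; ring

lemma log_rate : Real.log rate = -(34 / 25 * Real.log 2) := by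
  rw [rate, Real.log_mul (by norm_num) (by positivity), Real.log_inv, Real.log_rpow (by norm_num),
    show (4 : ℝ) = 2 ^ 2 by norm_num, Real.log_pow]
  push_cast
  ring

lemma decaysExponentially_of_eventually {a : ℕ → ℝ} (h1 : ∀ n, a n ≤ 1) {C c : ℝ} (hC : 0 < C)
    (hc : 0 < c) (h : ∀ᶠ n : ℕ in atTop, a n ≤ C * Real.exp (-(c * n))) :
    DecaysExponentially a := by
  obtain ⟨N, hN⟩ := eventually_atTop.1 h
  refine ⟨C + Real.exp (c * N), c, by positivity, hc, fun n _ => ?_⟩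
  rw [add_mul]
  by_cases hn : N ≤ n
  · exact (hN n hn).trans (le_add_of_nonneg_right (by positivity))
  · refine (h1 n).trans (le_add_of_nonneg_of_le (by positivity) ?_)
    rw [← Real.exp_add]
    refine Real.one_le_exp ?_
    have : (n : ℝ) ≤ N := by exact_mod_cast (not_le.1 hn).le
    nlinarith

theorem decaysExponentially_of_growthRate_lt {T : Set Vertex} (hT : IsSubtree T)
    (h : growthRate T < ((34 / 25 * Real.log 2 : ℝ) : EReal)) :
    DecaysExponentially (avalancheProb T) := by
  obtain ⟨r, hr1, hr2⟩ := EReal.lt_iff_exists_real_btwn.1 h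
  rw [EReal.coe_lt_coe_iff] at hr2
  have hev := eventually_lt_of_limsup_lt (u := fun n : ℕ =>
    ENNReal.log (clusterCount T n : ℝ≥0∞) / (n : EReal)) hr1
  refine decaysExponentially_of_eventually (fun n => avalancheProb_le_one hT n)
    (C := 2) (c := 34 / 25 * Real.log 2 - r) (by norm_num) (by linarith) ?_
  filter_upwards [hev, eventually_ge_atTop 1] with n hlt hn
  have hcount : (clusterCount T n : ℝ) ≤ Real.exp (r * n) := by
    by_cases h0 : clusterCount T n = 0
    · rw [h0, Nat.cast_zero]; positivity
    · have hpos : (0 : ℝ) < clusterCount T n := by positivity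
      have e : ENNReal.log (clusterCount T n : ℝ≥0∞) / (n : EReal) =
          ((Real.log (clusterCount T n) / n : ℝ) : EReal) := by
        rw [ENNReal.log_pos_real (by simpa using h0) (by simp), EReal.coe_div]
        simp
      rw [e, EReal.coe_lt_coe_iff, div_lt_iff₀ (by positivity)] at hlt
      rw [← Real.log_le_iff_le_exp hpos]
      exact hlt.le
  calc avalancheProb T n ≤ 2 * clusterCount T n * rate ^ n := avalancheProb_le hT hn
    _ ≤ 2 * Real.exp (r * n) * rate ^ n := by gcongr; exact (pow_pos rate_pos n).le
    _ = _ := by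
      rw [← Real.exp_log rate_pos, ← Real.exp_nat_mul, mul_assoc, ← Real.exp_add, log_rate]
      congr 2
      ring

/-! ### Averages over random trees -/

lemma isSubtree_of_parent_mem {T : Set Vertex} (ho : origin ∈ T)
    (h : ∀ v b, child v b ∈ T → v ∈ T) : IsSubtree T := by
  have hreach : ∀ (l : List Bool) (s : Bool) (hv : (s, l) ∈ T),
      (bethe.induce T).Reachable ⟨origin, ho⟩ ⟨(s, l), hv⟩ := by
    intro l
    induction l with
    | nil =>
      intro s hv
      cases s with
      | false => exact SimpleGraph.Reachable.refl _
      | true =>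
        refine SimpleGraph.Adj.reachable ?_
        exact adj_iff.2 (Or.inr (Or.inr ⟨rfl, rfl, by simp [origin]⟩))
    | cons b l ih =>
      intro s hv
      have hp : (s, l) ∈ T := h (s, l) b hv
      refine (ih s hp).trans (SimpleGraph.Adj.reachable ?_)
      exact adj_child (s, l) b
  refine (SimpleGraph.connected_iff_exists_forall_reachable _).2 ⟨⟨origin, ho⟩, ?_⟩
  rintro ⟨⟨s, l⟩, hv⟩
  exact hreach l s hv

lemma IsSubtree.parent_mem_of_origin {T : Set Vertex} (hT : IsSubtree T) (ho : origin ∈ T)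
    (v : Vertex) (b : Bool) (hv : child v b ∈ T) : v ∈ T :=
  parent_mem hT hv ho fun h => by
    have := length_le_of_mem_descendants h
    simp [child, origin] at this

lemma isSubtree_inter_ball {T : Set Vertex} (hT : IsSubtree T) (ho : origin ∈ T) (m : ℕ) :
    IsSubtree (T ∩ ball m) :=
  isSubtree_of_parent_mem ⟨ho, by simp [ball, origin]⟩ fun v b h =>
    ⟨hT.parent_mem_of_origin ho v b h.1, by
      have := h.2
      simp only [ball, child, Set.mem_ofPred_eq, List.length_cons] at this ⊢
      omega⟩

/-- The finite subtrees `T ∩ ball m` exhaust `T`. -/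
def exhaustion {T : Set Vertex} (hT : IsSubtree T) (ho : origin ∈ T) (m : ℕ) : FiniteSubtree T :=
  ⟨((finite_ball m).inter_of_right T).toFinset, by simp,
    by simpa using isSubtree_inter_ball hT ho m⟩

lemma coe_exhaustion {T : Set Vertex} (hT : IsSubtree T) (ho : origin ∈ T) (m : ℕ) :
    ((exhaustion hT ho m).1 : Set Vertex) = T ∩ ball m := by simp [exhaustion]

lemma tendsto_exhaustion {T : Set Vertex} (hT : IsSubtree T) (ho : origin ∈ T) :
    Tendsto (exhaustion hT ho) atTop atTop := by
  rw [tendsto_atTop]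
  intro S
  obtain ⟨d, hd⟩ := exists_length_lt S.1.finite_toSet
  filter_upwards [eventually_ge_atTop d] with m hm v hv
  have : v ∈ T ∩ ball m := ⟨S.2.1 hv, (hd v hv).le.trans hm⟩
  rwa [← coe_exhaustion hT ho] at this

lemma sandpileMeasure_of_finite {T : Set Vertex} (hT : T.Finite) :
    sandpileMeasure T = uniformOn (recurrent T) := if_pos hT

/-- Only finitely many clusters of size `n` occur, and large balls contain them with their collars,
so this is convergence of finitely many local events. It reduces measurability in the random tree to
finite trees. -/
lemma tendsto_avalancheProb {T : Set Vertex} (hT : IsSubtree T) (ho : origin ∈ T) {n : ℕ}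
    (hn : 1 ≤ n) :
    Tendsto (fun m => avalancheProb (T ∩ ball m) n) atTop (𝓝 (avalancheProb T n)) := by
  have hμ := isVolumeLimit_sandpileMeasure hT
  have := hμ.1
  have hsum : Tendsto (fun m => ∑ C ∈ clustersIn T n,
      (uniformOn (recurrent ((exhaustion hT ho m).1 : Set Vertex))).real
        (heightsIn (collar T C) (clusterHeights C))) atTop (𝓝 (avalancheProb T n)) := by
    rw [avalancheProb_eq hT hn]
    refine tendsto_finsetSum _ fun C _ => ?_
    exact (ENNReal.tendsto_toReal (measure_ne_top _ _)).comp
      ((tendsto_heightsIn hμ _ _).comp (tendsto_exhaustion hT ho))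
  refine hsum.congr' ?_
  have hcol : ∀ᶠ m in atTop, ∀ C ∈ clustersIn T n, ∀ v ∈ collar T C, v ∈ T →
      v ∈ (exhaustion hT ho m).1 :=
    (tendsto_exhaustion hT ho).eventually
      ((eventually_all_finset _).2 fun C _ => eventually_subset (collar T C))
  filter_upwards [hcol, eventually_ge_atTop n] with m hm hmn
  rw [avalancheProb_eq (isSubtree_inter_ball hT ho m) hn,
    sandpileMeasure_of_finite ((finite_ball m).inter_of_right T)]
  have hc : clustersIn (T ∩ ball m) n = clustersIn T n := by
    ext C
    rw [mem_clustersIn, mem_clustersIn]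
    refine and_congr_right fun hC => ⟨fun h => h.trans Set.inter_subset_left, fun h v hv =>
      ⟨h hv, ?_⟩⟩
    have := hC.1.length_lt hv
    simp only [ball, Set.mem_ofPred_eq]
    omega
  rw [hc, coe_exhaustion]
  refine Finset.sum_congr rfl fun C hC => ?_
  rw [collar_eq (S := T ∩ ball m) Set.inter_subset_left fun v hv hvT => by
    rw [← coe_exhaustion hT ho]; exact hm C hC v hv hvT]

/-- A random subtree that contains the origin. -/
structure IsRandomSubtree (𝒯 : (Vertex → Bool) → Set Vertex) : Prop where
  isSubtree : ∀ ω, IsSubtree (𝒯 ω)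
  origin_mem : ∀ ω, origin ∈ 𝒯 ω
  measurable : ∀ v, MeasurableSet {ω | v ∈ 𝒯 ω}

/-- The measure of an infinite tree is obtained by choice, so measurability is derived from finite
truncations: each depends only on the membership of the finitely many vertices of a ball. -/
lemma IsRandomSubtree.measurable_avalancheProb {𝒯 : (Vertex → Bool) → Set Vertex}
    (h : IsRandomSubtree 𝒯) {n : ℕ} (hn : 1 ≤ n) :
    Measurable fun ω => avalancheProb (𝒯 ω) n := by
  classical
  refine measurable_of_tendsto_metrizable (f := fun m ω => avalancheProb (𝒯 ω ∩ ball m) n) ?_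
    (tendsto_pi_nhds.2 fun ω => tendsto_avalancheProb (h.isSubtree ω) (h.origin_mem ω) hn)
  intro m
  have := (finite_ball m).to_subtype
  let g : (ball m → Bool) → ℝ := fun f => avalancheProb {v | ∃ hv : v ∈ ball m, f ⟨v, hv⟩ = true} n
  have e : (fun ω => avalancheProb (𝒯 ω ∩ ball m) n) =
      g ∘ fun ω (v : ball m) => decide ((v : Vertex) ∈ 𝒯 ω) := by
    funext ω
    simp only [g, Function.comp_apply, decide_eq_true_eq]
    congr 1
    ext v
    simp [and_comm]
  rw [e]
  refine (measurable_of_finite g).comp (measurable_pi_lambda _ fun v => measurable_to_bool ?_)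
  convert h.measurable v using 1
  ext ω
  simp

instance isProbabilityMeasure_coinLaw (p : unitInterval) : IsProbabilityMeasure (coinLaw p) := by
  unfold coinLaw; infer_instance

lemma IsRandomSubtree.annealedIntegrable {𝒯 : (Vertex → Bool) → Set Vertex}
    (h : IsRandomSubtree 𝒯) (p : unitInterval) : AnnealedIntegrable 𝒯 p := fun n hn =>
  Integrable.of_bound (C := 1) (h.measurable_avalancheProb hn).aestronglyMeasurable
    (Eventually.of_forall fun ω => by
      rw [Real.norm_of_nonneg (avalancheProb_nonneg _ _)]
      exact avalancheProb_le_one (h.isSubtree ω) n)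

lemma IsRandomSubtree.measurableSet_subset {𝒯 : (Vertex → Bool) → Set Vertex}
    (h : IsRandomSubtree 𝒯) (C : Finset Vertex) : MeasurableSet {ω | (C : Set Vertex) ⊆ 𝒯 ω} := by
  have : {ω | (C : Set Vertex) ⊆ 𝒯 ω} = ⋂ v ∈ C, {ω | v ∈ 𝒯 ω} := by
    ext ω; simp [Set.subset_def]
  rw [this]
  exact C.measurableSet_biInter fun v _ => h.measurable v

lemma IsRandomSubtree.annealedProb_le {𝒯 : (Vertex → Bool) → Set Vertex}
    (h : IsRandomSubtree 𝒯) (p : unitInterval) {n : ℕ} (hn : 1 ≤ n) :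
    annealedProb 𝒯 p n ≤
      2 * rate ^ n * ∑ C ∈ clusters n, (coinLaw p).real {ω | (C : Set Vertex) ⊆ 𝒯 ω} := by
  classical
  have hi : ∀ C ∈ clusters n, Integrable
      ({ω | (C : Set Vertex) ⊆ 𝒯 ω}.indicator fun _ => (1 : ℝ)) (coinLaw p) := fun C _ =>
    (integrable_const 1).indicator (h.measurableSet_subset C)
  have hcount : ∀ ω, (clusterCount (𝒯 ω) n : ℝ) =
      ∑ C ∈ clusters n, {ω | (C : Set Vertex) ⊆ 𝒯 ω}.indicator (fun _ => (1 : ℝ)) ω := by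
    intro ω
    rw [clusterCount_eq, clustersIn, Finset.card_filter]
    push_cast
    refine Finset.sum_congr rfl fun C _ => ?_
    simp only [Set.indicator_apply, Set.mem_ofPred_eq]
  calc annealedProb 𝒯 p n ≤ ∫ ω, 2 * rate ^ n * ∑ C ∈ clusters n,
        {ω | (C : Set Vertex) ⊆ 𝒯 ω}.indicator (fun _ => (1 : ℝ)) ω ∂(coinLaw p) := by
        refine integral_mono (h.annealedIntegrable p n hn)
          ((integrable_finsetSum _ hi).const_mul _) fun ω => ?_
        simp only
        rw [← hcount]
        exact (avalancheProb_le (h.isSubtree ω) hn).trans_eq (by ring)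
    _ = _ := by
        rw [integral_const_mul, integral_finsetSum _ hi]
        congr 1
        refine Finset.sum_congr rfl fun C _ => ?_
        rw [integral_indicator_const _ (h.measurableSet_subset C), smul_eq_mul, mul_one]

lemma coinLaw_real_forall (p : unitInterval) (E : Finset Vertex) :
    (coinLaw p).real {ω | ∀ v ∈ E, ω v = true} = (p : ℝ) ^ E.card := by
  have e : {ω : Vertex → Bool | ∀ v ∈ E, ω v = true} = Set.pi (E : Set Vertex) fun _ => {true} := by
    ext ω; simp
  rw [e, coinLaw, Measure.real, Measure.infinitePi_pi _ fun _ _ => measurableSet_singleton _,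
    ENNReal.toReal_prod]
  simp

/-! ### Weighted enumeration of clusters -/

/-- The connected sets with topmost vertex `v` and depth less than `k` below `v`, and the empty
set. -/
def pieces : ℕ → Vertex → Finset (Finset Vertex)
  | 0, _ => {∅}
  | k + 1, v => insert ∅ ((pieces k (child v false) ×ˢ pieces k (child v true)).image
      fun P => insert v (P.1 ∪ P.2))

lemma empty_mem_pieces (k : ℕ) (v : Vertex) : ∅ ∈ pieces k v := by
  cases k <;> simp [pieces]

lemma mem_pieces {k : ℕ} : ∀ {v : Vertex} {X : Finset Vertex}, X ∈ pieces k v →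
    (X : Set Vertex) ⊆ descendants v ∧ (X.Nonempty → v ∈ X) := by
  induction k with
  | zero =>
    intro v X h
    obtain rfl : X = ∅ := by simpa [pieces] using h
    simp
  | succ k ih =>
    intro v X h
    rw [pieces, Finset.mem_insert, Finset.mem_image] at h
    rcases h with rfl | ⟨⟨Y, Z⟩, hP, rfl⟩
    · simp
    · rw [Finset.mem_product] at hP
      refine ⟨?_, fun _ => Finset.mem_insert_self _ _⟩
      intro u hu
      simp only [Finset.coe_insert, Finset.coe_union, Set.mem_insert_iff, Set.mem_union] at hu
      rcases hu with rfl | hu | hu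
      · exact self_mem_descendants _
      · exact descendants_child_subset v _ ((ih hP.1).1 hu)
      · exact descendants_child_subset v _ ((ih hP.2).1 hu)

open Classical in
/-- The part of `C` below `v`, as a finset. -/
def part (C : Finset Vertex) (v : Vertex) : Finset Vertex := C.filter (· ∈ descendants v)

lemma coe_part (C : Finset Vertex) (v : Vertex) :
    (part C v : Set Vertex) = branch (C : Set Vertex) v := by
  ext u; simp [part, branch]

lemma IsCluster.part_mem_pieces {C : Finset Vertex} (hC : IsCluster C) :
    ∀ (k : ℕ) (v : Vertex), (∀ u ∈ C, u.2.length < v.2.length + k) → part C v ∈ pieces k v := by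
  have hempty : ∀ v ∉ C, part C v = ∅ := fun v hv => by
    rw [← Finset.coe_eq_empty, coe_part, (hC.hereditary v).branch_eq_empty (by simpa using hv)]
  intro k
  induction k with
  | zero =>
    intro v h
    rw [hempty v fun hv => by simpa using h v hv]
    exact empty_mem_pieces _ _
  | succ k ih =>
    intro v h
    by_cases hv : v ∈ C
    · rw [pieces, Finset.mem_insert, Finset.mem_image]
      have hl : ∀ b, ∀ u ∈ C, u.2.length < (child v b).2.length + k := fun b u hu => by
        have := h u hu
        simp only [child, List.length_cons]
        omega
      refine Or.inr ⟨(part C (child v false), part C (child v true)),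
        Finset.mem_product.2 ⟨ih _ (hl _), ih _ (hl _)⟩, ?_⟩
      rw [← Finset.coe_inj]
      push_cast
      rw [coe_part, coe_part, coe_part, branch_eq (T := (C : Set Vertex)) (v := v) hv,
        Set.union_assoc]
      rfl
    · rw [hempty v hv]
      exact empty_mem_pieces _ _

lemma sum_pieces_succ_le {g : Finset Vertex → ℝ} (hg : ∀ X, 0 ≤ g X) (h0 : g ∅ = 1) (k : ℕ)
    (v : Vertex) : ∑ X ∈ pieces (k + 1) v, g X ≤
      1 + ∑ X ∈ pieces k (child v false), ∑ Y ∈ pieces k (child v true), g (insert v (X ∪ Y)) := by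
  rw [pieces, Finset.sum_insert, h0, ← Finset.sum_product']
  · gcongr
    exact Finset.sum_image_le_of_nonneg fun X _ => hg X
  · rw [Finset.mem_image]
    rintro ⟨P, -, h⟩
    exact Finset.insert_ne_empty _ _ h

/-- Cutting the edge between the two roots splits a cluster into a piece on each side, the one at
`(true, [])` possibly empty. Depth `n` is enough for clusters of size `n`. -/
lemma sum_clusters_le {g : Finset Vertex → ℝ} (hg : ∀ X, 0 ≤ g X) {B : ℝ} {n : ℕ} (hB : 0 ≤ B)
    (h1 : ∑ X ∈ pieces n origin, g X ≤ B) (h2 : ∑ X ∈ pieces n (true, []), g X ≤ B)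
    (hmul : ∀ X ∈ pieces n origin, ∀ Y ∈ pieces n (true, []), g (X ∪ Y) ≤ g X * g Y) :
    ∑ C ∈ clusters n, g C ≤ B ^ 2 := by
  have hsub : clusters n ⊆ (pieces n origin ×ˢ pieces n (true, [])).image fun P => P.1 ∪ P.2 := by
    intro C hC
    obtain ⟨h, rfl⟩ := mem_clusters.1 hC
    rw [Finset.mem_image]
    refine ⟨(part C origin, part C (true, [])), Finset.mem_product.2
      ⟨h.part_mem_pieces _ _ fun u hu => ?_, h.part_mem_pieces _ _ fun u hu => ?_⟩, ?_⟩
    · simpa [origin] using h.length_lt hu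
    · simpa using h.length_lt hu
    · rw [← Finset.coe_inj]
      push_cast
      rw [coe_part, coe_part, ← h.rooted.eq_union]
  calc ∑ C ∈ clusters n, g C
      ≤ ∑ C ∈ (pieces n origin ×ˢ pieces n (true, [])).image fun P => P.1 ∪ P.2, g C :=
        Finset.sum_le_sum_of_subset_of_nonneg hsub fun C _ _ => hg C
    _ ≤ ∑ P ∈ pieces n origin ×ˢ pieces n (true, []), g (P.1 ∪ P.2) :=
        Finset.sum_image_le_of_nonneg fun X _ => hg X
    _ ≤ ∑ P ∈ pieces n origin ×ˢ pieces n (true, []), g P.1 * g P.2 :=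
        Finset.sum_le_sum fun P hP =>
          hmul _ (Finset.mem_product.1 hP).1 _ (Finset.mem_product.1 hP).2
    _ = (∑ X ∈ pieces n origin, g X) * ∑ Y ∈ pieces n (true, []), g Y := by
        rw [Finset.sum_mul_sum, Finset.sum_product]
    _ ≤ B ^ 2 := by
        rw [sq]
        exact mul_le_mul h1 h2 (Finset.sum_nonneg fun X _ => hg X) hB

/-! ### Generating functions weighted by forced coins -/

/-- The weight of a finite set with `E X` its set of coins. -/
def weight (ρ q : ℝ) (E : Finset Vertex → Finset Vertex) (X : Finset Vertex) : ℝ :=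
  ρ ^ X.card * q ^ (E X).card

/-- The vertices of `C` with a child in `C`. -/
def binaryCoins (C : Finset Vertex) : Finset Vertex := C.filter fun v => ∃ b, child v b ∈ C

/-- The vertices of `C` other than the roots. -/
def binomialCoins (C : Finset Vertex) : Finset Vertex := C.filter fun v => v.2 ≠ []

lemma weight_nonneg {ρ q : ℝ} (hρ : 0 ≤ ρ) (hq : 0 ≤ q) (E : Finset Vertex → Finset Vertex)
    (X : Finset Vertex) : 0 ≤ weight ρ q E X := by unfold weight; positivity

lemma pow_card_le_mul {q : ℝ} (hq : 0 ≤ q) (hq1 : q ≤ 1) {A B E : Finset Vertex}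
    (hAB : Disjoint A B) (hE : A ∪ B ⊆ E) : q ^ E.card ≤ q ^ A.card * q ^ B.card := by
  rw [← pow_add, ← Finset.card_union_of_disjoint hAB]
  exact pow_le_pow_of_le_one hq hq1 (Finset.card_le_card hE)

lemma disjoint_of_subset_descendants {X Y : Finset Vertex} {u v : Vertex}
    (hd : Disjoint (descendants u) (descendants v)) (hX : (X : Set Vertex) ⊆ descendants u)
    (hY : (Y : Set Vertex) ⊆ descendants v) : Disjoint X Y := by
  rw [← Finset.disjoint_coe]
  exact hd.mono hX hY

lemma disjoint_descendants_roots : Disjoint (descendants origin) (descendants (true, [])) :=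
  Set.disjoint_left.2 fun u h h' => by
    have := h.1.symm.trans h'.1
    simp [origin] at this

lemma weight_union_le {ρ q : ℝ} (hρ : 0 ≤ ρ) (hq : 0 ≤ q) (hq1 : q ≤ 1)
    {E : Finset Vertex → Finset Vertex} (hE : ∀ X, E X ⊆ X) (hmono : Monotone E)
    {X Y : Finset Vertex} (hXY : Disjoint X Y) :
    weight ρ q E (X ∪ Y) ≤ weight ρ q E X * weight ρ q E Y := by
  unfold weight
  rw [Finset.card_union_of_disjoint hXY, pow_add]
  have := pow_card_le_mul hq hq1 (hXY.mono (hE X) (hE Y)) (Finset.union_subset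
    (hmono (Finset.subset_union_left (s₁ := X) (s₂ := Y))) (hmono Finset.subset_union_right))
  calc _ ≤ ρ ^ X.card * ρ ^ Y.card * (q ^ (E X).card * q ^ (E Y).card) := by gcongr
    _ = _ := by ring

lemma weight_insert_le {ρ q : ℝ} (hρ : 0 ≤ ρ) (hq : 0 ≤ q) (hq1 : q ≤ 1)
    {E : Finset Vertex → Finset Vertex} (hE : ∀ X, E X ⊆ X) (hmono : Monotone E)
    {X : Finset Vertex} {v : Vertex} (hv : v ∉ X) :
    weight ρ q E (insert v X) ≤ ρ * (if v ∈ E (insert v X) then q else 1) * weight ρ q E X := by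
  unfold weight
  have h1 : E X ⊆ E (insert v X) := hmono (Finset.subset_insert v X)
  rw [Finset.card_insert_of_notMem hv, pow_succ]
  split_ifs with h
  · have := pow_card_le_mul hq hq1 (A := {v}) (B := E X)
      (Finset.disjoint_singleton_left.2 fun h => hv (hE X h))
      (Finset.union_subset (by simpa using h) h1)
    rw [Finset.card_singleton, pow_one] at this
    calc _ ≤ ρ ^ X.card * ρ * (q * q ^ (E X).card) := by gcongr
      _ = _ := by ring
  · have := pow_le_pow_of_le_one hq hq1 (Finset.card_le_card h1)
    calc _ ≤ ρ ^ X.card * ρ * q ^ (E X).card := by gcongr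
      _ = _ := by ring

lemma binaryCoins_subset (X : Finset Vertex) : binaryCoins X ⊆ X := Finset.filter_subset _ _

lemma binaryCoins_mono : Monotone binaryCoins := fun X Y h v hv => by
  simp only [binaryCoins, Finset.mem_filter] at hv ⊢
  exact ⟨h hv.1, hv.2.imp fun b hb => h hb⟩

lemma binomialCoins_subset (X : Finset Vertex) : binomialCoins X ⊆ X := Finset.filter_subset _ _

lemma binomialCoins_mono : Monotone binomialCoins := fun X Y h v hv => by
  simp only [binomialCoins, Finset.mem_filter] at hv ⊢
  exact ⟨h hv.1, hv.2⟩

lemma weight_empty {ρ q : ℝ} {E : Finset Vertex → Finset Vertex} (hE : ∀ X, E X ⊆ X) :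
    weight ρ q E ∅ = 1 := by
  simp [weight, Finset.subset_empty.1 (hE ∅)]

lemma weight_piece_le {ρ q : ℝ} (hρ : 0 ≤ ρ) (hq : 0 ≤ q) (hq1 : q ≤ 1)
    {E : Finset Vertex → Finset Vertex} (hE : ∀ X, E X ⊆ X) (hmono : Monotone E) {k : ℕ}
    {v : Vertex} {X Y : Finset Vertex} (hX : X ∈ pieces k (child v false))
    (hY : Y ∈ pieces k (child v true)) :
    weight ρ q E (insert v (X ∪ Y)) ≤ ρ * (if v ∈ E (insert v (X ∪ Y)) then q else 1) *
      (weight ρ q E X * weight ρ q E Y) := by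
  have hv : v ∉ X ∪ Y := by
    rw [Finset.mem_union]
    rintro (h | h)
    · exact notMem_descendants_child _ _ ((mem_pieces hX).1 h)
    · exact notMem_descendants_child _ _ ((mem_pieces hY).1 h)
  refine (weight_insert_le hρ hq hq1 hE hmono hv).trans ?_
  refine mul_le_mul_of_nonneg_left (weight_union_le hρ hq hq1 hE hmono ?_) ?_
  · exact disjoint_of_subset_descendants (disjoint_descendants_child v) (mem_pieces hX).1
      (mem_pieces hY).1
  · split_ifs <;> positivity

/-- `F` bounds the generating function of nonempty pieces: a supersolution of the recursion is
preserved at every depth. The topmost vertex costs `q` unless both child pieces are empty, when it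
costs 1; this is the term `1 - q`. -/
lemma sum_binary_le {ρ q F : ℝ} (hρ : 0 ≤ ρ) (hq : 0 ≤ q) (hq1 : q ≤ 1) (hF0 : 0 ≤ F)
    (hF : ρ * (q * (1 + F) ^ 2 + (1 - q)) ≤ F) (k : ℕ) :
    ∀ v, ∑ X ∈ pieces k v, weight ρ q binaryCoins X ≤ 1 + F := by
  have hnn := weight_nonneg hρ hq binaryCoins
  induction k with
  | zero =>
    intro v
    simp only [pieces, Finset.sum_singleton, weight_empty binaryCoins_subset]
    linarith
  | succ k ih =>
    intro v
    refine (sum_pieces_succ_le hnn (weight_empty binaryCoins_subset) k v).trans ?_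
    gcongr
    refine le_trans ?_ hF
    calc _ ≤ ∑ X ∈ pieces k (child v false), ∑ Y ∈ pieces k (child v true),
          ρ * (q * (weight ρ q binaryCoins X * weight ρ q binaryCoins Y) +
            (1 - q) * (if X = ∅ then if Y = ∅ then 1 else 0 else 0)) := by
          refine Finset.sum_le_sum fun X hX => Finset.sum_le_sum fun Y hY => ?_
          have h1 := weight_piece_le hρ hq hq1 binaryCoins_subset binaryCoins_mono hX hY
          have hcoin : ∀ b Z, Z ∈ pieces k (child v b) → Z ⊆ X ∪ Y → Z ≠ ∅ →
              v ∈ binaryCoins (insert v (X ∪ Y)) := by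
            intro b Z hZ hZs hne
            simp only [binaryCoins, Finset.mem_filter, Finset.mem_insert, true_or, true_and]
            exact ⟨b, Or.inr (hZs ((mem_pieces hZ).2 (Finset.nonempty_iff_ne_empty.2 hne)))⟩
          by_cases hX0 : X = ∅
          · by_cases hY0 : Y = ∅
            · subst hX0; subst hY0
              refine h1.trans ?_
              rw [weight_empty binaryCoins_subset]
              simp only [↓reduceIte]
              split_ifs <;> nlinarith
            · rw [if_pos (hcoin true Y hY Finset.subset_union_right hY0)] at h1
              simp only [hX0, hY0, if_true, if_false] at h1 ⊢
              linarith
          · rw [if_pos (hcoin false X hX Finset.subset_union_left hX0)] at h1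
            simp only [hX0, if_false] at h1 ⊢
            linarith
      _ = ρ * (q * ((∑ X ∈ pieces k (child v false), weight ρ q binaryCoins X) *
            ∑ Y ∈ pieces k (child v true), weight ρ q binaryCoins Y) + (1 - q)) := by
          simp only [← Finset.mul_sum, Finset.sum_add_distrib, Finset.sum_mul_sum]
          congr 3
          have : ∀ X : Finset Vertex, (∑ Y ∈ pieces k (child v true),
              if X = ∅ then if Y = ∅ then (1 : ℝ) else 0 else 0) = if X = ∅ then 1 else 0 := by
            intro X
            split_ifs
            · rw [Finset.sum_ite_eq', if_pos (empty_mem_pieces _ _)]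
            · exact Finset.sum_const_zero
          simp only [this]
          rw [Finset.sum_ite_eq', if_pos (empty_mem_pieces _ _), mul_one]
      _ ≤ _ := by
          rw [sq]
          have := mul_le_mul (ih (child v false)) (ih (child v true))
            (Finset.sum_nonneg fun X _ => hnn X) (by linarith)
          gcongr

lemma sum_binomial_step {ρ q : ℝ} (hρ : 0 ≤ ρ) (hq : 0 ≤ q) (hq1 : q ≤ 1) (k : ℕ) (v : Vertex)
    {r : ℝ} (hr : 0 ≤ r) (hvr : (if v.2 ≠ [] then q else 1) ≤ r)
    (ih : ∀ b, ∑ X ∈ pieces k (child v b), weight ρ q binomialCoins X ≤ 2) :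
    ∑ X ∈ pieces (k + 1) v, weight ρ q binomialCoins X ≤ 1 + 4 * ρ * r := by
  have hnn := weight_nonneg hρ hq binomialCoins
  refine (sum_pieces_succ_le hnn (weight_empty binomialCoins_subset) k v).trans ?_
  gcongr
  calc _ ≤ ∑ X ∈ pieces k (child v false), ∑ Y ∈ pieces k (child v true),
        ρ * r * (weight ρ q binomialCoins X * weight ρ q binomialCoins Y) := by
        refine Finset.sum_le_sum fun X hX => Finset.sum_le_sum fun Y hY => ?_
        refine (weight_piece_le hρ hq hq1 binomialCoins_subset binomialCoins_mono hX hY).trans ?_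
        have : (v ∈ binomialCoins (insert v (X ∪ Y))) ↔ v.2 ≠ [] := by simp [binomialCoins]
        simp only [this]
        have h1 := hnn X
        have h2 := hnn Y
        gcongr
    _ = ρ * r * ((∑ X ∈ pieces k (child v false), weight ρ q binomialCoins X) *
          ∑ Y ∈ pieces k (child v true), weight ρ q binomialCoins Y) := by
        simp only [← Finset.mul_sum, Finset.sum_mul_sum]
    _ ≤ ρ * r * (2 * 2) := by
        have := mul_le_mul (ih false) (ih true) (Finset.sum_nonneg fun X _ => hnn X) (by norm_num)
        gcongr
    _ = _ := by ring

/-- Away from the roots the recursion is x = 1 + ρ q x², and ρ = 1/(4q) is the critical value, with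
double root x = 2. A root needs no coin, so its last step has factor ρ instead of ρ q and gives 1 +
1/q. -/
lemma sum_binomial_le {q : ℝ} (hq : 0 < q) (hq1 : q ≤ 1) (k : ℕ) (v : Vertex) :
    ∑ X ∈ pieces k v, weight ((4 * q)⁻¹) q binomialCoins X ≤ 1 + 1 / q := by
  have hρ : 0 ≤ (4 * q)⁻¹ := by positivity
  have h2 : ∀ k (v : Vertex), v.2 ≠ [] →
      ∑ X ∈ pieces k v, weight ((4 * q)⁻¹) q binomialCoins X ≤ 2 := by
    intro k
    induction k with
    | zero =>
      intro v _
      simp only [pieces, Finset.sum_singleton, weight_empty binomialCoins_subset]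
      norm_num
    | succ k ih =>
      intro v hv
      refine (sum_binomial_step hρ hq.le hq1 k v hq.le (by simp [hv])
        fun b => ih _ (by simp [child])).trans_eq ?_
      field_simp
      norm_num
  cases k with
  | zero =>
    simp only [pieces, Finset.sum_singleton, weight_empty binomialCoins_subset]
    linarith [one_div_pos.2 hq]
  | succ k =>
    refine (sum_binomial_step hρ hq.le hq1 k v zero_le_one (by split_ifs <;> linarith)
      fun b => h2 _ _ (by simp [child])).trans_eq ?_
    field_simp

/-! ### Exponential decay of averaged probabilities -/

/-- The presence of `C` forces the coins in `E C`, which costs p to their number. Only `p ≤ q` is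
required, so that degenerate small `p` can be treated with a larger parameter. -/
lemma IsRandomSubtree.annealedProb_le_of_sum {𝒯 : (Vertex → Bool) → Set Vertex}
    (h : IsRandomSubtree 𝒯) {E : Finset Vertex → Finset Vertex}
    (hE : ∀ ω (C : Finset Vertex), (C : Set Vertex) ⊆ 𝒯 ω → ∀ v ∈ E C, ω v = true)
    {p : unitInterval} {q ρ B : ℝ} (hpq : (p : ℝ) ≤ q) (hρ : 0 < ρ) {n : ℕ} (hn : 1 ≤ n)
    (hB : ∑ C ∈ clusters n, weight ρ q E C ≤ B) :
    annealedProb 𝒯 p n ≤ 2 * B * (rate * ρ⁻¹) ^ n := by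
  have h1 : ∑ C ∈ clusters n, (coinLaw p).real {ω | (C : Set Vertex) ⊆ 𝒯 ω} ≤ (ρ⁻¹) ^ n * B := by
    calc _ ≤ ∑ C ∈ clusters n, (ρ⁻¹) ^ n * weight ρ q E C := by
          refine Finset.sum_le_sum fun C hC => ?_
          obtain ⟨-, rfl⟩ := mem_clusters.1 hC
          rw [weight, ← mul_assoc, ← mul_pow, inv_mul_cancel₀ hρ.ne', one_pow, one_mul]
          calc _ ≤ (coinLaw p).real {ω | ∀ v ∈ E C, ω v = true} :=
                measureReal_mono fun ω hω => hE ω C hω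
            _ = (p : ℝ) ^ (E C).card := coinLaw_real_forall p _
            _ ≤ _ := pow_le_pow_left₀ p.2.1 hpq _
      _ ≤ _ := by
          rw [← Finset.mul_sum]
          gcongr
  have := rate_pos
  calc _ ≤ _ := h.annealedProb_le p hn
    _ ≤ 2 * rate ^ n * ((ρ⁻¹) ^ n * B) := by gcongr
    _ = _ := by rw [mul_pow]; ring

/-- `F = 1/√q` maximizes ρ = F/(q(1 + F)² + 1 - q), the largest ρ allowed by `sum_binary_le`; the
maximum is 1/(2(q + √q)), so the hypothesis on `F` holds with equality. -/
lemma IsRandomSubtree.annealedProb_binary_le {𝒯 : (Vertex → Bool) → Set Vertex}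
    (h : IsRandomSubtree 𝒯)
    (hE : ∀ ω (C : Finset Vertex), (C : Set Vertex) ⊆ 𝒯 ω → ∀ v ∈ binaryCoins C, ω v = true)
    {p : unitInterval} {q : ℝ} (hpq : (p : ℝ) ≤ q) (hq : 0 < q) (hq1 : q ≤ 1) {n : ℕ}
    (hn : 1 ≤ n) :
    annealedProb 𝒯 p n ≤
      2 * (1 + 1 / √q) ^ 2 * ((2 : ℝ) ^ (16 / 25 : ℝ) * ((q + √q) / 2)) ^ n := by
  have hs : 0 < √q := Real.sqrt_pos.2 hq
  have hss : √q * √q = q := Real.mul_self_sqrt hq.le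
  set ρ := (2 * (q + √q))⁻¹ with hρdef
  have hρ : 0 < ρ := by positivity
  have hF : ρ * (q * (1 + 1 / √q) ^ 2 + (1 - q)) ≤ 1 / √q := by
    rw [hρdef, inv_mul_le_iff₀ (by positivity)]
    have e : q * (1 + 1 / √q) ^ 2 = q + 2 * √q + 1 := by
      have : q * (1 + 1 / √q) ^ 2 = (√q * (1 + 1 / √q)) ^ 2 := by rw [mul_pow, sq √q, hss]
      rw [this, mul_add, mul_one_div_cancel hs.ne']
      nlinarith
    have e' : 2 * (q + √q) * (1 / √q) = 2 * √q + 2 := by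
      field_simp
      nlinarith
    rw [e, e']
    linarith
  have hsum := sum_binary_le hρ.le hq.le hq1 (by positivity) hF n
  have := h.annealedProb_le_of_sum hE hpq hρ hn (sum_clusters_le
    (weight_nonneg hρ.le hq.le binaryCoins) (by positivity) (hsum origin) (hsum (true, []))
    fun X hX Y hY => weight_union_le hρ.le hq.le hq1 binaryCoins_subset binaryCoins_mono
      (disjoint_of_subset_descendants disjoint_descendants_roots (mem_pieces hX).1
        (mem_pieces hY).1))
  refine this.trans_eq ?_
  rw [hρdef, inv_inv, rate]
  congr 2
  ring

lemma IsRandomSubtree.annealedProb_binomial_le {𝒯 : (Vertex → Bool) → Set Vertex}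
    (h : IsRandomSubtree 𝒯)
    (hE : ∀ ω (C : Finset Vertex), (C : Set Vertex) ⊆ 𝒯 ω → ∀ v ∈ binomialCoins C, ω v = true)
    {p : unitInterval} {q : ℝ} (hpq : (p : ℝ) ≤ q) (hq : 0 < q) (hq1 : q ≤ 1) {n : ℕ}
    (hn : 1 ≤ n) :
    annealedProb 𝒯 p n ≤ 2 * (1 + 1 / q) ^ 2 * ((2 : ℝ) ^ (16 / 25 : ℝ) * q) ^ n := by
  have hρ : 0 < (4 * q)⁻¹ := by positivity
  have hsum := sum_binomial_le hq hq1 n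
  have := h.annealedProb_le_of_sum hE hpq hρ hn (sum_clusters_le
    (weight_nonneg hρ.le hq.le binomialCoins) (by positivity) (hsum origin) (hsum (true, []))
    fun X hX Y hY => weight_union_le hρ.le hq.le hq1 binomialCoins_subset binomialCoins_mono
      (disjoint_of_subset_descendants disjoint_descendants_roots (mem_pieces hX).1
        (mem_pieces hY).1))
  refine this.trans_eq ?_
  rw [inv_inv, rate]
  congr 2
  ring

lemma decaysExponentially_of_geometric {a : ℕ → ℝ} {K θ : ℝ} (hK : 0 < K) (hθ : 0 < θ)
    (hθ1 : θ < 1) (h : ∀ n, 1 ≤ n → a n ≤ K * θ ^ n) : DecaysExponentially a := by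
  refine ⟨K, -Real.log θ, hK, by linarith [Real.log_neg hθ hθ1], fun n hn => (h n hn).trans_eq ?_⟩
  rw [neg_mul, neg_neg, mul_comm _ (n : ℝ), Real.exp_nat_mul, Real.exp_log hθ]

/-! ### The four random trees -/

lemma measurableSet_coin (v : Vertex) : MeasurableSet {ω : Vertex → Bool | ω v = true} := by
  have h : Measurable fun ω : Vertex → Bool => ω v := measurable_pi_apply v
  exact h (measurableSet_singleton true)

lemma measurableSet_binaryPresent (s : Bool) (l : List Bool) :
    MeasurableSet {ω | binaryPresent ω s l} := by
  induction l with
  | nil => simp [binaryPresent]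
  | cons b l ih => exact ih.inter (measurableSet_coin (s, l))

lemma measurableSet_binomialPresent (s : Bool) (l : List Bool) :
    MeasurableSet {ω | binomialPresent ω s l} := by
  induction l with
  | nil => simp [binomialPresent]
  | cons b l ih => exact ih.inter (measurableSet_coin (s, b :: l))

lemma isRandomSubtree_binaryTree : IsRandomSubtree binaryTree where
  isSubtree _ := isSubtree_of_parent_mem trivial fun _ _ h => h.1
  origin_mem _ := trivial
  measurable v := measurableSet_binaryPresent v.1 v.2

lemma isRandomSubtree_rootedBinaryTree : IsRandomSubtree rootedBinaryTree where
  isSubtree _ := isSubtree_of_parent_mem ⟨rfl, trivial⟩ fun _ _ h => ⟨h.1, h.2.1⟩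
  origin_mem _ := ⟨rfl, trivial⟩
  measurable v := (MeasurableSet.const _).inter (measurableSet_binaryPresent v.1 v.2)

lemma isRandomSubtree_binomialTree : IsRandomSubtree binomialTree where
  isSubtree _ := isSubtree_of_parent_mem trivial fun _ _ h => h.1
  origin_mem _ := trivial
  measurable v := measurableSet_binomialPresent v.1 v.2

lemma isRandomSubtree_rootedBinomialTree : IsRandomSubtree rootedBinomialTree where
  isSubtree _ := isSubtree_of_parent_mem ⟨rfl, trivial⟩ fun _ _ h => ⟨h.1, h.2.1⟩
  origin_mem _ := ⟨rfl, trivial⟩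
  measurable v := (MeasurableSet.const _).inter (measurableSet_binomialPresent v.1 v.2)

lemma coin_of_subset_binaryTree (ω : Vertex → Bool) (C : Finset Vertex)
    (h : (C : Set Vertex) ⊆ binaryTree ω) : ∀ v ∈ binaryCoins C, ω v = true := by
  intro v hv
  obtain ⟨-, b, hb⟩ := Finset.mem_filter.1 hv
  exact (h hb).2

lemma coin_of_subset_binomialTree (ω : Vertex → Bool) (C : Finset Vertex)
    (h : (C : Set Vertex) ⊆ binomialTree ω) : ∀ v ∈ binomialCoins C, ω v = true := by
  rintro ⟨s, l⟩ hv
  obtain ⟨hvC, hl⟩ := Finset.mem_filter.1 hv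
  cases l with
  | nil => exact absurd rfl hl
  | cons b l => exact (h hvC).2

lemma mem_binaryTrees {𝒯 : (Vertex → Bool) → Set Vertex}
    (h : 𝒯 ∈ ({rootedBinaryTree, binaryTree} : Set ((Vertex → Bool) → Set Vertex))) :
    IsRandomSubtree 𝒯 ∧ ∀ ω (C : Finset Vertex), (C : Set Vertex) ⊆ 𝒯 ω →
      ∀ v ∈ binaryCoins C, ω v = true := by
  rcases h with rfl | rfl
  · exact ⟨isRandomSubtree_rootedBinaryTree, fun ω C h =>
      coin_of_subset_binaryTree ω C fun v hv => (h hv).2⟩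
  · exact ⟨isRandomSubtree_binaryTree, coin_of_subset_binaryTree⟩

lemma mem_binomialTrees {𝒯 : (Vertex → Bool) → Set Vertex}
    (h : 𝒯 ∈ ({rootedBinomialTree, binomialTree} : Set ((Vertex → Bool) → Set Vertex))) :
    IsRandomSubtree 𝒯 ∧ ∀ ω (C : Finset Vertex), (C : Set Vertex) ⊆ 𝒯 ω →
      ∀ v ∈ binomialCoins C, ω v = true := by
  rcases h with rfl | rfl
  · exact ⟨isRandomSubtree_rootedBinomialTree, fun ω C h =>
      coin_of_subset_binomialTree ω C fun v hv => (h hv).2⟩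
  · exact ⟨isRandomSubtree_binomialTree, coin_of_subset_binomialTree⟩

/-! ### Numerical constants -/

lemma critical_bounds : 0.6417129 ≤ (2 : ℝ) ^ (-(16 / 25) : ℝ) ∧
    (2 : ℝ) ^ (-(16 / 25) : ℝ) ≤ 0.641713 := by
  have e : ((2 : ℝ) ^ (-(16 / 25) : ℝ)) ^ 25 = (2 ^ 16)⁻¹ := by
    rw [← Real.rpow_natCast, ← Real.rpow_mul (by norm_num)]
    norm_num
  constructor
  · refine le_of_pow_le_pow_left₀ (n := 25) (by norm_num) (by positivity) ?_
    rw [e]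
    norm_num
  · refine le_of_pow_le_pow_left₀ (n := 25) (by norm_num) (by norm_num) ?_
    rw [e]
    norm_num

lemma exists_critical : ∃ pc : ℝ, 0.54511 ≤ pc ∧ pc < 0.54512 ∧
    (pc + √pc) / 2 = (2 : ℝ) ^ (-(16 / 25) : ℝ) := by
  obtain ⟨h1, h2⟩ := critical_bounds
  set c := (2 : ℝ) ^ (-(16 / 25) : ℝ)
  have hr : √(1 + 8 * c) * √(1 + 8 * c) = 1 + 8 * c := Real.mul_self_sqrt (by linarith)
  -- With `pc = s²` the critical equation becomes s² + s = 2c, and this is its nonnegative root.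
  set s := (√(1 + 8 * c) - 1) / 2 with hs
  have hr1 : 1 ≤ √(1 + 8 * c) := Real.one_le_sqrt.2 (by linarith)
  have hs0 : 0 ≤ s := by linarith
  have hsc : s * s + s = 2 * c := by nlinarith
  have b1 : 0.7383157 ≤ s := by
    by_contra h
    push Not at h
    nlinarith
  have b2 : s ≤ 0.738321 := by
    by_contra h
    push Not at h
    nlinarith
  refine ⟨s * s, by nlinarith, by nlinarith, ?_⟩
  rw [Real.sqrt_mul_self hs0]
  linarith

lemma two_rpow_mul_critical : (2 : ℝ) ^ (16 / 25 : ℝ) * (2 : ℝ) ^ (-(16 / 25) : ℝ) = 1 := by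
  rw [← Real.rpow_add (by norm_num)]
  norm_num

lemma two_rpow_nat_mul (n : ℕ) :
    (2 : ℝ) ^ ((n : ℝ) * (16 / 25)) = ((2 : ℝ) ^ (16 / 25 : ℝ)) ^ n := by
  rw [mul_comm, Real.rpow_mul (by norm_num), Real.rpow_natCast]

end TreeSandpile

end

theorem theorem6p3 :
    -- the measure of every subtree is well defined, as the limit over finite subtrees
    (∀ T : Set Vertex, IsSubtree T →
      IsVolumeLimit T (sandpileMeasure T) ∧
        ∀ ν : Measure Config, IsVolumeLimit T ν → ν = sandpileMeasure T) ∧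
    -- (1) every finite or infinite subtree containing the origin
    ((∃ C : ℝ, 0 < C ∧ ∀ T : Set Vertex, IsSubtree T → origin ∈ T → ∀ n : ℕ, 1 ≤ n →
        avalancheProb T n ≤
          C * (clusterCount T n : ℝ) * (4 : ℝ) ^ (-(n : ℝ)) * (2 : ℝ) ^ ((n : ℝ) * (16 / 25))) ∧
      ∀ T : Set Vertex, IsSubtree T → origin ∈ T →
        growthRate T < ((34 / 25 * Real.log 2 : ℝ) : EReal) →
        DecaysExponentially (avalancheProb T)) ∧
    -- (2) the random binary tree, rooted or rootless
    (∀ 𝒯 ∈ ({rootedBinaryTree, binaryTree} : Set ((Vertex → Bool) → Set Vertex)),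
      (∀ p : unitInterval, AnnealedIntegrable 𝒯 p) ∧
      (∀ p : unitInterval, 0 < p → ∃ C : ℝ, 0 < C ∧ ∀ n : ℕ, 1 ≤ n →
        annealedProb 𝒯 p n ≤
          C * (2 : ℝ) ^ ((n : ℝ) * (16 / 25)) * (((p : ℝ) + √(p : ℝ)) / 2) ^ n) ∧
      ∃ pc : ℝ, 0.54511 ≤ pc ∧ pc < 0.54512 ∧ (pc + √pc) / 2 = (2 : ℝ) ^ (-(16 / 25) : ℝ) ∧
        ∀ p : unitInterval, (p : ℝ) < pc → DecaysExponentially (annealedProb 𝒯 p)) ∧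
    -- (3) the random binomial tree, rooted or rootless
    (∀ 𝒯 ∈ ({rootedBinomialTree, binomialTree} : Set ((Vertex → Bool) → Set Vertex)),
      (∀ p : unitInterval, AnnealedIntegrable 𝒯 p) ∧
      (∀ p : unitInterval, 0 < p → ∃ C : ℝ, 0 < C ∧ ∀ n : ℕ, 1 ≤ n →
        annealedProb 𝒯 p n ≤ C * (2 : ℝ) ^ ((n : ℝ) * (16 / 25)) * (p : ℝ) ^ n) ∧
      |(2 : ℝ) ^ (-(16 / 25) : ℝ) - 0.641713| < 0.000001 ∧
        ∀ p : unitInterval, (p : ℝ) < (2 : ℝ) ^ (-(16 / 25) : ℝ) →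
          DecaysExponentially (annealedProb 𝒯 p)) := by
  refine ⟨fun T hT => ⟨isVolumeLimit_sandpileMeasure hT, fun ν hν =>
    isVolumeLimit_unique hT hν (isVolumeLimit_sandpileMeasure hT)⟩,
    ⟨⟨2, by norm_num, fun T hT _ n hn => ?_⟩, fun T hT _ h =>
      decaysExponentially_of_growthRate_lt hT h⟩, fun 𝒯 h𝒯 => ?_, fun 𝒯 h𝒯 => ?_⟩
  · rw [mul_assoc _ ((4 : ℝ) ^ _), ← rate_pow]
    exact avalancheProb_le hT hn
  · obtain ⟨h, hE⟩ := mem_binaryTrees h𝒯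
    refine ⟨h.annealedIntegrable, fun p hp => ?_, ?_⟩
    · have hp0 : (0 : ℝ) < p := hp
      refine ⟨2 * (1 + 1 / √(p : ℝ)) ^ 2, by positivity, fun n hn => ?_⟩
      rw [two_rpow_nat_mul, mul_assoc _ (_ ^ n), ← mul_pow]
      exact h.annealedProb_binary_le hE le_rfl hp0 p.2.2 hn
    · obtain ⟨pc, h1, h2, h3⟩ := exists_critical
      refine ⟨pc, h1, h2, h3, fun p hp => ?_⟩
      -- The constant blows up as p tends to 0; replacing p by at least 1/2, still below the
      -- critical value, covers small p and p = 0 as well.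
      set q := max (p : ℝ) (1 / 2) with hq
      have hq0 : 0 < q := lt_max_of_lt_right (by norm_num)
      have hqc : q < pc := max_lt hp (by linarith)
      refine decaysExponentially_of_geometric (K := 2 * (1 + 1 / √q) ^ 2)
        (θ := (2 : ℝ) ^ (16 / 25 : ℝ) * ((q + √q) / 2)) (by positivity) (by positivity) ?_
        fun n hn => h.annealedProb_binary_le hE (le_max_left _ _) hq0 (by linarith) hn
      rw [← two_rpow_mul_critical, ← h3]
      have := Real.sqrt_le_sqrt hqc.le
      gcongr
  · obtain ⟨h, hE⟩ := mem_binomialTrees h𝒯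
    obtain ⟨h1, h2⟩ := critical_bounds
    refine ⟨h.annealedIntegrable, fun p hp => ?_, ?_, fun p hp => ?_⟩
    · have hp0 : (0 : ℝ) < p := hp
      refine ⟨2 * (1 + 1 / (p : ℝ)) ^ 2, by positivity, fun n hn => ?_⟩
      rw [two_rpow_nat_mul, mul_assoc _ (_ ^ n), ← mul_pow]
      exact h.annealedProb_binomial_le hE le_rfl hp0 p.2.2 hn
    · rw [abs_lt]
      constructor <;> linarith
    · set q := max (p : ℝ) (1 / 2) with hq
      have hq0 : 0 < q := lt_max_of_lt_right (by norm_num)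
      have hqc : q < (2 : ℝ) ^ (-(16 / 25) : ℝ) := max_lt hp (by linarith)
      refine decaysExponentially_of_geometric (K := 2 * (1 + 1 / q) ^ 2)
        (θ := (2 : ℝ) ^ (16 / 25 : ℝ) * q) (by positivity) (by positivity) ?_
        fun n hn => h.annealedProb_binomial_le hE (le_max_left _ _) hq0 (by linarith) hn
      rw [← two_rpow_mul_critical]
      gcongr
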